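/- Let $\Gamma$ be a smooth tropical curve of bidegree $(3,3)$ in $\mathbb{TP}^1\times\mathbb{TP}^1$, i.e. the closure of the corner locus in $\mathbb{R}^2$ of a tropical polynomial $\max_{0\le i,j\le 3}(a_{ij}+is+jt)$, $a_{ij}\in\mathbb{R}$, whose dual Newton subdivision is a unimodular triangulation of the square of side length three. A point $(v_0,\ell)\in\mathbb{R}^2\times\mathbb{R}=\mathbb{R}^3$ encodes the tropical $(1,1)$-curve $\Lambda$ with lowest vertex $v_0$ and top vertex $v_1$, where $v_1=v_0+\ell(1,1)$ if $\ell\ge 0$ and $v_1=v_0+|\ell|(-1,1)$ if $\ell\le 0$; thus $\ell$ is the signed length of its edge, which has slope $1$ if $\ell>0$ and slope $-1$ if $\ell<0$. The curve $\Lambda$ is tritangent to $\Gamma$ if $\Lambda\cap\Gamma$ has three connected components, each of total stable intersection multiplicity $2$, or two components, of total stable intersection multiplicities $2$ and $4$, or is connected, of stable intersection multiplicity $6$. The tritangent classes of $\Gamma$ are the connected components of the set of all $(v_0,\ell)\in\mathbb{R}^3$ encoding curves tritangent to $\Gamma$. Let $\psi\colon\mathbb{R}^3\to\mathbb{R}^3$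 be the piecewise linear map induced by the tropical Segre embedding, $\psi(x,y,z)=(x,z-x,z-x-y)$ if $x+y\ge z$ and $\psi(x,y,z)=(x,y,z-x-y)$ if $x+y\le z$. **Theorem.** (1) For every smooth $\Gamma$, each tritangent class $\Omega$ of $\Gamma$ is connected and is the union of the cells of a finite rational polyhedral complex in $\mathbb{R}^3$ (the facet normals of all cells can be taken rational). The same is true for $\psi^{-1}(\Omega)$. (2) In general, such a class has no coarsest structure as a polyhedral complex: there are a smooth tropical $(3,3)$-curve $\Gamma$ and a tritangent class $\Omega$ of $\Gamma$ such that no polyhedral complex $K_0$ with union $\Omega$ is refined by every polyhedral complex $K$ with union $\Omega$ (that is, every cell of $K$ lies in a cell of $K_0$); and likewise if only rational polyhedral complexes $K_0$, $K$ are admitted. -/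

import Mathlib

open Filter Topology

noncomputable section

namespace Tritangent

/-! ### Smooth tropical curves of bidegree (3,3) -/

/-- Exponents `(i, j)` of a polynomial of bidegree `(3,3)`: the lattice points of the square of
side length three. -/
abbrev Expo : Type := Fin 4 × Fin 4

/-- The value at `p` of the tropical monomial with exponent `m`, for the tropical polynomial
`F(s, t) = max_{(i,j)} (a (i,j) + i s + j t)` (max convention). -/
def monomialVal (a : Expo → ℝ) (m : Expo) (p : ℝ × ℝ) : ℝ :=
  a m + (m.1 : ℕ) * p.1 + (m.2 : ℕ) * p.2

open Classical in
/-- The exponents at which the maximum defining `F(p)` is attained. The convex hulls of these sets,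
as `p` varies, are the cells of the Newton subdivision of the square dual to the tropical curve. -/
def active (a : Expo → ℝ) (p : ℝ × ℝ) : Finset Expo :=
  Finset.univ.filter fun m => ∀ n, monomialVal a n p ≤ monomialVal a m p

theorem active_nonempty (a : Expo → ℝ) (p : ℝ × ℝ) : (active a p).Nonempty := by
  classical
  obtain ⟨m, hm⟩ := Finite.exists_max (fun n : Expo => monomialVal a n p)
  exact ⟨m, by simpa [active] using hm⟩

/-- The tropical curve in `ℝ²` defined by `F`: the corner locus, where the maximum is attained at
least twice. -/
def curve (a : Expo → ℝ) : Set (ℝ × ℝ) := {p | 2 ≤ (active a p).card}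

/-- Twice the signed area of the lattice triangle with vertices `m, n, k`. -/
def triDet (m n k : Expo) : ℤ :=
  ((n.1 : ℕ) - (m.1 : ℕ) : ℤ) * ((k.2 : ℕ) - (m.2 : ℕ) : ℤ)
    - ((n.2 : ℕ) - (m.2 : ℕ) : ℤ) * ((k.1 : ℕ) - (m.1 : ℕ) : ℤ)

/-- Smoothness: the dual Newton subdivision is a unimodular triangulation of the square, that is,
each two-dimensional cell is a triangle of (Euclidean) area `1/2`. -/
def IsSmooth (a : Expo → ℝ) : Prop :=
  ∀ p : ℝ × ℝ, ∀ m ∈ active a p, ∀ n ∈ active a p, ∀ k ∈ active a p, triDet m n k ≠ 0 →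
    |triDet m n k| = 1 ∧ active a p = {m, n, k}

/-! ### Tropical curves of bidegree (1,1)

A point `q = (x, y, l)` of `ℝ³` encodes the `(1,1)`-curve with lowest vertex `v₀ = (x, y)` whose
unique edge has signed (lattice) length `l`: the edge has slope `1` if `l > 0`, slope `-1` if
`l < 0`, and `v₀ = v₁` if `l = 0`. -/

/-- The lowest vertex `v₀`. -/
def v₀ (q : Fin 3 → ℝ) : ℝ × ℝ := (q 0, q 1)

/-- The other (top) vertex `v₁`: it is `v₀ + l (1, 1)` if `l ≥ 0` and `v₀ + |l| (-1, 1)` if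
`l ≤ 0`. -/
def v₁ (q : Fin 3 → ℝ) : ℝ × ℝ := (q 0 + q 2, q 1 + |q 2|)

/-- The leg (ray) with endpoint `v` and direction `u`. -/
def leg (v u : ℝ × ℝ) : Set (ℝ × ℝ) := {p | ∃ t : ℝ, 0 ≤ t ∧ p = v + t • u}

/-- The tropical `(1,1)`-curve `Λ` in `ℝ²` encoded by `q`. The leg pointing down starts at `v₀` and
the one pointing up at `v₁`; the legs pointing left and right start at the left vertex and at the
right vertex. -/
def line11 (q : Fin 3 → ℝ) : Set (ℝ × ℝ) :=
  segment ℝ (v₀ q) (v₁ q) ∪ leg (v₀ q) (0, -1) ∪ leg (v₁ q) (0, 1) ∪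
    leg (if 0 ≤ q 2 then v₀ q else v₁ q) (-1, 0) ∪
    leg (if 0 ≤ q 2 then v₁ q else v₀ q) (1, 0)

/-! ### Stable intersections and tritangency -/

/-- The slope at `p` in direction `u` of the tropical polynomial `F`: as `F` is a maximum of affine
functions, it is the maximum of `⟨m, u⟩` over the exponents `m` active at `p`. -/
def tropSlope (a : Expo → ℝ) (p : ℝ × ℝ) (u : ℤ × ℤ) : ℤ :=
  (active a p).sup' (active_nonempty a p) fun m => ((m.1 : ℕ) : ℤ) * u.1 + ((m.2 : ℕ) : ℤ) * u.2

open Classical in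
/-- The primitive integral directions in which the `(1,1)`-curve `Λ` leaves the point `p`. All
edges and legs of `(1,1)`-curves have their primitive directions in `{-1, 0, 1}²`. -/
def outgoing (q : Fin 3 → ℝ) (p : ℝ × ℝ) : Finset (ℤ × ℤ) :=
  ((Finset.Icc (-1 : ℤ) 1 ×ˢ Finset.Icc (-1 : ℤ) 1).erase 0).filter fun u =>
    ∀ᶠ t : ℝ in 𝓝[>] 0, p + t • ((u.1 : ℝ), (u.2 : ℝ)) ∈ line11 q

/-- The multiplicity of `p` in the stable intersection of the curve of `F` with `Λ`: the order at
`p` of the restriction of `F` to `Λ`, i.e. the sum of the slopes of `F` along the edges and legs of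
`Λ` leaving `p` (they all have weight one). It vanishes outside finitely many points. -/
def stableMult (a : Expo → ℝ) (q : Fin 3 → ℝ) (p : ℝ × ℝ) : ℤ :=
  ∑ u ∈ outgoing q p, tropSlope a p u

/-- The inclusion of `ℝ²` in `TP¹ × TP¹`, where `TP¹ = [-∞, ∞]`. -/
def toTP (p : ℝ × ℝ) : EReal × EReal := ((p.1 : EReal), (p.2 : EReal))

/-- The tropical curve in `TP¹ × TP¹` whose part in `ℝ²` is `X`. -/
def compactify (X : Set (ℝ × ℝ)) : Set (EReal × EReal) := closure (toTP '' X)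

/-- The set-theoretic intersection `Λ ∩ Γ` in `TP¹ × TP¹`. -/
def inter (a : Expo → ℝ) (q : Fin 3 → ℝ) : Set (EReal × EReal) :=
  compactify (line11 q) ∩ compactify (curve a)

/-- The set of connected components of a subset `S` of a topological space. -/
def components {X : Type*} [TopologicalSpace X] (S : Set X) : Set (Set X) :=
  {C | ∃ x ∈ S, C = connectedComponentIn S x}

/-- The total stable intersection multiplicity of a component `C` of `Λ ∩ Γ`. (Stable intersections
of the curves considered here are supported in `ℝ²`.) -/
def totalMult (a : Expo → ℝ) (q : Fin 3 → ℝ) (C : Set (EReal × EReal)) : ℤ :=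
  ∑ᶠ (p : ℝ × ℝ) (_ : toTP p ∈ C), stableMult a q p

/-- The `(1,1)`-curve encoded by `q` is tritangent to the curve of `F`: the intersection has three
components of total stable multiplicity `2` each, or two of total stable multiplicities `2` and
`4`, or it is connected with total stable multiplicity `6`. -/
def IsTritangent (a : Expo → ℝ) (q : Fin 3 → ℝ) : Prop :=
  (∃ C₁ C₂ C₃, C₁ ≠ C₂ ∧ C₁ ≠ C₃ ∧ C₂ ≠ C₃ ∧ components (inter a q) = {C₁, C₂, C₃} ∧
    totalMult a q C₁ = 2 ∧ totalMult a q C₂ = 2 ∧ totalMult a q C₃ = 2) ∨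
  (∃ C₁ C₂, C₁ ≠ C₂ ∧ components (inter a q) = {C₁, C₂} ∧
    totalMult a q C₁ = 2 ∧ totalMult a q C₂ = 4) ∨
  (∃ C, components (inter a q) = {C} ∧ totalMult a q C = 6)

/-- The tritangent classes: the connected components of the set of all `(v₀, l)` in `ℝ³` encoding
tritangent `(1,1)`-curves. -/
def tritangentClasses (a : Expo → ℝ) : Set (Set (Fin 3 → ℝ)) :=
  components {q | IsTritangent a q}

/-- The piecewise linear map `ψ : ℝ³ → ℝ³` induced by the tropical Segre embedding. It sends the
vertex of a tropical plane to the point `(v₀, l)` encoding the corresponding `(1,1)`-curve. -/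
def segre (v : Fin 3 → ℝ) : Fin 3 → ℝ :=
  if v 2 ≤ v 0 + v 1 then ![v 0, v 2 - v 0, v 2 - v 0 - v 1]
  else ![v 0, v 1, v 2 - v 0 - v 1]

/-! ### Polyhedral complexes -/

/-- A polyhedron in `ℝ³`: the solution set of finitely many affine inequalities. -/
def IsPolyhedron (P : Set (Fin 3 → ℝ)) : Prop :=
  ∃ (k : ℕ) (A : Fin k → Fin 3 → ℝ) (b : Fin k → ℝ), P = {x | ∀ i, ∑ j, A i j * x j ≤ b i}

/-- A rational polyhedron in `ℝ³`: the facet normals can be taken rational. (The constant terms are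
arbitrary real numbers.) -/
def IsRationalPolyhedron (P : Set (Fin 3 → ℝ)) : Prop :=
  ∃ (k : ℕ) (A : Fin k → Fin 3 → ℚ) (b : Fin k → ℝ),
    P = {x | ∀ i, ∑ j, (A i j : ℝ) * x j ≤ b i}

/-- A polyhedral complex in `ℝ³`: a finite collection of non-empty polyhedra containing all
non-empty faces of its members, such that two members intersect, if at all, in a common face. -/
structure IsPolyhedralComplex (K : Set (Set (Fin 3 → ℝ))) : Prop where
  finite : K.Finite
  nonempty : ∀ P ∈ K, P.Nonempty
  polyhedron : ∀ P ∈ K, IsPolyhedron P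
  face_mem : ∀ P ∈ K, ∀ F : Set (Fin 3 → ℝ), F.Nonempty → IsExposed ℝ P F → F ∈ K
  inter_face : ∀ P ∈ K, ∀ Q ∈ K, (P ∩ Q).Nonempty →
    IsExposed ℝ P (P ∩ Q) ∧ IsExposed ℝ Q (P ∩ Q)

/-- The structures of polyhedral complex on a subset `S` of `ℝ³`. -/
def polyhedralStructures (S : Set (Fin 3 → ℝ)) : Set (Set (Set (Fin 3 → ℝ))) :=
  {K | IsPolyhedralComplex K ∧ ⋃₀ K = S}

/-- The structures of rational polyhedral complex on a subset `S` of `ℝ³`. -/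
def rationalPolyhedralStructures (S : Set (Fin 3 → ℝ)) : Set (Set (Set (Fin 3 → ℝ))) :=
  {K | K ∈ polyhedralStructures S ∧ ∀ P ∈ K, IsRationalPolyhedron P}

/-- A family of polyhedral structures on the same set has a coarsest member: one which is refined by
every member of the family, i.e. each cell of any member lies in a cell of the coarsest one. -/
def HasCoarsest (𝒮 : Set (Set (Set (Fin 3 → ℝ)))) : Prop :=
  ∃ K₀ ∈ 𝒮, ∀ K ∈ 𝒮, ∀ P ∈ K, ∃ Q ∈ K₀, P ⊆ Q

end Tritangent

end

/-!
The proof rests on a description of tritangency which does not mention components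
(`isTritangent_iff`). Let `F` be the tropical polynomial and `Λ` a `(1,1)`-curve. Assign to the
four legs and the bounded edge of `Λ` the parities `par`: even for the left and the lower leg, odd
for the right and the upper leg, and for the bounded edge even or odd according to whether its
slope is `1` or `-1`. Then `Λ` is tritangent if and only if, at each interior point of an edge or
leg at which a single monomial of `F` is active, the slope of this monomial along the edge has the
parity of the edge (`IsParityGood`). As the whole stable intersection has degree six
(`finsum_stableMult_univ`) and each component contributes a positive number
(`exists_stableMult_ne_zero`, `exists_toTP_mem_component`), tritangency means that all components
have even multiplicity (`isTritangent_iff_even`). The multiplicity of a part of `Λ` is a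
telescoping sum of slopes of `F` along the edges. Under the parity condition, the slopes at the
ends of each component have the prescribed parities, which add up to an even number
(`even_totalMult`); conversely, a point outside the curve of `F` cuts `Λ` into two sides, and the
multiplicity of one side, a sum of multiplicities of components, is determined modulo two by the
slope at this point (`even_finsum_farSide`).

The parity condition fails on a finite union of sets each of which is defined by the existence of a
parameter `t` on an edge that solves finitely many strict affine inequalities, rational in `(v₀,
l)` and `t`. Such sets are open, and, after elimination of `t`, unions of relatively open cells of
a finite rational plane arrangement (`isResolvable_setOf_isTritangent`). So each tritangent class
is a closed union of such cells, and the closed cells contained in it form a complex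
(`closedCell_image_mem_rationalPolyhedralStructures`); they are transported by the piecewise linear
automorphism `segre` once the plane `l = 0` is added to the arrangement
(`connected_and_polyhedral_of_resolves`).

A set that agrees on some open set with a connected but not convex part `U` of a rational plane has
no coarsest structure (`not_hasCoarsest`). Indeed, small piecewise affine automorphisms of the set,
which move points of `U` within the plane, carry a given structure to one in which a prescribed
point of `U` is interior to a two-dimensional cell (`exists_structure_with_interior_point`). So, in
a coarsest structure, all points of `U` would be interior to two-dimensional cells, hence by
connectedness to the same cell, which is impossible as cells are convex. In the example
`exampleCurve`, this happens at the point `(-2, 4, 0)`: nearby, the upper leg has to run along a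
vertical edge of the curve, which forces `x + l = -2`, and the right leg, whose height is `y + max
l 0`, must not be lower than `4`. In the plane `x + l = -2`, this region has a reflex corner where
`l` changes its sign.
-/

namespace Tritangent

/-! ### Complexes cut out by rational hyperplane arrangements -/

/-- An affine functional on `ℝ³` with rational linear part and real constant term, as a pair. -/
abbrev RatAff : Type := (Fin 3 → ℚ) × ℝ

/-- The value of a rational affine functional. -/
noncomputable def RatAff.ev (f : RatAff) (x : Fin 3 → ℝ) : ℝ := ∑ j, (f.1 j : ℝ) * x j + f.2

theorem RatAff.ev_combo (f : RatAff) (x y : Fin 3 → ℝ) {s t : ℝ} (h : s + t = 1) :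
    f.ev (s • x + t • y) = s * f.ev x + t * f.ev y := by
  simp only [RatAff.ev, Fin.sum_univ_three, Pi.add_apply, Pi.smul_apply, smul_eq_mul]
  linear_combination -f.2 * h

theorem RatAff.continuous_ev (f : RatAff) : Continuous f.ev := by
  unfold RatAff.ev; fun_prop

/-- The closed cell, in the arrangement of the zero sets of the functionals in `Φ`, of which `x` is
a relative interior point: no functional changes its weak sign. -/
def closedCell (Φ : Finset RatAff) (x : Fin 3 → ℝ) : Set (Fin 3 → ℝ) :=
  {y | ∀ f ∈ Φ, (f.ev x ≤ 0 → f.ev y ≤ 0) ∧ (0 ≤ f.ev x → 0 ≤ f.ev y)}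

/-- `x` and `y` lie in the same relatively open cell of the arrangement given by `Φ`. -/
def SameSigns (Φ : Finset RatAff) (x y : Fin 3 → ℝ) : Prop :=
  ∀ f ∈ Φ, SignType.sign (f.ev x) = SignType.sign (f.ev y)

/-- `S` is a union of relatively open cells of the arrangement given by `Φ`. -/
def Resolves (Φ : Finset RatAff) (S : Set (Fin 3 → ℝ)) : Prop :=
  ∀ x y, SameSigns Φ x y → x ∈ S → y ∈ S

theorem Resolves.mono {Φ Ψ : Finset RatAff} {S : Set (Fin 3 → ℝ)} (h : Resolves Φ S)
    (hΦ : Φ ⊆ Ψ) : Resolves Ψ S :=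
  fun x y hxy => h x y fun f hf => hxy f (hΦ hf)

theorem SameSigns.symm {Φ : Finset RatAff} {x y : Fin 3 → ℝ} (h : SameSigns Φ x y) :
    SameSigns Φ y x := fun f hf => (h f hf).symm

theorem self_mem_closedCell (Φ : Finset RatAff) (x : Fin 3 → ℝ) : x ∈ closedCell Φ x :=
  fun _ _ => ⟨id, id⟩

theorem closedCell_subset {Φ : Finset RatAff} {x y : Fin 3 → ℝ} (h : y ∈ closedCell Φ x) :
    closedCell Φ y ⊆ closedCell Φ x :=
  fun _ hz f hf => ⟨fun h0 => (hz f hf).1 ((h f hf).1 h0), fun h0 => (hz f hf).2 ((h f hf).2 h0)⟩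

theorem convex_closedCell (Φ : Finset RatAff) (x : Fin 3 → ℝ) : Convex ℝ (closedCell Φ x) := by
  intro y hy z hz s t hs ht hst f hf
  rw [f.ev_combo y z hst]
  refine ⟨fun h0 => ?_, fun h0 => ?_⟩
  · nlinarith [mul_nonneg hs (sub_nonneg.2 ((hy f hf).1 h0)),
      mul_nonneg ht (sub_nonneg.2 ((hz f hf).1 h0))]
  · nlinarith [mul_nonneg hs ((hy f hf).2 h0), mul_nonneg ht ((hz f hf).2 h0)]

/-- Points of the open segment from a point of the closed cell to `x` have the signs of `x`. -/
theorem sameSigns_of_mem_closedCell {Φ : Finset RatAff} {x y : Fin 3 → ℝ}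
    (hy : y ∈ closedCell Φ x) {s t : ℝ} (hs : 0 ≤ s) (ht : 0 < t) (hst : s + t = 1) :
    SameSigns Φ x (s • y + t • x) := by
  intro f hf
  rw [f.ev_combo y x hst]
  obtain ⟨h1, h2⟩ := hy f hf
  rcases lt_trichotomy (f.ev x) 0 with h | h | h
  · rw [sign_neg h, sign_neg]
    nlinarith [h1 h.le, mul_pos ht (neg_pos.2 h), mul_nonneg hs (sub_nonneg.2 (h1 h.le))]
  · have : f.ev y = 0 := le_antisymm (h1 h.le) (h2 h.ge)
    simp [h, this]
  · rw [sign_pos h, sign_pos]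
    nlinarith [h2 h.le, mul_pos ht h, mul_nonneg hs (h2 h.le)]

theorem mem_closedCell_of_sameSigns {Φ : Finset RatAff} {x y : Fin 3 → ℝ}
    (h : SameSigns Φ x y) : y ∈ closedCell Φ x := by
  intro f hf
  have := h f hf
  refine ⟨fun h0 => ?_, fun h0 => ?_⟩
  · rw [← sign_nonpos_iff] at h0 ⊢; rwa [← this]
  · rw [← sign_nonneg_iff] at h0 ⊢; rwa [← this]

theorem closedCell_subset_of_resolves {Φ : Finset RatAff} {S : Set (Fin 3 → ℝ)}
    (hS : IsClosed S) (hΦ : Resolves Φ S) {x : Fin 3 → ℝ} (hx : x ∈ S) : closedCell Φ x ⊆ S := by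
  intro y hy
  have h1 : Tendsto (fun t : ℝ => (1 - t) • y + t • x) (𝓝[>] 0) (𝓝 y) := by
    have : Continuous fun t : ℝ => (1 - t) • y + t • x := by fun_prop
    have := (this.tendsto 0).mono_left (nhdsWithin_le_nhds (s := Set.Ioi 0))
    simpa using this
  refine hS.mem_of_tendsto h1 ?_
  filter_upwards [Ioo_mem_nhdsGT (zero_lt_one' ℝ)] with t ht
  exact hΦ x _ (sameSigns_of_mem_closedCell hy (by linarith [ht.2]) ht.1 (by ring)) hx

theorem finite_closedCells (Φ : Finset RatAff) : (Set.range (closedCell Φ)).Finite := by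
  let G : (Φ → SignType) → Set (Fin 3 → ℝ) := fun σ =>
    {y | ∀ f : Φ, (σ f ≤ 0 → f.1.ev y ≤ 0) ∧ (0 ≤ σ f → 0 ≤ f.1.ev y)}
  refine (Set.finite_range G).subset ?_
  rintro _ ⟨x, rfl⟩
  refine ⟨fun f => SignType.sign (f.1.ev x), ?_⟩
  ext y
  simp [G, closedCell, sign_nonpos_iff, sign_nonneg_iff]

theorem isRationalPolyhedron_of_fintype {ι : Type*} [Fintype ι] (A : ι → Fin 3 → ℚ) (b : ι → ℝ) :
    IsRationalPolyhedron {x | ∀ i, ∑ j, (A i j : ℝ) * x j ≤ b i} := by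
  refine ⟨Fintype.card ι, fun k => A ((Fintype.equivFin ι).symm k),
    fun k => b ((Fintype.equivFin ι).symm k), ?_⟩
  ext x
  exact ⟨fun h k => h _, fun h i => by simpa using h (Fintype.equivFin ι i)⟩

theorem IsRationalPolyhedron.isPolyhedron {P : Set (Fin 3 → ℝ)} (h : IsRationalPolyhedron P) :
    IsPolyhedron P := by
  obtain ⟨k, A, b, rfl⟩ := h
  exact ⟨k, fun i j => A i j, b, rfl⟩

theorem isRationalPolyhedron_closedCell (Φ : Finset RatAff) (x : Fin 3 → ℝ) :
    IsRationalPolyhedron (closedCell Φ x) := by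
  classical
  -- The two weak inequalities for `f` are indexed by `Bool`; those not required become `0 ≤ 0`.
  let A : Φ × Bool → Fin 3 → ℚ := fun p =>
    if p.2 then (if p.1.1.ev x ≤ 0 then p.1.1.1 else 0)
    else (if 0 ≤ p.1.1.ev x then -p.1.1.1 else 0)
  let b : Φ × Bool → ℝ := fun p =>
    if p.2 then (if p.1.1.ev x ≤ 0 then -p.1.1.2 else 0)
    else (if 0 ≤ p.1.1.ev x then p.1.1.2 else 0)
  convert isRationalPolyhedron_of_fintype A b using 1
  ext y
  have key : ∀ f : Φ, ((f.1.ev x ≤ 0 → f.1.ev y ≤ 0) ∧ (0 ≤ f.1.ev x → 0 ≤ f.1.ev y)) ↔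
      (∑ j, (A (f, true) j : ℝ) * y j ≤ b (f, true)) ∧
      (∑ j, (A (f, false) j : ℝ) * y j ≤ b (f, false)) := by
    intro f
    refine and_congr ?_ ?_
    · by_cases h : f.1.ev x ≤ 0
      · simp only [h, A, b, if_true, true_imp_iff]
        simp only [RatAff.ev]
        constructor <;> intro h <;> linarith
      · simp [h, A, b]
    · by_cases h : 0 ≤ f.1.ev x
      · simp only [h, A, b, if_true, true_imp_iff, Bool.false_eq_true, if_false]
        simp only [RatAff.ev, Pi.neg_apply, Rat.cast_neg, neg_mul, Finset.sum_neg_distrib]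
        constructor <;> intro h <;> linarith
      · simp [h, A, b]
  constructor
  · rintro h ⟨f, _ | _⟩
    · exact ((key f).1 (h f.1 f.2)).2
    · exact ((key f).1 (h f.1 f.2)).1
  · intro h f hf
    exact (key ⟨f, hf⟩).2 ⟨h _, h _⟩

/-- Among the points of a nonempty face `F` of a closed cell, one with the fewest vanishing
functionals lies in the relative interior of `F`, so that `F` is its closed cell. -/
theorem exists_closedCell_eq_of_isExposed {Φ : Finset RatAff} {x : Fin 3 → ℝ}
    {F : Set (Fin 3 → ℝ)} (hF : F.Nonempty) (hex : IsExposed ℝ (closedCell Φ x) F) :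
    ∃ z ∈ F, F = closedCell Φ z := by
  classical
  have hsub := hex.subset
  have hconv := hex.convex (convex_closedCell Φ x)
  obtain ⟨z, hz, hmin⟩ : ∃ z ∈ F, ∀ y ∈ F, (Φ.filter fun f => f.ev z = 0).card ≤
      (Φ.filter fun f => f.ev y = 0).card := by
    have hne := hF.image fun z => (Φ.filter fun f => f.ev z = 0).card
    obtain ⟨z, hz, hzc⟩ := Nat.sInf_mem hne
    exact ⟨z, hz, fun y hy => hzc.trans_le (Nat.sInf_le ⟨y, hy, rfl⟩)⟩
  have hmin' : ∀ y ∈ F, ∀ f ∈ Φ, f.ev z = 0 → f.ev y = 0 := by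
    intro y hy
    have hw : (1 / 2 : ℝ) • y + (1 / 2 : ℝ) • z ∈ F :=
      hconv hy hz (by norm_num) (by norm_num) (by norm_num)
    have hle := hmin _ hw
    have hcard : ∀ f ∈ Φ, f.ev ((1 / 2 : ℝ) • y + (1 / 2 : ℝ) • z) = 0 →
        f.ev y = 0 ∧ f.ev z = 0 := by
      intro f hf h
      rw [f.ev_combo y z (by norm_num)] at h
      obtain ⟨a1, a2⟩ := hsub hy f hf
      obtain ⟨b1, b2⟩ := hsub hz f hf
      rcases le_total (f.ev x) 0 with h0 | h0
      · have := a1 h0; have := b1 h0; constructor <;> linarith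
      · have := a2 h0; have := b2 h0; constructor <;> linarith
    have heq := Finset.eq_of_subset_of_card_le
      (s := Φ.filter fun f => f.ev ((1 / 2 : ℝ) • y + (1 / 2 : ℝ) • z) = 0)
      (t := Φ.filter fun f => f.ev z = 0)
      (fun f hf => by
        rw [Finset.mem_filter] at hf ⊢
        exact ⟨hf.1, (hcard f hf.1 hf.2).2⟩) hle
    intro f hf h0
    have : f ∈ Φ.filter fun f => f.ev z = 0 := Finset.mem_filter.2 ⟨hf, h0⟩
    rw [← heq, Finset.mem_filter] at this
    exact (hcard f hf this.2).1
  refine ⟨z, hz, Set.Subset.antisymm ?_ ?_⟩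
  · intro y hy f hf
    obtain ⟨a1, a2⟩ := hsub hy f hf
    obtain ⟨b1, b2⟩ := hsub hz f hf
    constructor
    · intro h
      rcases h.eq_or_lt with h | h
      · exact (hmin' y hy f hf h).le
      · exact a1 (le_of_not_ge fun h0 => absurd (b2 h0) (not_le.2 h))
    · intro h
      rcases h.eq_or_lt with h | h
      · exact (hmin' y hy f hf h.symm).ge
      · exact a2 (le_of_not_ge fun h0 => absurd (b1 h0) (not_le.2 h))
  · intro y hy
    -- Prolong the segment from `y` to `z` slightly beyond `z`.
    have hev : ∀ᶠ t : ℝ in 𝓝[>] 0, (1 + t) • z + (-t) • y ∈ closedCell Φ z := by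
      have : ∀ f ∈ Φ, ∀ᶠ t : ℝ in 𝓝[>] 0,
          (f.ev z ≤ 0 → f.ev ((1 + t) • z + (-t) • y) ≤ 0) ∧
          (0 ≤ f.ev z → 0 ≤ f.ev ((1 + t) • z + (-t) • y)) := by
        intro f hf
        have hc : Tendsto (fun t : ℝ => f.ev ((1 + t) • z + (-t) • y)) (𝓝[>] 0) (𝓝 (f.ev z)) := by
          have : Continuous fun t : ℝ => f.ev ((1 + t) • z + (-t) • y) :=
            f.continuous_ev.comp (by fun_prop)
          have := (this.tendsto 0).mono_left (nhdsWithin_le_nhds (s := Set.Ioi 0))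
          simpa using this
        rcases lt_trichotomy (f.ev z) 0 with h | h | h
        · filter_upwards [hc.eventually_lt_const h] with t ht
          exact ⟨fun _ => ht.le, fun h' => absurd h (not_lt.2 h')⟩
        · have hy0 : f.ev y = 0 := le_antisymm ((hy f hf).1 h.le) ((hy f hf).2 h.ge)
          filter_upwards with t
          rw [f.ev_combo z y (by ring), h, hy0]
          simp
        · filter_upwards [hc.eventually_const_lt h] with t ht
          exact ⟨fun h' => absurd h (not_lt.2 h'), fun _ => ht.le⟩
      have := (Filter.eventually_all_finset Φ).2 this
      filter_upwards [this] with t ht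
      exact fun f hf => ht f hf
    obtain ⟨t, ht, ht0⟩ := (hev.and self_mem_nhdsWithin).exists
    have ht0 : (0 : ℝ) < t := ht0
    refine hex.isExtreme.left_mem_of_mem_openSegment (closedCell_subset (hsub hz) hy)
      (closedCell_subset (hsub hz) ht) hz
      ⟨t / (1 + t), 1 / (1 + t), by positivity, by positivity, by field_simp; ring, ?_⟩
    ext i
    simp only [Pi.add_apply, Pi.smul_apply, smul_eq_mul]
    field_simp
    ring

/-- The intersection of two closed cells is cut out from the first by the vanishing of the
functionals on which the signs differ. -/
theorem isExposed_inter_closedCell (Φ : Finset RatAff) (x y : Fin 3 → ℝ)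
    (hne : (closedCell Φ x ∩ closedCell Φ y).Nonempty) :
    IsExposed ℝ (closedCell Φ x) (closedCell Φ x ∩ closedCell Φ y) := by
  classical
  intro _
  let σ : RatAff → ℝ := fun f =>
    if SignType.sign (f.ev x) = SignType.sign (f.ev y) then 0 else -(SignType.sign (f.ev x) : ℝ)
  let l : StrongDual ℝ (Fin 3 → ℝ) :=
    ∑ f ∈ Φ, σ f • ∑ j, (f.1 j : ℝ) • ContinuousLinearMap.proj (R := ℝ) (φ := fun _ : Fin 3 => ℝ) j
  have hl : ∀ z, l z = ∑ f ∈ Φ, σ f * f.ev z - ∑ f ∈ Φ, σ f * f.2 := by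
    intro z
    rw [← Finset.sum_sub_distrib]
    simp only [l, sum_apply, smul_apply,
      ContinuousLinearMap.proj_apply, smul_eq_mul, RatAff.ev]
    exact Finset.sum_congr rfl fun f _ => by ring
  have hterm : ∀ z ∈ closedCell Φ x, ∀ f ∈ Φ, σ f * f.ev z ≤ 0 := by
    intro z hz f hf
    obtain ⟨h1, h2⟩ := hz f hf
    simp only [σ]
    split_ifs with hs
    · simp
    · rcases lt_trichotomy (f.ev x) 0 with h | h | h
      · simpa [sign_neg h] using h1 h.le
      · simp [h]
      · simpa [sign_pos h] using h2 h.le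
  have hzero : ∀ z ∈ closedCell Φ x, (z ∈ closedCell Φ y ↔ ∀ f ∈ Φ, σ f * f.ev z = 0) := by
    intro z hz
    refine forall₂_congr fun f hf => ?_
    obtain ⟨h1, h2⟩ := hz f hf
    simp only [σ]
    split_ifs with hs
    · simp only [zero_mul, iff_true]
      rw [← sign_nonpos_iff, ← hs, sign_nonpos_iff, ← sign_nonneg_iff, ← hs, sign_nonneg_iff]
      exact ⟨h1, h2⟩
    · rcases lt_trichotomy (f.ev x) 0 with h | h | h
      · rw [sign_neg h] at hs ⊢
        have hy : 0 ≤ f.ev y := not_lt.1 fun h' => hs (sign_neg h').symm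
        simp only [SignType.coe_neg_one, neg_neg, one_mul]
        refine ⟨fun h' => le_antisymm (h1 h.le) (h'.2 hy), fun h' => by simp [h']⟩
      · have : f.ev z = 0 := le_antisymm (h1 h.le) (h2 h.ge)
        simp [this]
      · rw [sign_pos h] at hs ⊢
        have hy : f.ev y ≤ 0 := not_lt.1 fun h' => hs (sign_pos h').symm
        simp only [SignType.coe_one, neg_mul, one_mul, neg_eq_zero]
        refine ⟨fun h' => le_antisymm (h'.1 hy) (h2 h.le), fun h' => by simp [h']⟩
  obtain ⟨w, hwx, hwy⟩ := hne
  refine ⟨l, Set.ext fun z => ⟨fun hz => ⟨hz.1, fun v hv => ?_⟩, fun hz => ⟨hz.1, ?_⟩⟩⟩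
  · rw [hl, hl, Finset.sum_eq_zero ((hzero z hz.1).1 hz.2)]
    linarith [Finset.sum_nonpos (hterm v hv)]
  · rw [hzero z hz.1]
    have h1 := hz.2 w hwx
    rw [hl, hl, Finset.sum_eq_zero ((hzero w hwx).1 hwy)] at h1
    refine (Finset.sum_eq_zero_iff_of_nonpos (hterm z hz.1)).1 ?_
    linarith [Finset.sum_nonpos (hterm z hz.1)]

/-- A closed union of relatively open cells of an arrangement is a rational polyhedral complex,
formed by the closed cells contained in it. -/
theorem closedCell_image_mem_rationalPolyhedralStructures {Φ : Finset RatAff}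
    {S : Set (Fin 3 → ℝ)} (hS : IsClosed S) (hΦ : Resolves Φ S) :
    closedCell Φ '' S ∈ rationalPolyhedralStructures S := by
  refine ⟨⟨⟨(finite_closedCells Φ).subset (Set.image_subset_range _ _), ?_, ?_, ?_, ?_⟩, ?_⟩, ?_⟩
  · rintro _ ⟨x, -, rfl⟩; exact ⟨x, self_mem_closedCell Φ x⟩
  · rintro _ ⟨x, -, rfl⟩; exact (isRationalPolyhedron_closedCell Φ x).isPolyhedron
  · rintro _ ⟨x, hx, rfl⟩ F hF hex
    obtain ⟨z, hz, rfl⟩ := exists_closedCell_eq_of_isExposed hF hex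
    exact ⟨z, closedCell_subset_of_resolves hS hΦ hx (hex.subset hz), rfl⟩
  · rintro _ ⟨x, -, rfl⟩ _ ⟨y, -, rfl⟩ hne
    refine ⟨isExposed_inter_closedCell Φ x y hne, ?_⟩
    rw [Set.inter_comm] at hne ⊢
    exact isExposed_inter_closedCell Φ y x hne
  · refine Set.Subset.antisymm (Set.sUnion_subset ?_) fun x hx =>
      ⟨_, ⟨x, hx, rfl⟩, self_mem_closedCell Φ x⟩
    rintro _ ⟨x, hx, rfl⟩
    exact closedCell_subset_of_resolves hS hΦ hx
  · rintro _ ⟨x, -, rfl⟩; exact isRationalPolyhedron_closedCell Φ x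

theorem isClosed_connectedComponentIn {X : Type*} [TopologicalSpace X] {S : Set X}
    (hS : IsClosed S) (x : X) : IsClosed (connectedComponentIn S x) := by
  by_cases hx : x ∈ S
  · refine isClosed_of_closure_subset ?_
    exact isPreconnected_connectedComponentIn.closure.subset_connectedComponentIn
      (subset_closure (mem_connectedComponentIn hx))
      (closure_minimal (connectedComponentIn_subset S x) hS)
  · simp [connectedComponentIn_eq_empty hx]

/-- Connected components of a closed union of relatively open cells inherit both properties, as
each relatively open cell is convex. -/
theorem component_isClosed_resolves {Φ : Finset RatAff} {S : Set (Fin 3 → ℝ)} (hS : IsClosed S)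
    (hΦ : Resolves Φ S) {x : Fin 3 → ℝ} :
    IsClosed (connectedComponentIn S x) ∧ Resolves Φ (connectedComponentIn S x) := by
  refine ⟨isClosed_connectedComponentIn hS x, fun y z hyz hy => ?_⟩
  have hyS := connectedComponentIn_subset S x hy
  rw [connectedComponentIn_eq hy]
  have hseg : segment ℝ y z ⊆ S := by
    refine ((convex_closedCell Φ y).segment_subset (self_mem_closedCell Φ y)
      (mem_closedCell_of_sameSigns hyz)).trans (closedCell_subset_of_resolves hS hΦ hyS)
  exact ((convex_segment y z).isPreconnected.subset_connectedComponentIn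
    (left_mem_segment ℝ y z) hseg) (right_mem_segment ℝ y z)

end Tritangent

namespace Tritangent

/-! ### Images under piecewise affine maps -/

/-- An affine automorphism of `ℝ³` with rational linear part. -/
def IsRatAut (g : (Fin 3 → ℝ) → (Fin 3 → ℝ)) : Prop :=
  ∃ (M : Matrix (Fin 3) (Fin 3) ℚ) (c : Fin 3 → ℝ), M.det ≠ 0 ∧
    ∀ x i, g x i = ∑ j, (M i j : ℝ) * x j + c i

theorem IsRatAut.exists_inverse {g : (Fin 3 → ℝ) → (Fin 3 → ℝ)} (hg : IsRatAut g) :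
    ∃ (L : (Fin 3 → ℝ) ≃L[ℝ] (Fin 3 → ℝ)) (c : Fin 3 → ℝ) (N : Matrix (Fin 3) (Fin 3) ℚ),
      (∀ x, g x = L x + c) ∧ ∀ x i, L.symm x i = ∑ j, (N i j : ℝ) * x j := by
  obtain ⟨M, c, hM, hg⟩ := hg
  have h1 : (M.map (algebraMap ℚ ℝ)) * (M⁻¹.map (algebraMap ℚ ℝ)) = 1 := by
    have := congrArg (fun A : Matrix (Fin 3) (Fin 3) ℚ => A.map (algebraMap ℚ ℝ))
      (Matrix.mul_nonsing_inv M (Ne.isUnit hM))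
    simpa [Matrix.map_mul, -eq_ratCast] using this
  have h2 : (M⁻¹.map (algebraMap ℚ ℝ)) * (M.map (algebraMap ℚ ℝ)) = 1 := by
    have := congrArg (fun A : Matrix (Fin 3) (Fin 3) ℚ => A.map (algebraMap ℚ ℝ))
      (Matrix.nonsing_inv_mul M (Ne.isUnit hM))
    simpa [Matrix.map_mul, -eq_ratCast] using this
  refine ⟨(Matrix.toLin'OfInv h2 h1).toContinuousLinearEquiv, c, M⁻¹, fun x => ?_, fun x i => ?_⟩
  · ext i
    rw [hg]
    simp [Matrix.toLin'OfInv, Matrix.mulVec, dotProduct]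
  · have : (Matrix.toLin'OfInv h2 h1).toContinuousLinearEquiv.symm x
        = (M⁻¹.map (algebraMap ℚ ℝ)).mulVec x := rfl
    rw [this]
    simp [Matrix.mulVec, dotProduct]

theorem IsRatAut.injective {g : (Fin 3 → ℝ) → (Fin 3 → ℝ)} (hg : IsRatAut g) :
    Function.Injective g := by
  obtain ⟨L, c, -, hL, -⟩ := hg.exists_inverse
  intro x y h
  rw [hL, hL] at h
  exact L.injective (add_right_cancel h)

theorem IsRatAut.isExposed_image_iff {g : (Fin 3 → ℝ) → (Fin 3 → ℝ)} (hg : IsRatAut g)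
    {A B : Set (Fin 3 → ℝ)} : IsExposed ℝ (g '' A) (g '' B) ↔ IsExposed ℝ A B := by
  have hinj := hg.injective
  obtain ⟨L, c, -, hL, -⟩ := hg.exists_inverse
  constructor
  · intro h hB
    obtain ⟨l, hl⟩ := h (hB.image g)
    refine ⟨l.comp (L : (Fin 3 → ℝ) →L[ℝ] (Fin 3 → ℝ)), Set.ext fun x => ?_⟩
    rw [← hinj.mem_set_image (s := B), hl]
    simp only [Set.mem_ofPred_eq, Set.forall_mem_image, hinj.mem_set_image]
    simp only [hL, map_add, add_le_add_iff_right, ContinuousLinearMap.comp_apply,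
      ContinuousLinearEquiv.coe_coe]
  · intro h hB
    obtain ⟨l, hl⟩ := h hB.of_image
    refine ⟨l.comp (L.symm : (Fin 3 → ℝ) →L[ℝ] (Fin 3 → ℝ)), ?_⟩
    have key : ∀ x, l (L.symm (g x)) = l x + l (L.symm c) := by
      intro x; rw [hL, map_add, map_add, L.symm_apply_apply]
    ext x
    constructor
    · rintro ⟨y, hy, rfl⟩
      rw [hl] at hy
      refine ⟨⟨y, hy.1, rfl⟩, ?_⟩
      rintro _ ⟨z, hz, rfl⟩
      simpa [key] using hy.2 z hz
    · rintro ⟨⟨y, hy, rfl⟩, h⟩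
      refine ⟨y, ?_, rfl⟩
      rw [hl]
      exact ⟨hy, fun z hz => by simpa [key] using h _ ⟨z, hz, rfl⟩⟩

theorem IsRatAut.isRationalPolyhedron_image {g : (Fin 3 → ℝ) → (Fin 3 → ℝ)} (hg : IsRatAut g)
    {P : Set (Fin 3 → ℝ)} (hP : IsRationalPolyhedron P) : IsRationalPolyhedron (g '' P) := by
  obtain ⟨L, c, N, hL, hN⟩ := hg.exists_inverse
  obtain ⟨k, A, b, rfl⟩ := hP
  refine ⟨k, fun i j => ∑ m, A i m * N m j, fun i => b i + ∑ m, (A i m : ℝ) * L.symm c m, ?_⟩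
  have key : ∀ (i : Fin k) (y : Fin 3 → ℝ), ∑ j, ((∑ m, A i m * N m j : ℚ) : ℝ) * y j
      = ∑ m, (A i m : ℝ) * L.symm y m := by
    intro i y
    simp only [hN, Fin.sum_univ_three]
    push_cast
    ring
  ext y
  simp only [Set.mem_image, Set.mem_ofPred_eq, key]
  constructor
  · rintro ⟨x, hx, rfl⟩ i
    rw [hL, map_add, L.symm_apply_apply]
    simp only [Pi.add_apply, mul_add, Finset.sum_add_distrib]
    linarith [hx i]
  · intro h
    refine ⟨L.symm (y - c), fun i => ?_, by rw [hL]; simp⟩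
    have := h i
    rw [map_sub]
    simp only [Pi.sub_apply, mul_sub, Finset.sum_sub_distrib]
    linarith

/-- A bijection of `ℝ³` that is affine, with rational linear part, on each cell transports
rational polyhedral complexes. -/
theorem image_mem_rationalPolyhedralStructures {S : Set (Fin 3 → ℝ)}
    {K : Set (Set (Fin 3 → ℝ))} (hK : K ∈ rationalPolyhedralStructures S)
    {φ : (Fin 3 → ℝ) → (Fin 3 → ℝ)} (hφ : Function.Injective φ)
    (haff : ∀ P ∈ K, ∃ g, IsRatAut g ∧ Set.EqOn φ g P) :
    (fun P => φ '' P) '' K ∈ rationalPolyhedralStructures (φ '' S) := by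
  obtain ⟨⟨hC, hU⟩, hR⟩ := hK
  have hrat : ∀ P ∈ K, IsRationalPolyhedron (φ '' P) := by
    intro P hP
    obtain ⟨g, hg, hEq⟩ := haff P hP
    rw [hEq.image_eq]
    exact hg.isRationalPolyhedron_image (hR P hP)
  have hinter : ∀ P ∈ K, ∀ F ⊆ P, IsExposed ℝ P F → IsExposed ℝ (φ '' P) (φ '' F) := by
    intro P hP F hF hex
    obtain ⟨g, hg, hEq⟩ := haff P hP
    rw [hEq.image_eq, (hEq.mono hF).image_eq]
    exact hg.isExposed_image_iff.2 hex
  refine ⟨⟨⟨hC.finite.image _, ?_, ?_, ?_, ?_⟩, ?_⟩, ?_⟩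
  · rintro _ ⟨P, hP, rfl⟩; exact (hC.nonempty P hP).image φ
  · rintro _ ⟨P, hP, rfl⟩; exact (hrat P hP).isPolyhedron
  · rintro _ ⟨P, hP, rfl⟩ F hF hex
    obtain ⟨g, hg, hEq⟩ := haff P hP
    have hsub : F ⊆ φ '' P := hex.subset
    obtain ⟨G, hGP, rfl⟩ := Set.subset_image_iff.1 hsub
    have hsubG : G ⊆ P := hGP
    refine ⟨G, hC.face_mem P hP G hF.of_image ?_, rfl⟩
    change IsExposed ℝ (φ '' P) (φ '' G) at hex
    rw [hEq.image_eq, (hEq.mono hsubG).image_eq] at hex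
    exact hg.isExposed_image_iff.1 hex
  · rintro _ ⟨P, hP, rfl⟩ _ ⟨Q, hQ, rfl⟩ hne
    change (φ '' P ∩ φ '' Q).Nonempty at hne
    change IsExposed ℝ (φ '' P) (φ '' P ∩ φ '' Q) ∧ IsExposed ℝ (φ '' Q) (φ '' P ∩ φ '' Q)
    rw [← Set.image_inter hφ] at hne ⊢
    obtain ⟨h1, h2⟩ := hC.inter_face P hP Q hQ hne.of_image
    exact ⟨hinter P hP _ Set.inter_subset_left h1, hinter Q hQ _ Set.inter_subset_right h2⟩
  · rw [← hU, Set.sUnion_image, Set.sUnion_eq_biUnion, Set.image_iUnion₂]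
  · rintro _ ⟨P, hP, rfl⟩; exact hrat P hP

/-! ### The tropical Segre map -/

/-- The inverse of `segre`. -/
noncomputable def segreInv (q : Fin 3 → ℝ) : Fin 3 → ℝ :=
  ![q 0, q 1 + max (-q 2) 0, q 0 + q 1 + max (q 2) 0]

theorem segre_segreInv (q : Fin 3 → ℝ) : segre (segreInv q) = q := by
  ext i
  rcases le_total (q 2) 0 with h | h
  · have h1 : max (-q 2) 0 = -q 2 := max_eq_left (by linarith)
    have h2 : max (q 2) 0 = 0 := max_eq_right h
    fin_cases i <;> simp [segre, segreInv, h]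
  · have h1 : max (-q 2) 0 = 0 := max_eq_right (by linarith)
    have h2 : max (q 2) 0 = q 2 := max_eq_left h
    rcases h.eq_or_lt with h0 | h0
    · rw [← h0] at h1 h2
      fin_cases i <;> simp [segre, segreInv, ← h0]
    · have h4 : ¬ q 2 ≤ 0 := not_le.2 h0
      fin_cases i <;> simp [segre, segreInv, h1, h2, h4]
      ring

theorem segreInv_segre (v : Fin 3 → ℝ) : segreInv (segre v) = v := by
  ext i
  by_cases h : v 2 ≤ v 0 + v 1
  · have h1 : max (-(v 2 - v 0 - v 1)) 0 = -(v 2 - v 0 - v 1) := max_eq_left (by linarith)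
    have h2 : max (v 2 - v 0 - v 1) 0 = 0 := max_eq_right (by linarith)
    fin_cases i <;> simp only [segre, segreInv, h, if_true] <;> simp [-neg_sub, h1, h2]
    ring
  · have h1 : max (-(v 2 - v 0 - v 1)) 0 = 0 := max_eq_right (by linarith)
    have h2 : max (v 2 - v 0 - v 1) 0 = v 2 - v 0 - v 1 := max_eq_left (by linarith)
    fin_cases i <;> simp only [segre, segreInv, h, if_false] <;> simp [-neg_sub, h1, h2]

theorem segreInv_injective : Function.Injective segreInv :=
  Function.LeftInverse.injective segre_segreInv

theorem segre_preimage (S : Set (Fin 3 → ℝ)) : segre ⁻¹' S = segreInv '' S :=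
  (congrFun (Set.image_eq_preimage_of_inverse segre_segreInv segreInv_segre) S).symm

theorem continuous_segreInv : Continuous segreInv := by
  refine continuous_pi fun i => ?_
  fin_cases i <;> simp [segreInv] <;> fun_prop

theorem isRatAut_of_matrix (M : Matrix (Fin 3) (Fin 3) ℚ) (hM : M.det ≠ 0) (c : Fin 3 → ℝ) :
    IsRatAut fun x i => ∑ j, (M i j : ℝ) * x j + c i :=
  ⟨M, c, hM, fun _ _ => rfl⟩

/-- The functional `l`, whose sign distinguishes the two linear pieces of `segreInv`. -/
def lengthFunctional : RatAff := (![0, 0, 1], 0)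

theorem ev_lengthFunctional (x : Fin 3 → ℝ) : lengthFunctional.ev x = x 2 := by
  simp [RatAff.ev, lengthFunctional, Fin.sum_univ_three]

theorem exists_isRatAut_eqOn_segreInv {Φ : Finset RatAff} (hΦ : lengthFunctional ∈ Φ)
    (x : Fin 3 → ℝ) : ∃ g, IsRatAut g ∧ Set.EqOn segreInv g (closedCell Φ x) := by
  rcases le_total (x 2) 0 with h | h
  · refine ⟨_, isRatAut_of_matrix !![1, 0, 0; 0, 1, -1; 1, 1, 0]
      (by simp [Matrix.det_fin_three]) 0, fun y hy => ?_⟩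
    have hy2 : y 2 ≤ 0 := by
      have := (hy _ hΦ).1
      rw [ev_lengthFunctional, ev_lengthFunctional] at this
      exact this h
    have h1 : max (-y 2) 0 = -y 2 := max_eq_left (by linarith)
    have h2 : max (y 2) 0 = 0 := max_eq_right hy2
    ext i
    fin_cases i <;> simp [segreInv, h1, h2, Fin.sum_univ_three]
  · refine ⟨_, isRatAut_of_matrix !![1, 0, 0; 0, 1, 0; 1, 1, 1]
      (by simp [Matrix.det_fin_three]) 0, fun y hy => ?_⟩
    have hy2 : 0 ≤ y 2 := by
      have := (hy _ hΦ).2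
      rw [ev_lengthFunctional, ev_lengthFunctional] at this
      exact this h
    have h1 : max (-y 2) 0 = 0 := max_eq_right (by linarith)
    have h2 : max (y 2) 0 = y 2 := max_eq_left hy2
    ext i
    fin_cases i <;> simp [segreInv, h1, h2, Fin.sum_univ_three]

theorem connected_and_polyhedral_of_resolves {T Ω : Set (Fin 3 → ℝ)} {Φ : Finset RatAff}
    (hT : IsClosed T) (hΦ : Resolves Φ T) (hΩ : Ω ∈ components T) :
    (IsConnected Ω ∧ (rationalPolyhedralStructures Ω).Nonempty) ∧
      (IsConnected (segre ⁻¹' Ω) ∧ (rationalPolyhedralStructures (segre ⁻¹' Ω)).Nonempty) := by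
  classical
  obtain ⟨x, hx, rfl⟩ := hΩ
  obtain ⟨hcl, hres⟩ := component_isClosed_resolves hT hΦ (x := x)
  have hres' := hres.mono (Finset.subset_insert lengthFunctional Φ)
  have hconn : IsConnected (connectedComponentIn T x) :=
    ⟨⟨x, mem_connectedComponentIn hx⟩, isPreconnected_connectedComponentIn⟩
  have hK := closedCell_image_mem_rationalPolyhedralStructures hcl hres'
  rw [segre_preimage]
  refine ⟨⟨hconn, _, hK⟩, hconn.image _ continuous_segreInv.continuousOn, _,
    image_mem_rationalPolyhedralStructures hK segreInv_injective ?_⟩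
  rintro _ ⟨y, -, rfl⟩
  exact exists_isRatAut_eqOn_segreInv (Finset.mem_insert_self _ _) y

end Tritangent

namespace Tritangent

/-! ### Slopes of a tropical polynomial along a line -/

/-- The pairing of an exponent with a direction: the slope of a monomial. -/
def pair (m : Expo) (u : ℤ × ℤ) : ℤ := ((m.1 : ℕ) : ℤ) * u.1 + ((m.2 : ℕ) : ℤ) * u.2

/-- An integral direction, as a vector of `ℝ²`. -/
def vec (u : ℤ × ℤ) : ℝ × ℝ := ((u.1 : ℝ), (u.2 : ℝ))

theorem pair_neg (m : Expo) (u : ℤ × ℤ) : pair m (-u) = -pair m u := by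
  simp only [pair, Prod.fst_neg, Prod.snd_neg]; ring

theorem vec_neg (u : ℤ × ℤ) : vec (-u) = -vec u := by
  ext <;> simp [vec]

theorem monomialVal_add_smul (a : Expo → ℝ) (m : Expo) (p : ℝ × ℝ) (t : ℝ) (u : ℤ × ℤ) :
    monomialVal a m (p + t • vec u) = monomialVal a m p + t * (pair m u : ℝ) := by
  simp only [monomialVal, pair, vec, Prod.fst_add, Prod.snd_add, Prod.smul_fst, Prod.smul_snd,
    smul_eq_mul]
  push_cast
  ring

theorem continuous_monomialVal (a : Expo → ℝ) (m : Expo) : Continuous (monomialVal a m) := by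
  unfold monomialVal; fun_prop

theorem mem_active {a : Expo → ℝ} {p : ℝ × ℝ} {m : Expo} :
    m ∈ active a p ↔ ∀ n, monomialVal a n p ≤ monomialVal a m p := by
  simp [active]

theorem val_eq_of_mem_active {a : Expo → ℝ} {p : ℝ × ℝ} {m n : Expo} (hm : m ∈ active a p)
    (hn : n ∈ active a p) : monomialVal a m p = monomialVal a n p :=
  le_antisymm (mem_active.1 hn m) (mem_active.1 hm n)

theorem mem_active_of_val_eq {a : Expo → ℝ} {p : ℝ × ℝ} {m n : Expo} (hm : m ∈ active a p)
    (h : monomialVal a n p = monomialVal a m p) : n ∈ active a p :=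
  mem_active.2 fun k => h ▸ mem_active.1 hm k

theorem pair_le_tropSlope {a : Expo → ℝ} {p : ℝ × ℝ} {m : Expo} (hm : m ∈ active a p)
    (u : ℤ × ℤ) : pair m u ≤ tropSlope a p u :=
  Finset.le_sup' (f := fun m : Expo => pair m u) hm

theorem exists_pair_eq_tropSlope (a : Expo → ℝ) (p : ℝ × ℝ) (u : ℤ × ℤ) :
    ∃ m ∈ active a p, pair m u = tropSlope a p u := by
  obtain ⟨m, hm, h⟩ := Finset.exists_mem_eq_sup' (active_nonempty a p) fun m : Expo => pair m u
  exact ⟨m, hm, h.symm⟩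

theorem tropSlope_eq {a : Expo → ℝ} {p : ℝ × ℝ} {u : ℤ × ℤ} {s : ℤ}
    (h : ∀ m ∈ active a p, pair m u = s) : tropSlope a p u = s := by
  obtain ⟨m, hm, h'⟩ := exists_pair_eq_tropSlope a p u
  rw [← h', h m hm]

/-- Moving from `p` slightly in direction `u`, the active monomials are those active at `p` whose
slope is maximal. -/
theorem exists_active_right (a : Expo → ℝ) (p : ℝ × ℝ) (u : ℤ × ℤ) :
    ∃ ε > 0, ∀ t ∈ Set.Ioo (0 : ℝ) ε,
      active a (p + t • vec u) = (active a p).filter fun m => pair m u = tropSlope a p u := by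
  obtain ⟨m₀, hm₀, hs⟩ := exists_pair_eq_tropSlope a p u
  have key : ∀ n : Expo, ∀ᶠ t : ℝ in 𝓝[>] 0,
      monomialVal a n (p + t • vec u) ≤ monomialVal a m₀ (p + t • vec u) ∧
      (monomialVal a n (p + t • vec u) = monomialVal a m₀ (p + t • vec u) ↔
        n ∈ active a p ∧ pair n u = tropSlope a p u) := by
    intro n
    by_cases hn : n ∈ active a p
    · have hle : pair n u ≤ pair m₀ u := hs ▸ pair_le_tropSlope hn u
      have hle' : (pair n u : ℝ) ≤ pair m₀ u := by exact_mod_cast hle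
      filter_upwards [self_mem_nhdsWithin] with t ht
      have ht : 0 < t := ht
      rw [monomialVal_add_smul, monomialVal_add_smul, val_eq_of_mem_active hn hm₀, ← hs]
      refine ⟨by nlinarith, ?_⟩
      rw [add_right_inj, mul_right_inj' ht.ne', Int.cast_inj]
      simp [hn]
    · have hlt : monomialVal a n p < monomialVal a m₀ p :=
        lt_of_le_of_ne (mem_active.1 hm₀ n) fun h => hn (mem_active_of_val_eq hm₀ h)
      have hc : Continuous fun t : ℝ => p + t • vec u := by fun_prop
      have h1 := ((continuous_monomialVal a n).comp hc).tendsto 0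
      have h2 := ((continuous_monomialVal a m₀).comp hc).tendsto 0
      have h3 := h1.eventually_lt h2 (by simpa using hlt)
      filter_upwards [h3.filter_mono nhdsWithin_le_nhds] with t ht
      exact ⟨le_of_lt ht, fun h => absurd h (ne_of_lt ht), fun h => absurd h.1 hn⟩
  obtain ⟨ε, hε, h⟩ := mem_nhdsGT_iff_exists_Ioo_subset.1 (Filter.eventually_all.2 key)
  refine ⟨ε, hε, fun t ht => ?_⟩
  have ht' := h ht
  have hm₀' : m₀ ∈ active a (p + t • vec u) := mem_active.2 fun n => (ht' n).1
  ext n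
  rw [Finset.mem_filter, ← (ht' n).2]
  exact ⟨fun hn => val_eq_of_mem_active hn hm₀', fun hn => mem_active_of_val_eq hm₀' hn⟩

/-- Far away on a ray, the set of active monomials is constant and consists of monomials of
maximal slope. -/
theorem exists_active_atTop (a : Expo → ℝ) (p : ℝ × ℝ) (u : ℤ × ℤ) :
    ∃ S : Finset Expo, (∀ m ∈ S, ∀ n, pair n u ≤ pair m u) ∧
      ∃ t₀ : ℝ, 0 < t₀ ∧ ∀ t, t₀ ≤ t → active a (p + t • vec u) = S := by
  classical
  obtain ⟨m₀, hm₀⟩ := Finite.exists_max fun n : Expo => toLex (pair n u, monomialVal a n p)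
  have key : ∀ n : Expo, ∀ᶠ t : ℝ in atTop,
      monomialVal a n (p + t • vec u) ≤ monomialVal a m₀ (p + t • vec u) ∧
      (monomialVal a n (p + t • vec u) = monomialVal a m₀ (p + t • vec u) ↔
        pair n u = pair m₀ u ∧ monomialVal a n p = monomialVal a m₀ p) := by
    intro n
    rcases (Prod.Lex.le_iff.1 (hm₀ n)) with h | ⟨h, h'⟩
    · have h : pair n u < pair m₀ u := h
      have h1 : (pair n u : ℝ) + 1 ≤ pair m₀ u := by exact_mod_cast h
      filter_upwards [eventually_gt_atTop (max 0 (monomialVal a n p - monomialVal a m₀ p))]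
        with t ht
      have ht0 := (le_max_left _ _).trans_lt ht
      have ht1 := (le_max_right _ _).trans_lt ht
      rw [monomialVal_add_smul, monomialVal_add_smul]
      have : t * ((pair n u : ℝ) + 1) ≤ t * (pair m₀ u : ℝ) := by gcongr
      refine ⟨by linarith, fun h' => by linarith, fun h' => absurd h'.1 h.ne⟩
    · have h : pair n u = pair m₀ u := h
      have h' : monomialVal a n p ≤ monomialVal a m₀ p := h'
      refine Eventually.of_forall fun t => ?_
      rw [monomialVal_add_smul, monomialVal_add_smul, h]
      simpa using h'
  obtain ⟨t₀, ht₀⟩ := Filter.eventually_atTop.1 (Filter.eventually_all.2 key)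
  refine ⟨Finset.univ.filter fun n => pair n u = pair m₀ u ∧
    monomialVal a n p = monomialVal a m₀ p, ?_, max t₀ 1, by positivity, fun t ht => ?_⟩
  · intro m hm n
    rw [(Finset.mem_filter.1 hm).2.1]
    rcases (Prod.Lex.le_iff.1 (hm₀ n)) with h | ⟨h, -⟩
    · exact le_of_lt h
    · exact le_of_eq h
  · have ht' := ht₀ t ((le_max_left _ _).trans ht)
    have hm₀' : m₀ ∈ active a (p + t • vec u) := mem_active.2 fun n => (ht' n).1
    ext n
    rw [Finset.mem_filter, ← (ht' n).2]
    exact ⟨fun hn => ⟨Finset.mem_univ _, val_eq_of_mem_active hn hm₀'⟩,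
      fun hn => mem_active_of_val_eq hm₀' hn.2⟩

/-- The slope of `F` along the line `t ↦ p + t u` to the right of `t`. -/
noncomputable def slopeR (a : Expo → ℝ) (p : ℝ × ℝ) (u : ℤ × ℤ) (t : ℝ) : ℤ :=
  tropSlope a (p + t • vec u) u

/-- The slope of `F` along the line `t ↦ p + t u` to the left of `t`. -/
noncomputable def slopeL (a : Expo → ℝ) (p : ℝ × ℝ) (u : ℤ × ℤ) (t : ℝ) : ℤ :=
  -tropSlope a (p + t • vec u) (-u)

theorem line_add (p : ℝ × ℝ) (u : ℤ × ℤ) (s t : ℝ) :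
    p + s • vec u = p + t • vec u + (s - t) • vec u := by
  module

theorem exists_slope_right (a : Expo → ℝ) (p : ℝ × ℝ) (u : ℤ × ℤ) (t : ℝ) :
    ∃ ε > 0, ∀ s ∈ Set.Ioo t (t + ε), slopeR a p u s = slopeR a p u t ∧
      slopeL a p u s = slopeR a p u t ∧ active a (p + s • vec u) =
        (active a (p + t • vec u)).filter fun m => pair m u = slopeR a p u t := by
  obtain ⟨ε, hε, h⟩ := exists_active_right a (p + t • vec u) u
  refine ⟨ε, hε, fun s hs => ?_⟩
  have hact := h (s - t) ⟨by linarith [hs.1], by linarith [hs.2]⟩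
  rw [← line_add] at hact
  have hm : ∀ m ∈ active a (p + s • vec u), pair m u = slopeR a p u t := by
    intro m hm
    rw [hact] at hm
    exact (Finset.mem_filter.1 hm).2
  refine ⟨tropSlope_eq hm, ?_, hact⟩
  rw [slopeL, tropSlope_eq (s := -slopeR a p u t), neg_neg]
  intro m hm'
  rw [pair_neg, hm m hm']

theorem exists_slope_left (a : Expo → ℝ) (p : ℝ × ℝ) (u : ℤ × ℤ) (t : ℝ) :
    ∃ ε > 0, ∀ s ∈ Set.Ioo (t - ε) t, slopeR a p u s = slopeL a p u t ∧
      slopeL a p u s = slopeL a p u t ∧ active a (p + s • vec u) =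
        (active a (p + t • vec u)).filter fun m => pair m u = slopeL a p u t := by
  obtain ⟨ε, hε, h⟩ := exists_active_right a (p + t • vec u) (-u)
  refine ⟨ε, hε, fun s hs => ?_⟩
  have hact := h (t - s) ⟨by linarith [hs.2], by linarith [hs.1]⟩
  have hline : p + t • vec u + (t - s) • vec (-u) = p + s • vec u := by
    rw [vec_neg]; module
  rw [hline] at hact
  have hm : ∀ m ∈ active a (p + s • vec u), pair m u = slopeL a p u t := by
    intro m hm
    rw [hact] at hm
    have := (Finset.mem_filter.1 hm).2
    rw [pair_neg] at this
    rw [slopeL, ← this, neg_neg]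
  refine ⟨tropSlope_eq hm, ?_, ?_⟩
  · rw [slopeL, tropSlope_eq (s := -slopeL a p u t), neg_neg]
    intro m hm'
    rw [pair_neg, hm m hm']
  · rw [hact]
    refine Finset.filter_congr fun m _ => ?_
    rw [pair_neg, slopeL]
    constructor <;> intro h <;> linarith

theorem finite_setOf_slope_ne (a : Expo → ℝ) (p : ℝ × ℝ) (u : ℤ × ℤ) :
    {t | slopeR a p u t ≠ slopeL a p u t}.Finite := by
  have hsub : {t | slopeR a p u t ≠ slopeL a p u t} ⊆ ⋃ m : Expo, ⋃ n : Expo,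
      {t | pair m u ≠ pair n u ∧
        monomialVal a m (p + t • vec u) = monomialVal a n (p + t • vec u)} := by
    intro t ht
    obtain ⟨m, hm, hm'⟩ := exists_pair_eq_tropSlope a (p + t • vec u) u
    obtain ⟨n, hn, hn'⟩ := exists_pair_eq_tropSlope a (p + t • vec u) (-u)
    simp only [Set.mem_iUnion]
    refine ⟨m, n, fun h => ht ?_, val_eq_of_mem_active hm hn⟩
    rw [slopeR, slopeL, ← hm', ← hn', pair_neg, neg_neg, h]
  refine (Set.finite_iUnion fun m => Set.finite_iUnion fun n =>
    Set.Subsingleton.finite ?_).subset hsub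
  rintro s ⟨hne, hs⟩ t ⟨-, ht⟩
  rw [monomialVal_add_smul, monomialVal_add_smul] at hs ht
  have hne' : (pair m u : ℝ) - pair n u ≠ 0 := sub_ne_zero.2 (by exact_mod_cast hne)
  have : (s - t) * ((pair m u : ℝ) - pair n u) = 0 := by linear_combination hs - ht
  have := (mul_eq_zero.1 this).resolve_right hne'
  linarith

/-! ### Sums of jumps -/

section Jumps

variable {R L : ℝ → ℤ}

/-- For an integer-valued step function, with one-sided values `R` and `L`, the jumps in `(α, β]`
add up to `R β - R α`. -/
theorem sum_jumps (hr : ∀ t, ∃ ε > 0, ∀ s ∈ Set.Ioo t (t + ε), R s = R t ∧ L s = R t)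
    (hl : ∀ t, ∃ ε > 0, ∀ s ∈ Set.Ioo (t - ε) t, R s = L t ∧ L s = L t)
    (D : Finset ℝ) (hD : ∀ t, R t ≠ L t → t ∈ D) {α β : ℝ} (hαβ : α ≤ β) :
    ∑ t ∈ D with α < t ∧ t ≤ β, (R t - L t) = R β - R α := by
  classical
  let S : ℝ → ℤ := fun x => ∑ t ∈ D with t ≤ x, (R t - L t)
  have hSdiff : ∀ x y, x ≤ y → S y - S x = ∑ t ∈ D with x < t ∧ t ≤ y, (R t - L t) := by
    intro x y hxy
    have : D.filter (fun t => t ≤ y) =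
        D.filter (fun t => t ≤ x) ∪ D.filter (fun t => x < t ∧ t ≤ y) := by
      ext t
      simp only [Finset.mem_filter, Finset.mem_union]
      constructor
      · rintro ⟨h1, h2⟩
        rcases le_or_gt t x with h | h
        · exact Or.inl ⟨h1, h⟩
        · exact Or.inr ⟨h1, h, h2⟩
      · rintro (⟨h1, h2⟩ | ⟨h1, -, h2⟩)
        · exact ⟨h1, h2.trans hxy⟩
        · exact ⟨h1, h2⟩
    simp only [S]
    rw [this, Finset.sum_union, add_sub_cancel_left]
    rw [Finset.disjoint_filter]
    intro t _ h1 h2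
    exact absurd h1 (not_le.2 h2.1)
  have hloc : IsLocallyConstant fun x => R x - S x := by
    rw [IsLocallyConstant.iff_eventually_eq]
    intro x
    obtain ⟨ε, hε, h1⟩ := hr x
    obtain ⟨δ, hδ, h2⟩ := hl x
    filter_upwards [Ioo_mem_nhds (show x - δ < x by linarith) (show x < x + ε by linarith)]
      with y hy
    rcases lt_trichotomy y x with h | rfl | h
    · have hs : S x - S y = R x - L x := by
        rw [hSdiff y x h.le]
        have : ∑ t ∈ D with y < t ∧ t ≤ x, (R t - L t) = ∑ t ∈ D with t = x, (R t - L t) := by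
          rw [Finset.sum_filter, Finset.sum_filter]
          refine Finset.sum_congr rfl fun t _ => ?_
          by_cases hx : t = x
          · simp [hx, h]
          · rw [if_neg hx]
            split_ifs with hc
            · have := h2 t ⟨hy.1.trans hc.1, lt_of_le_of_ne hc.2 hx⟩
              rw [this.1, this.2, sub_self]
            · rfl
        rw [this, Finset.filter_eq' D x]
        split_ifs with hx
        · simp
        · have : R x = L x := by
            by_contra hne
            exact hx (hD x hne)
          simp [this]
      have := (h2 y ⟨hy.1, h⟩).1
      linarith
    · rfl
    · have hs : S y - S x = 0 := by
        rw [hSdiff x y h.le]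
        refine Finset.sum_eq_zero fun t ht => ?_
        obtain ⟨-, h3, h4⟩ := Finset.mem_filter.1 ht
        have := h1 t ⟨h3, h4.trans_lt hy.2⟩
        rw [this.1, this.2, sub_self]
      have := (h1 y ⟨h, hy.2⟩).1
      linarith
  have : R α - S α = R β - S β := hloc.apply_eq_of_preconnectedSpace α β
  have h2 := hSdiff α β hαβ
  linarith

/-- The contribution of the point with parameter `t` of an edge of length `ℓ` to the stable
multiplicity: the sum of the outgoing slopes along the edge. -/
noncomputable def edgeMult (R L : ℝ → ℤ) (ℓ : EReal) (t : ℝ) : ℤ :=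
  (if (t : EReal) < ℓ then R t else 0) - (if 0 < t then L t else 0)

theorem finite_support_edgeMult (hD : {t | R t ≠ L t}.Finite) (ℓ : EReal) :
    (Function.support fun t : ℝ => if 0 ≤ t ∧ (t : EReal) ≤ ℓ then edgeMult R L ℓ t else 0).Finite := by
  refine (hD.union (Set.toFinite {0, ℓ.toReal})).subset fun t ht => ?_
  by_contra hne
  simp only [Set.mem_union, Set.mem_ofPred_eq, Set.mem_insert_iff, Set.mem_singleton_iff, not_or,
    ne_eq, not_not] at hne
  obtain ⟨h1, h2, h3⟩ := hne
  refine ht ?_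
  simp only
  split_ifs with h
  · have h4 : (t : EReal) ≠ ℓ := fun h => h3 (by rw [← h, EReal.toReal_coe])
    rw [edgeMult, if_pos (lt_of_le_of_ne h.2 h4), if_pos (lt_of_le_of_ne h.1 (Ne.symm h2)), h1,
      sub_self]
  · rfl

theorem finsum_edgeMult_Icc
    (hr : ∀ t, ∃ ε > 0, ∀ s ∈ Set.Ioo t (t + ε), R s = R t ∧ L s = R t)
    (hl : ∀ t, ∃ ε > 0, ∀ s ∈ Set.Ioo (t - ε) t, R s = L t ∧ L s = L t)
    (hD : {t | R t ≠ L t}.Finite) {ℓ : EReal} {α β : ℝ} (h0 : 0 ≤ α) (hαβ : α ≤ β)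
    (hβ : (β : EReal) ≤ ℓ) :
    ∑ᶠ t ∈ Set.Icc α β, edgeMult R L ℓ t =
      (if (β : EReal) < ℓ then R β else 0) - (if 0 < α then L α else 0) := by
  classical
  rcases hαβ.eq_or_lt with rfl | hlt
  · rw [Set.Icc_self, finsum_mem_singleton, edgeMult]
  have hαℓ : (α : EReal) < ℓ := lt_of_lt_of_le (by exact_mod_cast hlt) hβ
  have hβ0 : 0 < β := h0.trans_lt hlt
  let D : Finset ℝ := hD.toFinset ∪ {α, β}
  have hin : ∀ t, α < t → t < β → edgeMult R L ℓ t = R t - L t := by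
    intro t h1 h2
    have : (t : EReal) < ℓ := lt_of_lt_of_le (by exact_mod_cast h2) hβ
    rw [edgeMult, if_pos this, if_pos (h0.trans_lt h1)]
  have hsum : ∑ᶠ t ∈ Set.Icc α β, edgeMult R L ℓ t =
      ∑ t ∈ D with α ≤ t ∧ t ≤ β, edgeMult R L ℓ t := by
    refine finsum_mem_eq_sum_of_inter_support_eq _ ?_
    ext t
    simp only [Set.mem_inter_iff, Set.mem_Icc, Function.mem_support, Finset.coe_filter,
      Set.mem_ofPred_eq]
    constructor
    · rintro ⟨h, hne⟩
      refine ⟨⟨?_, h⟩, hne⟩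
      by_contra hD'
      simp only [D, Finset.mem_union, Set.Finite.mem_toFinset, Set.mem_ofPred_eq,
        Finset.mem_insert, Finset.mem_singleton, not_or, not_not, ne_eq] at hD'
      obtain ⟨h1, h2, h3⟩ := hD'
      exact hne (by rw [hin t (lt_of_le_of_ne h.1 (Ne.symm h2)) (lt_of_le_of_ne h.2 h3), h1, sub_self])
    · rintro ⟨⟨-, h⟩, hne⟩
      exact ⟨h, hne⟩
  have hj := sum_jumps hr hl D (fun t ht => by simp [D, ht]) hαβ
  have hα : D.filter (fun t => α ≤ t ∧ t ≤ β) =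
      insert α (D.filter fun t => α < t ∧ t ≤ β) := by
    ext t
    simp only [Finset.mem_filter, Finset.mem_insert]
    constructor
    · rintro ⟨h1, h2, h3⟩
      rcases h2.eq_or_lt with h | h
      · exact Or.inl h.symm
      · exact Or.inr ⟨h1, h, h3⟩
    · rintro (rfl | ⟨h1, h2, h3⟩)
      · exact ⟨by simp [D], le_rfl, hαβ⟩
      · exact ⟨h1, h2.le, h3⟩
  have hβD : D.filter (fun t => α < t ∧ t ≤ β) =
      insert β (D.filter fun t => α < t ∧ t < β) := by
    ext t
    simp only [Finset.mem_filter, Finset.mem_insert]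
    constructor
    · rintro ⟨h1, h2, h3⟩
      rcases h3.eq_or_lt with h | h
      · exact Or.inl h
      · exact Or.inr ⟨h1, h2, h⟩
    · rintro (rfl | ⟨h1, h2, h3⟩)
      · exact ⟨by simp [D], hlt, le_rfl⟩
      · exact ⟨h1, h2, h3.le⟩
  have hsame : ∑ t ∈ D with α < t ∧ t < β, edgeMult R L ℓ t =
      ∑ t ∈ D with α < t ∧ t < β, (R t - L t) :=
    Finset.sum_congr rfl fun t ht => hin t (Finset.mem_filter.1 ht).2.1 (Finset.mem_filter.1 ht).2.2
  rw [hβD, Finset.sum_insert (by simp)] at hj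
  rw [hsum, hα, Finset.sum_insert (by simp), hβD, Finset.sum_insert (by simp), hsame]
  have e1 : edgeMult R L ℓ α = R α - (if 0 < α then L α else 0) := by rw [edgeMult, if_pos hαℓ]
  have e2 : edgeMult R L ℓ β = (if (β : EReal) < ℓ then R β else 0) - L β := by
    rw [edgeMult, if_pos hβ0]
  rw [e1, e2]
  linarith

end Jumps

end Tritangent

namespace Tritangent

section Jumps

variable {R L : ℝ → ℤ}

/-- If the outer slopes at the ends of an interval `J` of an edge all have the parity of `π`, then
modulo two only the end points of the edge contribute to the multiplicity carried by `J`. -/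
theorem finsum_edgeMult_modEq
    (hr : ∀ t, ∃ ε > 0, ∀ s ∈ Set.Ioo t (t + ε), R s = R t ∧ L s = R t)
    (hl : ∀ t, ∃ ε > 0, ∀ s ∈ Set.Ioo (t - ε) t, R s = L t ∧ L s = L t)
    (hD : {t | R t ≠ L t}.Finite) {ℓ : EReal} {J : Set ℝ} (hJ : J.OrdConnected)
    (hcl : IsClosed J) (hJℓ : ∀ t ∈ J, 0 ≤ t ∧ (t : EReal) ≤ ℓ) {π : ℤ}
    (hinf : ℓ = ⊤ → ∃ T, ∀ t, T ≤ t → R t = L t ∧ R t ≡ π [ZMOD 2])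
    (hleft : ∀ α ∈ J, 0 < α → (∀ s ∈ J, α ≤ s) → L α ≡ π [ZMOD 2])
    (hright : ∀ β ∈ J, (β : EReal) < ℓ → (∀ s ∈ J, s ≤ β) → R β ≡ π [ZMOD 2])
    [Decidable ((0 : ℝ) ∈ J)] [Decidable (∃ t ∈ J, (t : EReal) = ℓ)] :
    ∑ᶠ t ∈ J, edgeMult R L ℓ t ≡
      π * ((if (0 : ℝ) ∈ J then 1 else 0) + (if ∃ t ∈ J, (t : EReal) = ℓ then 1 else 0))
      [ZMOD 2] := by
  rcases J.eq_empty_or_nonempty with rfl | hne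
  · simp
  have hbelow : BddBelow J := ⟨0, fun t ht => (hJℓ t ht).1⟩
  have hα := hcl.csInf_mem hne hbelow
  set α := sInf J with hαdef
  have hαmin : ∀ s ∈ J, α ≤ s := fun s hs => csInf_le hbelow hs
  have hα0 := (hJℓ α hα).1
  have hzero : (0 : ℝ) ∈ J ↔ ¬ 0 < α :=
    ⟨fun h => not_lt.2 (hαmin 0 h), fun h => by rwa [← le_antisymm (not_lt.1 h) hα0]⟩
  -- The interval, or a bounded part of it that carries the whole multiplicity.
  obtain ⟨β, hβ, hsum, hβπ, hend⟩ : ∃ β ∈ J,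
      ∑ᶠ t ∈ J, edgeMult R L ℓ t = ∑ᶠ t ∈ Set.Icc α β, edgeMult R L ℓ t ∧
      ((β : EReal) < ℓ → R β ≡ π [ZMOD 2]) ∧ ((∃ t ∈ J, (t : EReal) = ℓ) ↔ (β : EReal) = ℓ) := by
    by_cases hb : BddAbove J
    · have hβ := hcl.csSup_mem hne hb
      have hβmax : ∀ s ∈ J, s ≤ sSup J := fun s hs => le_csSup hb hs
      have hJeq : J = Set.Icc α (sSup J) :=
        Set.Subset.antisymm (fun s hs => ⟨hαmin s hs, hβmax s hs⟩) (hJ.out hα hβ)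
      refine ⟨sSup J, hβ, by rw [← hJeq], fun h => hright _ hβ h hβmax, ?_, fun h => ⟨_, hβ, h⟩⟩
      rintro ⟨t, ht, rfl⟩
      exact le_antisymm (hJℓ _ hβ).2 (by exact_mod_cast hβmax t ht)
    · have hunb : ∀ T, ∃ t ∈ J, T < t := not_bddAbove_iff.1 hb
      have hℓ : ℓ = ⊤ := by
        rw [EReal.eq_top_iff_forall_lt]
        intro y
        obtain ⟨t, ht, hy⟩ := hunb y
        exact lt_of_lt_of_le (by exact_mod_cast hy) (hJℓ t ht).2
      obtain ⟨T, hT⟩ := hinf hℓ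
      obtain ⟨β, hβ, hTβ⟩ := hunb T
      have hIcc : Set.Icc α β ⊆ J := hJ.out hα hβ
      refine ⟨β, hβ, ?_, fun _ => (hT β hTβ.le).2, ?_⟩
      · refine finsum_mem_inter_support_eq' _ _ _ fun t ht => ⟨fun htJ => ⟨hαmin t htJ, ?_⟩,
          fun h => hIcc h⟩
        by_contra hlt
        rw [not_le] at hlt
        refine ht ?_
        have h0 : 0 < t := (hJℓ β hβ).1.trans_lt hlt
        rw [edgeMult, if_pos h0, hℓ, if_pos (EReal.coe_lt_top t),
          (hT t (hTβ.le.trans hlt.le)).1, sub_self]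
      · rw [hℓ]
        simp
  rw [hsum, finsum_edgeMult_Icc hr hl hD hα0 (hαmin β hβ) (hJℓ β hβ).2]
  simp only [hzero, hend]
  have hlπ : 0 < α → L α ≡ π [ZMOD 2] := fun h => hleft α hα h hαmin
  have key : ∀ x : ℤ, x ≡ π [ZMOD 2] → x % 2 = π % 2 := fun x h => h
  by_cases h1 : 0 < α
  · have e1 := key _ (hlπ h1)
    rcases (hJℓ β hβ).2.eq_or_lt with h2 | h2
    · rw [if_neg h2.not_lt, if_pos h1, if_neg (not_not.2 h1), if_pos h2]
      change _ % 2 = _ % 2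
      omega
    · have e2 := key _ (hβπ h2)
      rw [if_pos h2, if_pos h1, if_neg (not_not.2 h1), if_neg h2.ne]
      change _ % 2 = _ % 2
      omega
  · rcases (hJℓ β hβ).2.eq_or_lt with h2 | h2
    · rw [if_neg h2.not_lt, if_neg h1, if_pos h1, if_pos h2]
      change _ % 2 = _ % 2
      omega
    · have e2 := key _ (hβπ h2)
      rw [if_pos h2, if_neg h1, if_pos h1, if_neg h2.ne]
      change _ % 2 = _ % 2
      omega

end Jumps

end Tritangent

namespace Tritangent

/-! ### Edges and legs of a curve of bidegree (1,1) -/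

/-- The four legs and the bounded edge of a `(1,1)`-curve. -/
inductive Edge
  | left | right | down | up | mid
  deriving DecidableEq

instance : Fintype Edge :=
  ⟨{.left, .right, .down, .up, .mid}, fun e => by cases e <;> decide⟩

/-- The vertex at which an edge or leg starts; the bounded edge starts at `v₀`. -/
noncomputable def base (q : Fin 3 → ℝ) : Edge → ℝ × ℝ
  | .left => if 0 ≤ q 2 then v₀ q else v₁ q
  | .right => if 0 ≤ q 2 then v₁ q else v₀ q
  | .down => v₀ q
  | .up => v₁ q
  | .mid => v₀ q

/-- The primitive direction of an edge or leg, pointing away from its base. -/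
noncomputable def dir (q : Fin 3 → ℝ) : Edge → ℤ × ℤ
  | .left => (-1, 0)
  | .right => (1, 0)
  | .down => (0, -1)
  | .up => (0, 1)
  | .mid => if 0 ≤ q 2 then (1, 1) else (-1, 1)

/-- The lattice length of an edge or leg. -/
noncomputable def len (q : Fin 3 → ℝ) : Edge → EReal
  | .mid => (|q 2| : ℝ)
  | _ => ⊤

/-- The parity of the slopes of `F` along the parts of an edge or leg of a tritangent curve that lie
outside the curve of `F`. -/
noncomputable def par (q : Fin 3 → ℝ) : Edge → ℤ
  | .left => 0
  | .right => 1
  | .down => 0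
  | .up => 1
  | .mid => if 0 ≤ q 2 then 0 else 1

/-- The point with parameter `t` of an edge or leg. -/
noncomputable def pt (q : Fin 3 → ℝ) (e : Edge) (t : ℝ) : ℝ × ℝ := base q e + t • vec (dir q e)

/-- The parameters of the points of an edge or leg. -/
def dom (q : Fin 3 → ℝ) (e : Edge) : Set ℝ := {t | 0 ≤ t ∧ (t : EReal) ≤ len q e}

/-- The edge `e` leaves `p` in its own direction. -/
def FwdAt (q : Fin 3 → ℝ) (e : Edge) (p : ℝ × ℝ) : Prop :=
  ∃ t : ℝ, 0 ≤ t ∧ (t : EReal) < len q e ∧ p = pt q e t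

/-- The edge `e` leaves `p` in the direction opposite to its own. -/
def BwdAt (q : Fin 3 → ℝ) (e : Edge) (p : ℝ × ℝ) : Prop :=
  ∃ t : ℝ, 0 < t ∧ (t : EReal) ≤ len q e ∧ p = pt q e t

variable {q : Fin 3 → ℝ} {p : ℝ × ℝ}

theorem vec_dir_ne_zero (q : Fin 3 → ℝ) (e : Edge) : vec (dir q e) ≠ 0 := by
  cases e <;> simp only [dir] <;> try split_ifs
  all_goals simp [vec, Prod.ext_iff]

theorem pt_injective (q : Fin 3 → ℝ) (e : Edge) : Function.Injective (pt q e) := by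
  intro s t h
  exact smul_left_injective ℝ (vec_dir_ne_zero q e) (add_left_cancel h)

theorem continuous_pt (q : Fin 3 → ℝ) (e : Edge) : Continuous (pt q e) := by
  unfold pt; fun_prop

theorem isClosed_dom (q : Fin 3 → ℝ) (e : Edge) : IsClosed (dom q e) :=
  (isClosed_le continuous_const continuous_id).inter
    (isClosed_le continuous_coe_real_ereal continuous_const)

theorem isClosed_pt_image (q : Fin 3 → ℝ) (e : Edge) {J : Set ℝ} (hJ : IsClosed J) :
    IsClosed (pt q e '' J) := by
  have h := (isClosedEmbedding_smul_left (𝕜 := ℝ) (vec_dir_ne_zero q e))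
  have h2 := (Homeomorph.addLeft (base q e)).isClosedEmbedding.comp h
  exact h2.isClosedMap J hJ

theorem mem_line11_iff : p ∈ line11 q ↔ ∃ e, p ∈ pt q e '' dom q e := by
  have hleg : ∀ (e : Edge) (v u : ℝ × ℝ), base q e = v → vec (dir q e) = u → len q e = ⊤ →
      (p ∈ leg v u ↔ p ∈ pt q e '' dom q e) := by
    rintro e _ _ rfl rfl h
    simp only [leg, dom, h, le_top, and_true, Set.mem_image, Set.mem_ofPred_eq, pt]
    constructor
    · rintro ⟨t, ht, rfl⟩; exact ⟨t, ht, rfl⟩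
    · rintro ⟨t, ht, rfl⟩; exact ⟨t, ht, rfl⟩
  have hmid : p ∈ segment ℝ (v₀ q) (v₁ q) ↔ p ∈ pt q .mid '' dom q .mid := by
    have hdir : v₁ q - v₀ q = |q 2| • vec (dir q .mid) := by
      rcases le_or_gt 0 (q 2) with h | h
      · ext <;> simp [v₁, v₀, vec, dir, h, abs_of_nonneg h]
      · ext <;> simp [v₁, v₀, vec, dir, not_le.2 h, abs_of_neg h]
    rw [segment_eq_image']
    simp only [hdir, Set.mem_image, dom, len, Set.mem_ofPred_eq, EReal.coe_le_coe_iff, Set.mem_Icc,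
      pt, base, smul_smul]
    constructor
    · rintro ⟨t, ⟨h0, h1⟩, rfl⟩
      exact ⟨t * |q 2|, ⟨by positivity, mul_le_of_le_one_left (abs_nonneg _) h1⟩, rfl⟩
    · rintro ⟨t, ⟨h0, h1⟩, rfl⟩
      rcases (abs_nonneg (q 2)).eq_or_lt with h | h
      · exact ⟨0, by simp, by rw [← h] at h1 ⊢; rw [le_antisymm h1 h0]; simp⟩
      · exact ⟨t / |q 2|, ⟨by positivity, (div_le_one h).2 h1⟩, by rw [div_mul_cancel₀ _ h.ne']⟩
  have hex : (∃ e, p ∈ pt q e '' dom q e) ↔ p ∈ pt q .mid '' dom q .mid ∨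
      p ∈ pt q .down '' dom q .down ∨ p ∈ pt q .up '' dom q .up ∨
      p ∈ pt q .left '' dom q .left ∨ p ∈ pt q .right '' dom q .right := by
    constructor
    · rintro ⟨e, he⟩; cases e <;> tauto
    · rintro (h | h | h | h | h) <;> exact ⟨_, h⟩
  rw [hex, ← hmid, ← hleg .down (v₀ q) (0, -1) rfl (by simp [vec, dir]) rfl,
    ← hleg .up (v₁ q) (0, 1) rfl (by simp [vec, dir]) rfl,
    ← hleg .left (if 0 ≤ q 2 then v₀ q else v₁ q) (-1, 0) rfl (by simp [vec, dir]) rfl,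
    ← hleg .right (if 0 ≤ q 2 then v₁ q else v₀ q) (1, 0) rfl (by simp [vec, dir]) rfl]
  simp only [line11, Set.mem_union]
  tauto

theorem isClosed_line11 (q : Fin 3 → ℝ) : IsClosed (line11 q) := by
  have : line11 q = ⋃ e, pt q e '' dom q e := by
    ext p; rw [mem_line11_iff, Set.mem_iUnion]
  rw [this]
  exact isClosed_iUnion_of_finite fun e => isClosed_pt_image q e (isClosed_dom q e)

theorem pt_add_smul (q : Fin 3 → ℝ) (e : Edge) (s t : ℝ) :
    pt q e s + t • vec (dir q e) = pt q e (s + t) := by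
  simp only [pt]; module

theorem dir_mem (q : Fin 3 → ℝ) (e : Edge) :
    dir q e ∈ (Finset.Icc (-1 : ℤ) 1 ×ˢ Finset.Icc (-1 : ℤ) 1).erase 0 ∧
      -dir q e ∈ (Finset.Icc (-1 : ℤ) 1 ×ˢ Finset.Icc (-1 : ℤ) 1).erase 0 := by
  cases e <;> simp only [dir] <;> try split_ifs
  all_goals decide

/-- Parallel primitive directions in `{-1, 0, 1}²` agree up to sign. -/
theorem eq_or_eq_neg_of_smul_vec_eq {u d : ℤ × ℤ}
    (hu : u ∈ (Finset.Icc (-1 : ℤ) 1 ×ˢ Finset.Icc (-1 : ℤ) 1).erase 0)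
    (hd : d ∈ (Finset.Icc (-1 : ℤ) 1 ×ˢ Finset.Icc (-1 : ℤ) 1).erase 0)
    {s r : ℝ} (hs : 0 < s) (h : s • vec u = r • vec d) :
    (u = d ∧ r = s) ∨ (u = -d ∧ r = -s) := by
  obtain ⟨u1, u2⟩ := u
  obtain ⟨d1, d2⟩ := d
  simp only [vec, Prod.smul_mk, smul_eq_mul, Prod.mk.injEq] at h
  obtain ⟨h1, h2⟩ := h
  simp only [Finset.mem_erase, ne_eq, Prod.mk_eq_zero, Finset.mem_product, Finset.mem_Icc] at hu hd
  simp only [Prod.mk.injEq, Prod.neg_mk]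
  obtain ⟨hu0, ⟨a1, a2⟩, a3, a4⟩ := hu
  obtain ⟨hd0, ⟨b1, b2⟩, b3, b4⟩ := hd
  interval_cases u1 <;> interval_cases u2 <;> interval_cases d1 <;> interval_cases d2 <;>
    simp at h1 h2 hu0 hd0 ⊢ <;> linarith

open Classical in
theorem mem_outgoing_iff {u : ℤ × ℤ} :
    u ∈ outgoing q p ↔ ∃ e, (u = dir q e ∧ FwdAt q e p) ∨ (u = -dir q e ∧ BwdAt q e p) := by
  have hvec : ((u.1 : ℝ), (u.2 : ℝ)) = vec u := rfl
  simp only [outgoing, Finset.mem_filter, hvec]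
  constructor
  · rintro ⟨hu, hev⟩
    have hfr : ∃ e, ∃ᶠ t : ℝ in 𝓝[>] 0, p + t • vec u ∈ pt q e '' dom q e := by
      by_contra hcon
      push Not at hcon
      have := Filter.eventually_all.2 fun e => hcon e
      obtain ⟨t, h1, h2⟩ := (hev.and this).exists
      obtain ⟨e, he⟩ := mem_line11_iff.1 h1
      exact h2 e he
    obtain ⟨e, he⟩ := hfr
    have hp : p ∈ pt q e '' dom q e := by
      have hlim : Tendsto (fun t : ℝ => p + t • vec u) (𝓝[>] 0) (𝓝 p) := by
        have : Continuous fun t : ℝ => p + t • vec u := by fun_prop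
        simpa using (this.tendsto 0).mono_left (nhdsWithin_le_nhds (s := Set.Ioi 0))
      exact (isClosed_pt_image q e (isClosed_dom q e)).mem_of_frequently_of_tendsto he hlim
    obtain ⟨t, ht, rfl⟩ := hp
    obtain ⟨τ, ⟨t', ht', h⟩, hτ⟩ := (he.and_eventually self_mem_nhdsWithin).exists
    have hτ : 0 < τ := hτ
    have hpar : τ • vec u = (t' - t) • vec (dir q e) := by
      simp only [pt] at h
      rw [add_assoc, add_right_inj] at h
      rw [sub_smul, h]
      abel
    rcases eq_or_eq_neg_of_smul_vec_eq hu (dir_mem q e).1 hτ hpar with ⟨h1, h2⟩ | ⟨h1, h2⟩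
    · have : t < t' := by linarith
      exact ⟨e, Or.inl ⟨h1, t, ht.1, lt_of_lt_of_le (by exact_mod_cast this) ht'.2, rfl⟩⟩
    · exact ⟨e, Or.inr ⟨h1, t, by linarith [ht'.1], ht.2, rfl⟩⟩
  · rintro ⟨e, ⟨rfl, t, ht, hlt, rfl⟩ | ⟨rfl, t, ht, hle, rfl⟩⟩
    · refine ⟨(dir_mem q e).1, ?_⟩
      have hc : Continuous fun τ : ℝ => ((t + τ : ℝ) : EReal) :=
        continuous_coe_real_ereal.comp (by fun_prop)
      have := (hc.tendsto 0).eventually_lt_const (by simpa using hlt)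
      filter_upwards [this.filter_mono nhdsWithin_le_nhds, self_mem_nhdsWithin] with τ h1 h2
      have h2 : 0 < τ := h2
      rw [pt_add_smul]
      exact mem_line11_iff.2 ⟨e, _, ⟨by linarith, h1.le⟩, rfl⟩
    · refine ⟨(dir_mem q e).2, ?_⟩
      filter_upwards [Ioo_mem_nhdsGT ht] with τ hτ
      rw [vec_neg, smul_neg, ← neg_smul, pt_add_smul]
      refine mem_line11_iff.2 ⟨e, _, ⟨by linarith [hτ.2], le_trans ?_ hle⟩, rfl⟩
      exact_mod_cast (by linarith [hτ.1] : t + -τ ≤ t)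

theorem base_left_fst_le (q : Fin 3 → ℝ) : (base q .left).1 ≤ (base q .right).1 := by
  simp only [base]
  split_ifs with h
  · simpa [v₀, v₁] using h
  · simp only [v₀, v₁]; linarith

theorem base_down_snd_le (q : Fin 3 → ℝ) : (base q .down).2 ≤ (base q .up).2 := by
  simp only [base, v₀, v₁]
  linarith [abs_nonneg (q 2)]

/-- The direction of a flag of the curve: an edge together with one of its two orientations. -/
noncomputable def flagDir (q : Fin 3 → ℝ) (f : Edge × Bool) : ℤ × ℤ :=
  if f.2 then dir q f.1 else -dir q f.1

/-- The flag points away from `p` along its edge. -/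
def FlagAt (q : Fin 3 → ℝ) (p : ℝ × ℝ) (f : Edge × Bool) : Prop :=
  if f.2 then FwdAt q f.1 p else BwdAt q f.1 p

theorem not_flagAt_left_right {b c : Bool} (h1 : FlagAt q p (.left, b))
    (h2 : FlagAt q p (.right, c)) (hbc : b ≠ c) : False := by
  have h := base_left_fst_le q
  cases b <;> cases c <;> simp [FlagAt, FwdAt, BwdAt] at h1 h2 hbc <;>
    obtain ⟨t, ht, -, rfl⟩ := h1 <;>
    obtain ⟨s, hs, -, hst⟩ := h2 <;> have := congrArg Prod.fst hst <;>
    simp [pt, vec, dir] at this <;> linarith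

theorem not_flagAt_down_up {b c : Bool} (h1 : FlagAt q p (.down, b))
    (h2 : FlagAt q p (.up, c)) (hbc : b ≠ c) : False := by
  have h := base_down_snd_le q
  cases b <;> cases c <;> simp [FlagAt, FwdAt, BwdAt] at h1 h2 hbc <;>
    obtain ⟨t, ht, -, rfl⟩ := h1 <;>
    obtain ⟨s, hs, -, hst⟩ := h2 <;> have := congrArg Prod.snd hst <;>
    simp [pt, vec, dir] at this <;> linarith

theorem flagDir_inj {f g : Edge × Bool} (hf : FlagAt q p f) (hg : FlagAt q p g)
    (h : flagDir q f = flagDir q g) : f = g := by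
  have hd : dir q .mid = (1, 1) ∨ dir q .mid = (-1, 1) := by
    simp only [dir]; split_ifs <;> simp
  obtain ⟨e, b⟩ := f
  obtain ⟨e', b'⟩ := g
  have h1 : dir q .left = (-1, 0) := rfl
  have h2 : dir q .right = (1, 0) := rfl
  have h3 : dir q .down = (0, -1) := rfl
  have h4 : dir q .up = (0, 1) := rfl
  simp only [flagDir] at h
  rcases hd with h5 | h5 <;> cases e <;> cases e' <;>
    simp only [h1, h2, h3, h4, h5] at h <;> cases b <;> cases b' <;>
    first
    | rfl
    | (exfalso; revert h; decide)
    | exact (not_flagAt_left_right hf hg (by decide)).elim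
    | exact (not_flagAt_left_right hg hf (by decide)).elim
    | exact (not_flagAt_down_up hf hg (by decide)).elim
    | exact (not_flagAt_down_up hg hf (by decide)).elim

open Classical in
/-- The outgoing directions at `p`, sorted by edges. -/
theorem sum_outgoing (q : Fin 3 → ℝ) (p : ℝ × ℝ) (g : ℤ × ℤ → ℤ) :
    ∑ u ∈ outgoing q p, g u = ∑ e, ((if FwdAt q e p then g (dir q e) else 0) +
      (if BwdAt q e p then g (-dir q e) else 0)) := by
  have himg : outgoing q p = (Finset.univ.filter fun f => FlagAt q p f).image (flagDir q) := by
    ext u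
    rw [mem_outgoing_iff, Finset.mem_image]
    simp only [Finset.mem_filter, Finset.mem_univ, true_and]
    constructor
    · rintro ⟨e, ⟨rfl, h⟩ | ⟨rfl, h⟩⟩
      · exact ⟨(e, true), h, by simp [flagDir]⟩
      · exact ⟨(e, false), h, by simp [flagDir]⟩
    · rintro ⟨⟨e, _ | _⟩, h, rfl⟩
      · exact ⟨e, Or.inr ⟨by simp [flagDir], h⟩⟩
      · exact ⟨e, Or.inl ⟨by simp [flagDir], h⟩⟩
  rw [himg, Finset.sum_image, Finset.sum_filter, ← Finset.univ_product_univ, Finset.sum_product]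
  · refine Finset.sum_congr rfl fun e _ => ?_
    simp [FlagAt, flagDir]
  · intro f hf g hg h
    simp only [Finset.coe_filter, Finset.mem_univ, true_and, Set.mem_ofPred_eq] at hf hg
    exact flagDir_inj hf hg h

open Classical in
/-- Balancing: the outgoing directions at a point add up to zero. -/
theorem sum_outgoing_pair (q : Fin 3 → ℝ) (p : ℝ × ℝ) (m : Expo) :
    ∑ u ∈ outgoing q p, pair m u = 0 := by
  have hleg : ∀ e, len q e = ⊤ → (if FwdAt q e p then pair m (dir q e) else 0) +
      (if BwdAt q e p then pair m (-dir q e) else 0) =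
      if p = base q e then pair m (dir q e) else 0 := by
    intro e he
    by_cases hp : p = base q e
    · have hF : FwdAt q e p := ⟨0, le_rfl, by simp [he], by simp [pt, hp]⟩
      have hB : ¬ BwdAt q e p := by
        rintro ⟨t, ht, -, h⟩
        have : pt q e 0 = pt q e t := by rw [← h, hp]; simp [pt]
        exact ht.ne (pt_injective q e this)
      rw [if_pos hF, if_neg hB, if_pos hp, add_zero]
    · have : FwdAt q e p ↔ BwdAt q e p := by
        constructor
        · rintro ⟨t, ht, h1, rfl⟩
          refine ⟨t, lt_of_le_of_ne ht ?_, h1.le, rfl⟩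
          rintro rfl
          exact hp (by simp [pt])
        · rintro ⟨t, ht, h1, rfl⟩
          exact ⟨t, ht.le, by simp [he], rfl⟩
      by_cases hF : FwdAt q e p
      · rw [if_pos hF, if_pos (this.1 hF), if_neg hp, pair_neg, add_neg_cancel]
      · rw [if_neg hF, if_neg (mt this.2 hF), if_neg hp, add_zero]
  have hend : pt q .mid |q 2| = v₁ q := by
    rcases le_or_gt 0 (q 2) with h | h
    · ext <;> simp [pt, base, v₁, v₀, vec, dir, h, abs_of_nonneg h]
    · ext <;> simp [pt, base, v₁, v₀, vec, dir, not_le.2 h, abs_of_neg h]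
  have hmid : (if FwdAt q .mid p then pair m (dir q .mid) else 0) +
      (if BwdAt q .mid p then pair m (-dir q .mid) else 0) =
      (if p = v₀ q then pair m (dir q .mid) else 0) -
      (if p = v₁ q then pair m (dir q .mid) else 0) := by
    have hF : FwdAt q .mid p ↔ (p ∈ pt q .mid '' dom q .mid ∧ p ≠ v₁ q) := by
      constructor
      · rintro ⟨t, h0, h1, rfl⟩
        refine ⟨⟨t, ⟨h0, h1.le⟩, rfl⟩, fun h => ?_⟩
        rw [← hend] at h
        rw [pt_injective q .mid h] at h1
        exact lt_irrefl _ h1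
      · rintro ⟨⟨t, ht, rfl⟩, hne⟩
        refine ⟨t, ht.1, lt_of_le_of_ne ht.2 fun h => hne ?_, rfl⟩
        rw [← hend, EReal.coe_injective h]
    have hB : BwdAt q .mid p ↔ (p ∈ pt q .mid '' dom q .mid ∧ p ≠ v₀ q) := by
      constructor
      · rintro ⟨t, h0, h1, rfl⟩
        refine ⟨⟨t, ⟨h0.le, h1⟩, rfl⟩, fun h => ?_⟩
        have h' : pt q .mid t = pt q .mid 0 := by rw [h]; simp [pt, base]
        exact h0.ne' (pt_injective q .mid h')
      · rintro ⟨⟨t, ht, rfl⟩, hne⟩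
        refine ⟨t, lt_of_le_of_ne ht.1 ?_, ht.2, rfl⟩
        rintro rfl
        exact hne (by simp [pt, base])
    have h0 : v₀ q ∈ pt q .mid '' dom q .mid := ⟨0, ⟨le_rfl, by simp [len]⟩, by simp [pt, base]⟩
    have h1 : v₁ q ∈ pt q .mid '' dom q .mid := ⟨|q 2|, ⟨abs_nonneg _, le_rfl⟩, hend⟩
    by_cases e0 : p = v₀ q <;> by_cases e1 : p = v₁ q
    · rw [if_neg fun h => (hF.1 h).2 e1, if_neg fun h => (hB.1 h).2 e0, if_pos e0, if_pos e1,
        add_zero, sub_self]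
    · rw [if_pos (hF.2 ⟨e0 ▸ h0, e1⟩), if_neg fun h => (hB.1 h).2 e0, if_pos e0, if_neg e1,
        add_zero, sub_zero]
    · rw [if_neg fun h => (hF.1 h).2 e1, if_pos (hB.2 ⟨e1 ▸ h1, e0⟩), if_neg e0, if_pos e1,
        pair_neg, zero_add, zero_sub]
    · by_cases hp : p ∈ pt q .mid '' dom q .mid
      · rw [if_pos (hF.2 ⟨hp, e1⟩), if_pos (hB.2 ⟨hp, e0⟩), if_neg e0, if_neg e1, pair_neg,
          add_neg_cancel, sub_zero]
      · rw [if_neg fun h => hp (hF.1 h).1, if_neg fun h => hp (hB.1 h).1, if_neg e0, if_neg e1,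
          add_zero, sub_zero]
  have huniv : (Finset.univ : Finset Edge) = {.left, .right, .down, .up, .mid} := rfl
  rw [sum_outgoing, huniv]
  simp only [Finset.mem_insert, Finset.mem_singleton, reduceCtorEq, or_self, not_false_eq_true,
    Finset.sum_insert, Finset.sum_singleton]
  have hd := hleg .down rfl
  have hu := hleg .up rfl
  have hl := hleg .left rfl
  have hr := hleg .right rfl
  rw [hmid, hl, hr, hd, hu]
  have bd : base q .down = v₀ q := rfl
  have bu : base q .up = v₁ q := rfl
  rcases le_or_gt 0 (q 2) with h | h
  · have bl : base q .left = v₀ q := if_pos h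
    have br : base q .right = v₁ q := if_pos h
    rw [bd, bu, bl, br]
    simp only [dir, h, if_true]
    by_cases e0 : p = v₀ q <;> by_cases e1 : p = v₁ q
    · rw [if_pos e0, if_pos e0, if_pos e0, if_pos e1, if_pos e1, if_pos e1]; simp [pair]
    · rw [if_pos e0, if_pos e0, if_pos e0, if_neg e1, if_neg e1, if_neg e1]; simp [pair]
    · rw [if_neg e0, if_neg e0, if_neg e0, if_pos e1, if_pos e1, if_pos e1]; simp [pair]
    · rw [if_neg e0, if_neg e0, if_neg e0, if_neg e1, if_neg e1, if_neg e1]; simp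
  · have bl : base q .left = v₁ q := if_neg (not_le.2 h)
    have br : base q .right = v₀ q := if_neg (not_le.2 h)
    rw [bd, bu, bl, br]
    simp only [dir, not_le.2 h, if_false]
    by_cases e0 : p = v₀ q <;> by_cases e1 : p = v₁ q
    · rw [if_pos e0, if_pos e0, if_pos e0, if_pos e1, if_pos e1, if_pos e1]; simp [pair]
    · rw [if_pos e0, if_pos e0, if_pos e0, if_neg e1, if_neg e1, if_neg e1]; simp [pair]
    · rw [if_neg e0, if_neg e0, if_neg e0, if_pos e1, if_pos e1, if_pos e1]; simp [pair]
    · rw [if_neg e0, if_neg e0, if_neg e0, if_neg e1, if_neg e1, if_neg e1]; simp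

end Tritangent

namespace Tritangent

/-! ### Stable multiplicities, edge by edge -/

section

variable {a : Expo → ℝ} {q : Fin 3 → ℝ} {p : ℝ × ℝ}

open Classical in
/-- The part of the stable multiplicity at `p` contributed by the edge `e`. -/
noncomputable def edgeTerm (a : Expo → ℝ) (q : Fin 3 → ℝ) (e : Edge) (p : ℝ × ℝ) : ℤ :=
  (if FwdAt q e p then tropSlope a p (dir q e) else 0) +
    (if BwdAt q e p then tropSlope a p (-dir q e) else 0)

theorem stableMult_eq_sum (a : Expo → ℝ) (q : Fin 3 → ℝ) (p : ℝ × ℝ) :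
    stableMult a q p = ∑ e, edgeTerm a q e p :=
  sum_outgoing q p (tropSlope a p)

/-- The contribution of the point with parameter `t` of the edge `e`. -/
noncomputable def multAt (a : Expo → ℝ) (q : Fin 3 → ℝ) (e : Edge) : ℝ → ℤ :=
  edgeMult (slopeR a (base q e) (dir q e)) (slopeL a (base q e) (dir q e)) (len q e)

theorem fwdAt_pt_iff {e : Edge} {t : ℝ} (ht : t ∈ dom q e) :
    FwdAt q e (pt q e t) ↔ (t : EReal) < len q e := by
  refine ⟨?_, fun h => ⟨t, ht.1, h, rfl⟩⟩
  rintro ⟨s, -, hs, h⟩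
  rwa [pt_injective q e h]

theorem bwdAt_pt_iff {e : Edge} {t : ℝ} (ht : t ∈ dom q e) :
    BwdAt q e (pt q e t) ↔ 0 < t := by
  refine ⟨?_, fun h => ⟨t, h, ht.2, rfl⟩⟩
  rintro ⟨s, hs, -, h⟩
  rwa [pt_injective q e h]

theorem edgeTerm_pt {e : Edge} {t : ℝ} (ht : t ∈ dom q e) :
    edgeTerm a q e (pt q e t) = multAt a q e t := by
  simp only [edgeTerm, multAt, edgeMult, fwdAt_pt_iff ht, bwdAt_pt_iff ht]
  have h1 : tropSlope a (pt q e t) (dir q e) = slopeR a (base q e) (dir q e) t := rfl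
  have h2 : tropSlope a (pt q e t) (-dir q e) = -slopeL a (base q e) (dir q e) t := by
    rw [slopeL, neg_neg]; rfl
  rw [h1, h2]
  split_ifs <;> ring

theorem edgeTerm_eq_zero {e : Edge} (h : p ∉ pt q e '' dom q e) : edgeTerm a q e p = 0 := by
  have h1 : ¬ FwdAt q e p := fun ⟨t, h0, h1, h2⟩ => h ⟨t, ⟨h0, h1.le⟩, h2.symm⟩
  have h2 : ¬ BwdAt q e p := fun ⟨t, h0, h1, h2⟩ => h ⟨t, ⟨h0.le, h1⟩, h2.symm⟩
  simp [edgeTerm, h1, h2]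

theorem finite_support_edgeTerm (a : Expo → ℝ) (q : Fin 3 → ℝ) (e : Edge) :
    (Function.support (edgeTerm a q e)).Finite := by
  refine ((finite_support_edgeMult (finite_setOf_slope_ne a (base q e) (dir q e))
    (len q e)).image (pt q e)).subset fun p hp => ?_
  by_cases h : p ∈ pt q e '' dom q e
  · obtain ⟨t, ht, rfl⟩ := h
    refine ⟨t, ?_, rfl⟩
    rw [Function.mem_support, edgeTerm_pt ht] at hp
    rw [Function.mem_support, if_pos (show 0 ≤ t ∧ (t : EReal) ≤ len q e from ht)]
    exact hp
  · exact absurd (edgeTerm_eq_zero h) hp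

theorem finite_support_stableMult (a : Expo → ℝ) (q : Fin 3 → ℝ) :
    (Function.support (stableMult a q)).Finite := by
  refine (Set.finite_iUnion fun e => finite_support_edgeTerm a q e).subset fun p hp => ?_
  rw [Function.mem_support, stableMult_eq_sum] at hp
  obtain ⟨e, -, he⟩ := Finset.exists_ne_zero_of_sum_ne_zero hp
  exact Set.mem_iUnion.2 ⟨e, he⟩

theorem finsum_edgeTerm (a : Expo → ℝ) (q : Fin 3 → ℝ) (e : Edge) (S : Set (ℝ × ℝ)) :
    ∑ᶠ p ∈ S, edgeTerm a q e p = ∑ᶠ t ∈ dom q e ∩ pt q e ⁻¹' S, multAt a q e t := by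
  have h1 : ∑ᶠ p ∈ S, edgeTerm a q e p =
      ∑ᶠ p ∈ pt q e '' (dom q e ∩ pt q e ⁻¹' S), edgeTerm a q e p := by
    refine finsum_mem_inter_support_eq' _ _ _ fun p hp => ⟨fun h => ?_, ?_⟩
    · by_cases hpe : p ∈ pt q e '' dom q e
      · obtain ⟨t, ht, rfl⟩ := hpe
        exact ⟨t, ⟨ht, h⟩, rfl⟩
      · exact absurd (edgeTerm_eq_zero hpe) hp
    · rintro ⟨t, ht, rfl⟩
      exact ht.2
  rw [h1, finsum_mem_image ((pt_injective q e).injOn)]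
  exact finsum_mem_congr rfl fun t ht => edgeTerm_pt ht.1

/-- The stable multiplicity carried by a set of points is the sum of the contributions of the
edges. -/
theorem finsum_stableMult (a : Expo → ℝ) (q : Fin 3 → ℝ) (S : Set (ℝ × ℝ)) :
    ∑ᶠ p ∈ S, stableMult a q p = ∑ e, ∑ᶠ t ∈ dom q e ∩ pt q e ⁻¹' S, multAt a q e t := by
  simp only [← finsum_edgeTerm]
  simp only [finsum_mem_def]
  rw [← finsum_sum_comm]
  · refine finsum_congr fun p => ?_
    by_cases h : p ∈ S
    · simp [h, stableMult_eq_sum]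
    · simp [h]
  · intro e _
    exact (finite_support_edgeTerm a q e).subset (Set.support_indicator.trans_subset
      Set.inter_subset_right)

theorem stableMult_nonneg (a : Expo → ℝ) (q : Fin 3 → ℝ) (p : ℝ × ℝ) : 0 ≤ stableMult a q p := by
  obtain ⟨m, hm⟩ := active_nonempty a p
  rw [← sum_outgoing_pair q p m]
  exact Finset.sum_le_sum fun u _ => pair_le_tropSlope hm u

/-- If the multiplicity vanishes at `p`, then all active monomials have the same slope in each
outgoing direction. -/
theorem pair_eq_of_stableMult_eq_zero (h : stableMult a q p = 0) {m : Expo} (hm : m ∈ active a p)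
    {u : ℤ × ℤ} (hu : u ∈ outgoing q p) : pair m u = tropSlope a p u := by
  have h1 : ∑ u ∈ outgoing q p, pair m u = ∑ u ∈ outgoing q p, tropSlope a p u :=
    (sum_outgoing_pair q p m).trans h.symm
  exact (Finset.sum_eq_sum_iff_of_le fun u _ => pair_le_tropSlope hm u).1 h1 u hu

/-- The slope of `F` far out on a leg. -/
def topSlope : Edge → ℤ
  | .right => 3
  | .up => 3
  | _ => 0

theorem len_eq_top_iff (q : Fin 3 → ℝ) (e : Edge) : len q e = ⊤ ↔ e ≠ .mid := by
  cases e <;> simp [len]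

theorem exists_leg_atTop (a : Expo → ℝ) (q : Fin 3 → ℝ) {e : Edge} (he : len q e = ⊤) :
    ∃ S : Finset Expo, (∀ m ∈ S, (∀ n, pair n (dir q e) ≤ pair m (dir q e)) ∧
      pair m (dir q e) = topSlope e) ∧ ∃ t₀ : ℝ, 0 < t₀ ∧ ∀ t, t₀ ≤ t →
        active a (pt q e t) = S ∧ slopeR a (base q e) (dir q e) t = topSlope e ∧
        slopeL a (base q e) (dir q e) t = topSlope e := by
  obtain ⟨S, hS, t₀, ht₀, h⟩ := exists_active_atTop a (base q e) (dir q e)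
  have hS' : ∀ m ∈ S, pair m (dir q e) = topSlope e := by
    intro m hm
    have h0 := hS m hm (0, 0)
    have h3 := hS m hm (3, 3)
    have b1 := m.1.2
    have b2 := m.2.2
    cases e
    · simp [pair, dir, topSlope] at h0 ⊢
      omega
    · simp [pair, dir, topSlope] at h3 ⊢
      omega
    · simp [pair, dir, topSlope] at h0 ⊢
      omega
    · simp [pair, dir, topSlope] at h3 ⊢
      omega
    · exact absurd rfl ((len_eq_top_iff q _).1 he)
  refine ⟨S, fun m hm => ⟨hS m hm, hS' m hm⟩, t₀, ht₀, fun t ht => ⟨h t ht, ?_, ?_⟩⟩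
  · refine tropSlope_eq fun m hm => hS' m ?_
    rwa [h t ht] at hm
  · rw [slopeL, tropSlope_eq (s := -topSlope e), neg_neg]
    intro m hm
    rw [h t ht] at hm
    rw [pair_neg, hS' m hm]

theorem exists_slope_right' (a : Expo → ℝ) (q : Fin 3 → ℝ) (e : Edge) (t : ℝ) :
    ∃ ε > 0, ∀ s ∈ Set.Ioo t (t + ε),
      slopeR a (base q e) (dir q e) s = slopeR a (base q e) (dir q e) t ∧
      slopeL a (base q e) (dir q e) s = slopeR a (base q e) (dir q e) t := by
  obtain ⟨ε, hε, h⟩ := exists_slope_right a (base q e) (dir q e) t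
  exact ⟨ε, hε, fun s hs => ⟨(h s hs).1, (h s hs).2.1⟩⟩

theorem exists_slope_left' (a : Expo → ℝ) (q : Fin 3 → ℝ) (e : Edge) (t : ℝ) :
    ∃ ε > 0, ∀ s ∈ Set.Ioo (t - ε) t,
      slopeR a (base q e) (dir q e) s = slopeL a (base q e) (dir q e) t ∧
      slopeL a (base q e) (dir q e) s = slopeL a (base q e) (dir q e) t := by
  obtain ⟨ε, hε, h⟩ := exists_slope_left a (base q e) (dir q e) t
  exact ⟨ε, hε, fun s hs => ⟨(h s hs).1, (h s hs).2.1⟩⟩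

theorem finsum_multAt_Icc (a : Expo → ℝ) (q : Fin 3 → ℝ) (e : Edge) {α β : ℝ} (h0 : 0 ≤ α)
    (hαβ : α ≤ β) (hβ : (β : EReal) ≤ len q e) :
    ∑ᶠ t ∈ Set.Icc α β, multAt a q e t =
      (if (β : EReal) < len q e then slopeR a (base q e) (dir q e) β else 0) -
        (if 0 < α then slopeL a (base q e) (dir q e) α else 0) :=
  finsum_edgeMult_Icc (exists_slope_right' a q e) (exists_slope_left' a q e)
    (finite_setOf_slope_ne _ _ _) h0 hαβ hβ

/-- The part of a leg beyond a point `t`, where `F` is affine, carries the difference of the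
slopes. -/
theorem finsum_multAt_leg_Ici (a : Expo → ℝ) (q : Fin 3 → ℝ) {e : Edge} (he : len q e = ⊤)
    {α : ℝ} (h0 : 0 ≤ α) :
    ∑ᶠ t ∈ Set.Ici α, multAt a q e t =
      topSlope e - (if 0 < α then slopeL a (base q e) (dir q e) α else 0) := by
  obtain ⟨S, -, t₀, ht₀, h⟩ := exists_leg_atTop a q he
  have hlt : ∀ t : ℝ, (t : EReal) < len q e := fun t => by rw [he]; exact EReal.coe_lt_top t
  have hb : α ≤ max α t₀ := le_max_left _ _
  have h1 : ∑ᶠ t ∈ Set.Ici α, multAt a q e t = ∑ᶠ t ∈ Set.Icc α (max α t₀), multAt a q e t := by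
    refine finsum_mem_inter_support_eq' _ _ _ fun t ht => ⟨fun hα => ⟨hα, ?_⟩, fun h => h.1⟩
    by_contra hcon
    rw [not_le] at hcon
    have ht' := h t ((le_max_right _ _).trans hcon.le)
    refine ht ?_
    rw [multAt, edgeMult, if_pos (hlt t), if_pos (ht₀.trans ((le_max_right _ _).trans_lt hcon)),
      ht'.2.1, ht'.2.2, sub_self]
  rw [h1, finsum_multAt_Icc a q e h0 hb (hlt _).le, if_pos (hlt _), (h _ (le_max_right _ _)).2.1]

theorem dom_leg {e : Edge} (he : len q e = ⊤) : dom q e = Set.Ici 0 := by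
  ext t; simp [dom, he]

theorem dom_mid : dom q .mid = Set.Icc 0 |q 2| := by
  ext t; simp [dom, len]

theorem finsum_multAt_dom (a : Expo → ℝ) (q : Fin 3 → ℝ) (e : Edge) :
    ∑ᶠ t ∈ dom q e, multAt a q e t = topSlope e := by
  by_cases he : e = .mid
  · subst he
    rw [dom_mid, finsum_multAt_Icc a q _ le_rfl (abs_nonneg _) le_rfl]
    simp [len, topSlope]
  · have he' := (len_eq_top_iff q e).2 he
    rw [dom_leg he', finsum_multAt_leg_Ici a q he' le_rfl]
    simp

/-- The stable intersection of a `(1,1)`-curve and a `(3,3)`-curve has degree six. -/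
theorem finsum_stableMult_univ (a : Expo → ℝ) (q : Fin 3 → ℝ) : ∑ᶠ p, stableMult a q p = 6 := by
  rw [← finsum_mem_univ, finsum_stableMult]
  simp only [Set.preimage_univ, Set.inter_univ, finsum_multAt_dom]
  rfl

end

end Tritangent

namespace Tritangent

/-! ### The compactified intersection -/

section

variable {a : Expo → ℝ} {q : Fin 3 → ℝ}

theorem isEmbedding_toTP : IsEmbedding toTP :=
  EReal.isEmbedding_coe.prodMap EReal.isEmbedding_coe

theorem toTP_mem_compactify_iff {X : Set (ℝ × ℝ)} (hX : IsClosed X) {p : ℝ × ℝ} :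
    toTP p ∈ compactify X ↔ p ∈ X := by
  have := isEmbedding_toTP.isInducing.closure_eq_preimage_closure_image X
  rw [hX.closure_eq] at this
  exact (Set.ext_iff.1 this p).symm

theorem isClosed_setOf_mem_active (a : Expo → ℝ) (m : Expo) : IsClosed {p | m ∈ active a p} := by
  simp only [mem_active]
  have : {p | ∀ n, monomialVal a n p ≤ monomialVal a m p} =
      ⋂ n, {p | monomialVal a n p ≤ monomialVal a m p} := by
    ext; simp
  rw [this]
  exact isClosed_iInter fun n =>
    isClosed_le (continuous_monomialVal a n) (continuous_monomialVal a m)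

theorem isClosed_curve (a : Expo → ℝ) : IsClosed (curve a) := by
  have : curve a = ⋃ m : Expo, ⋃ n : Expo, ⋃ _ : m ≠ n,
      ({p | m ∈ active a p} ∩ {p | n ∈ active a p}) := by
    ext p
    simp only [curve, Set.mem_ofPred_eq, Set.mem_iUnion, Set.mem_inter_iff, exists_prop]
    rw [← Nat.lt_iff_add_one_le, Finset.one_lt_card]
    constructor
    · rintro ⟨m, hm, n, hn, h⟩; exact ⟨m, n, h, hm, hn⟩
    · rintro ⟨m, n, h, hm, hn⟩; exact ⟨m, hm, n, hn, h⟩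
  rw [this]
  refine isClosed_iUnion_of_finite fun m => isClosed_iUnion_of_finite fun n =>
    isClosed_iUnion_of_finite fun _ => ?_
  exact (isClosed_setOf_mem_active a m).inter (isClosed_setOf_mem_active a n)

theorem notMem_curve_iff {p : ℝ × ℝ} : p ∉ curve a ↔ ∃ m, active a p = {m} := by
  rw [← Finset.card_eq_one]
  have := (active_nonempty a p).card_pos
  simp only [curve, Set.mem_ofPred_eq]
  omega

theorem isClosed_inter (a : Expo → ℝ) (q : Fin 3 → ℝ) : IsClosed (inter a q) :=
  isClosed_closure.inter isClosed_closure

theorem toTP_mem_inter_iff {p : ℝ × ℝ} : toTP p ∈ inter a q ↔ p ∈ line11 q ∧ p ∈ curve a := by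
  rw [inter, Set.mem_inter_iff, toTP_mem_compactify_iff (isClosed_line11 q),
    toTP_mem_compactify_iff (isClosed_curve a)]

theorem continuous_toTP : Continuous toTP := isEmbedding_toTP.continuous

theorem pt_mem_line11 {e : Edge} {t : ℝ} (ht : t ∈ dom q e) : pt q e t ∈ line11 q :=
  mem_line11_iff.2 ⟨e, t, ht, rfl⟩

theorem pt_mid_abs (q : Fin 3 → ℝ) : pt q .mid |q 2| = v₁ q := by
  rcases le_or_gt 0 (q 2) with h | h
  · ext <;> simp [pt, base, v₁, v₀, vec, dir, h, abs_of_nonneg h]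
  · ext <;> simp [pt, base, v₁, v₀, vec, dir, not_le.2 h, abs_of_neg h]

/-- A point of the compactified `(1,1)`-curve lies on one of the legs, which may be prolonged to
infinity, or on the bounded edge. -/
theorem mem_compactify_line11 {P : EReal × EReal} (hP : P ∈ compactify (line11 q)) :
    (P.1 ≤ (base q .left).1 ∧ P.2 = (base q .left).2) ∨
    ((base q .right).1 ≤ P.1 ∧ P.2 = (base q .right).2) ∨
    (P.1 = (base q .down).1 ∧ P.2 ≤ (base q .down).2) ∨
    (P.1 = (base q .up).1 ∧ (base q .up).2 ≤ P.2) ∨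
    ∃ t ∈ dom q .mid, P = toTP (pt q .mid t) := by
  refine closure_minimal (s := toTP '' line11 q) (t := {P : EReal × EReal |
    (P.1 ≤ (base q .left).1 ∧ P.2 = (base q .left).2) ∨
    ((base q .right).1 ≤ P.1 ∧ P.2 = (base q .right).2) ∨
    (P.1 = (base q .down).1 ∧ P.2 ≤ (base q .down).2) ∨
    (P.1 = (base q .up).1 ∧ (base q .up).2 ≤ P.2) ∨
    ∃ t ∈ dom q .mid, P = toTP (pt q .mid t)}) ?_ ?_ hP
  · rintro _ ⟨p, hp, rfl⟩
    obtain ⟨e, t, ht, rfl⟩ := mem_line11_iff.1 hp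
    have ht0 := ht.1
    cases e
    · left
      simp only [toTP, EReal.coe_le_coe_iff, EReal.coe_eq_coe_iff, pt, vec, dir]
      simp [ht0]
    · right; left
      simp only [toTP, EReal.coe_le_coe_iff, EReal.coe_eq_coe_iff, pt, vec, dir]
      simp [ht0]
    · right; right; left
      simp only [toTP, EReal.coe_le_coe_iff, EReal.coe_eq_coe_iff, pt, vec, dir]
      simp [ht0]
    · right; right; right; left
      simp only [toTP, EReal.coe_le_coe_iff, EReal.coe_eq_coe_iff, pt, vec, dir]
      simp [ht0]
    · exact Or.inr (Or.inr (Or.inr (Or.inr ⟨t, ht, rfl⟩)))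
  · have hcomp : IsClosed {P : EReal × EReal | ∃ t ∈ dom q .mid, P = toTP (pt q .mid t)} := by
      have : {P : EReal × EReal | ∃ t ∈ dom q .mid, P = toTP (pt q .mid t)} =
          (fun t => toTP (pt q .mid t)) '' dom q .mid := by
        ext P; simp [eq_comm]
      rw [this, dom_mid]
      exact (isCompact_Icc.image (continuous_toTP.comp (continuous_pt q .mid))).isClosed
    refine IsClosed.union ?_ (IsClosed.union ?_ (IsClosed.union ?_ (IsClosed.union ?_ hcomp)))
    · exact (isClosed_le continuous_fst continuous_const).inter
        (isClosed_eq continuous_snd continuous_const)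
    · exact (isClosed_le continuous_const continuous_fst).inter
        (isClosed_eq continuous_snd continuous_const)
    · exact (isClosed_eq continuous_fst continuous_const).inter
        (isClosed_le continuous_snd continuous_const)
    · exact (isClosed_eq continuous_fst continuous_const).inter
        (isClosed_le continuous_const continuous_snd)

/-- The coordinate along which an edge is monotone: the first one, except on vertical legs. -/
def coord {α : Type*} : Edge → α × α → α
  | .down => Prod.snd
  | .up => Prod.snd
  | _ => Prod.fst

theorem coord_toTP (e : Edge) (p : ℝ × ℝ) : coord e (toTP p) = (coord e p : ℝ) := by
  cases e <;> rfl

theorem continuous_coord {α : Type*} [TopologicalSpace α] (e : Edge) :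
    Continuous (coord e : α × α → α) := by
  cases e <;> simp only [coord] <;> fun_prop

theorem pt_mid_fst_mem {t : ℝ} (ht : t ∈ dom q .mid) :
    (base q .left).1 ≤ (pt q .mid t).1 ∧ (pt q .mid t).1 ≤ (base q .right).1 := by
  rw [dom_mid] at ht
  obtain ⟨h0, h1⟩ := ht
  rcases le_or_gt 0 (q 2) with h | h
  · rw [abs_of_nonneg h] at h1
    simp [base, pt, dir, vec, v₀, v₁, h, h0, h1]
  · rw [abs_of_neg h] at h1
    simp only [base, pt, dir, vec, v₀, v₁, not_le.2 h, if_false, Prod.fst_add, Prod.smul_fst,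
      smul_eq_mul, Int.cast_neg, Int.cast_one]
    constructor <;> linarith

theorem pt_mid_snd_mem {t : ℝ} (ht : t ∈ dom q .mid) :
    (base q .down).2 ≤ (pt q .mid t).2 ∧ (pt q .mid t).2 ≤ (base q .up).2 := by
  rw [dom_mid] at ht
  obtain ⟨h0, h1⟩ := ht
  simp only [base, pt, dir, vec, v₀, v₁]
  split_ifs <;> simp [h0, h1]

theorem pt_mid_fst_injective (q : Fin 3 → ℝ) : Function.Injective fun t => (pt q .mid t).1 := by
  intro s t h
  simp only [base, pt, dir, vec] at h
  split_ifs at h <;> simpa using h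

/-- The two vertices are the left and the right one, in some order. -/
theorem base_vertices (q : Fin 3 → ℝ) :
    (base q .down = base q .left ∧ base q .up = base q .right) ∨
      (base q .down = base q .right ∧ base q .up = base q .left) := by
  simp only [base]
  split_ifs <;> simp

theorem pt_mid_zero (q : Fin 3 → ℝ) : pt q .mid 0 = base q .down := by
  simp [pt, base]

theorem zero_mem_dom (q : Fin 3 → ℝ) (e : Edge) : (0 : ℝ) ∈ dom q e :=
  ⟨le_rfl, by cases e <;> simp [len]⟩

theorem abs_mem_dom (q : Fin 3 → ℝ) : |q 2| ∈ dom q .mid := ⟨abs_nonneg _, le_rfl⟩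

/-- Interior points of the bounded edge have first coordinate different from both vertices. -/
theorem pt_mid_fst_ne {t : ℝ} (h0 : 0 < t) (h1 : t < |q 2|) :
    (pt q .mid t).1 ≠ (base q .down).1 ∧ (pt q .mid t).1 ≠ (base q .up).1 := by
  constructor <;> intro h
  · rw [← pt_mid_zero] at h
    exact h0.ne' (pt_mid_fst_injective q h)
  · have : base q .up = pt q .mid |q 2| := (pt_mid_abs q).symm
    rw [this] at h
    exact h1.ne (pt_mid_fst_injective q h)

/-- Interior points of edges are determined, within the compactified `(1,1)`-curve, by the
coordinate along the edge. -/
theorem eq_of_coord_eq {e : Edge} {t : ℝ} (h0 : 0 < t) (hlt : (t : EReal) < len q e)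
    {P : EReal × EReal} (hP : P ∈ compactify (line11 q))
    (h : coord e P = (coord e (pt q e t) : ℝ)) : P = toTP (pt q e t) := by
  have hx := base_left_fst_le q
  have hy := base_down_snd_le q
  have hxd : (base q .left).1 ≤ (base q .down).1 ∧ (base q .down).1 ≤ (base q .right).1 := by
    rw [← pt_mid_zero]; exact pt_mid_fst_mem (zero_mem_dom q _)
  have hxu : (base q .left).1 ≤ (base q .up).1 ∧ (base q .up).1 ≤ (base q .right).1 := by
    have : base q .up = pt q .mid |q 2| := (pt_mid_abs q).symm
    rw [this]; exact pt_mid_fst_mem (abs_mem_dom q)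
  have hyl : (base q .down).2 ≤ (base q .left).2 ∧ (base q .left).2 ≤ (base q .up).2 := by
    rcases base_vertices q with ⟨h1, h2⟩ | ⟨h1, h2⟩
    · exact ⟨by rw [h1], by rwa [← h1]⟩
    · exact ⟨by rwa [← h2], by rw [h2]⟩
  have hyr : (base q .down).2 ≤ (base q .right).2 ∧ (base q .right).2 ≤ (base q .up).2 := by
    rcases base_vertices q with ⟨h1, h2⟩ | ⟨h1, h2⟩
    · exact ⟨by rwa [← h2], by rw [h2]⟩
    · exact ⟨by rw [h1], by rwa [← h1]⟩
  obtain ⟨P1, P2⟩ := P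
  have hcases := mem_compactify_line11 hP
  cases e
  case left =>
    have hpt : pt q .left t = ((base q .left).1 - t, (base q .left).2) := by
      ext <;> simp [pt, dir, vec, sub_eq_add_neg]
    rw [hpt] at h ⊢
    simp only [coord] at h
    subst h
    rcases hcases with ⟨h1, h2⟩ | ⟨h1, h2⟩ | ⟨h1, h2⟩ | ⟨h1, h2⟩ | ⟨s, hs, hst⟩
    · simp only at h2; rw [h2]; rfl
    · exfalso; rw [EReal.coe_le_coe_iff] at h1; linarith
    · exfalso; rw [EReal.coe_eq_coe_iff] at h1; linarith
    · exfalso; rw [EReal.coe_eq_coe_iff] at h1; linarith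
    · exfalso
      have h1 := congrArg Prod.fst hst
      simp only [toTP, EReal.coe_eq_coe_iff] at h1
      linarith [(pt_mid_fst_mem hs).1]
  case right =>
    have hpt : pt q .right t = ((base q .right).1 + t, (base q .right).2) := by
      ext <;> simp [pt, dir, vec]
    rw [hpt] at h ⊢
    simp only [coord] at h
    subst h
    rcases hcases with ⟨h1, h2⟩ | ⟨h1, h2⟩ | ⟨h1, h2⟩ | ⟨h1, h2⟩ | ⟨s, hs, hst⟩
    · exfalso; rw [EReal.coe_le_coe_iff] at h1; linarith
    · simp only at h2; rw [h2]; rfl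
    · exfalso; rw [EReal.coe_eq_coe_iff] at h1; linarith
    · exfalso; rw [EReal.coe_eq_coe_iff] at h1; linarith
    · exfalso
      have h1 := congrArg Prod.fst hst
      simp only [toTP, EReal.coe_eq_coe_iff] at h1
      linarith [(pt_mid_fst_mem hs).2]
  case down =>
    have hpt : pt q .down t = ((base q .down).1, (base q .down).2 - t) := by
      ext <;> simp [pt, dir, vec, sub_eq_add_neg]
    rw [hpt] at h ⊢
    simp only [coord] at h
    subst h
    rcases hcases with ⟨h1, h2⟩ | ⟨h1, h2⟩ | ⟨h1, h2⟩ | ⟨h1, h2⟩ | ⟨s, hs, hst⟩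
    · exfalso; rw [EReal.coe_eq_coe_iff] at h2; linarith
    · exfalso; rw [EReal.coe_eq_coe_iff] at h2; linarith
    · simp only at h1; rw [h1]; rfl
    · exfalso; rw [EReal.coe_le_coe_iff] at h2; linarith
    · exfalso
      have h1 := congrArg Prod.snd hst
      simp only [toTP, EReal.coe_eq_coe_iff] at h1
      linarith [(pt_mid_snd_mem hs).1]
  case up =>
    have hpt : pt q .up t = ((base q .up).1, (base q .up).2 + t) := by
      ext <;> simp [pt, dir, vec]
    rw [hpt] at h ⊢
    simp only [coord] at h
    subst h
    rcases hcases with ⟨h1, h2⟩ | ⟨h1, h2⟩ | ⟨h1, h2⟩ | ⟨h1, h2⟩ | ⟨s, hs, hst⟩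
    · exfalso; rw [EReal.coe_eq_coe_iff] at h2; linarith
    · exfalso; rw [EReal.coe_eq_coe_iff] at h2; linarith
    · exfalso; rw [EReal.coe_le_coe_iff] at h2; linarith
    · simp only at h1; rw [h1]; rfl
    · exfalso
      have h1 := congrArg Prod.snd hst
      simp only [toTP, EReal.coe_eq_coe_iff] at h1
      linarith [(pt_mid_snd_mem hs).2]
  case mid =>
    have ht : t < |q 2| := by simpa [len] using hlt
    obtain ⟨n1, n2⟩ := pt_mid_fst_ne h0 ht
    have hmem := pt_mid_fst_mem (q := q) (t := t) ⟨h0.le, hlt.le⟩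
    simp only [coord] at h
    subst h
    have hlr : (pt q .mid t).1 ≠ (base q .left).1 ∧ (pt q .mid t).1 ≠ (base q .right).1 := by
      rcases base_vertices q with ⟨h1, h2⟩ | ⟨h1, h2⟩
      · rw [← h1, ← h2]; exact ⟨n1, n2⟩
      · rw [← h1, ← h2]; exact ⟨n2, n1⟩
    rcases hcases with ⟨h1, h2⟩ | ⟨h1, h2⟩ | ⟨h1, h2⟩ | ⟨h1, h2⟩ | ⟨s, hs, hst⟩
    · rw [EReal.coe_le_coe_iff] at h1; exact absurd (le_antisymm h1 hmem.1) hlr.1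
    · rw [EReal.coe_le_coe_iff] at h1; exact absurd (le_antisymm hmem.2 h1) hlr.2
    · rw [EReal.coe_eq_coe_iff] at h1; exact absurd h1 n1
    · rw [EReal.coe_eq_coe_iff] at h1; exact absurd h1 n2
    · have h1 := congrArg Prod.fst hst
      simp only [toTP, EReal.coe_eq_coe_iff] at h1
      rw [hst, pt_mid_fst_injective q h1]

end

end Tritangent

namespace Tritangent

/-! ### Components of the intersection -/

section

variable {a : Expo → ℝ} {q : Fin 3 → ℝ}

/-- The parity condition characterizing tritangent curves: on each edge or leg, at each point where
a single monomial is active, the slope of this monomial along the edge has the parity `par`. -/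
def IsParityGood (a : Expo → ℝ) (q : Fin 3 → ℝ) : Prop :=
  ∀ (e : Edge) (t : ℝ), 0 < t → (t : EReal) < len q e → ∀ m, active a (pt q e t) = {m} →
    pair m (dir q e) ≡ par q e [ZMOD 2]

theorem mem_component_of_isPreconnected {e : Edge} {S : Set ℝ} (hS : IsPreconnected S)
    (hdom : S ⊆ dom q e) (hcurve : ∀ r ∈ S, pt q e r ∈ curve a) {r₀ : ℝ} (hr₀ : r₀ ∈ S)
    {P : EReal × EReal} (h : toTP (pt q e r₀) ∈ connectedComponentIn (inter a q) P) {r : ℝ}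
    (hr : r ∈ S) : toTP (pt q e r) ∈ connectedComponentIn (inter a q) P := by
  rw [connectedComponentIn_eq h]
  have himg : IsPreconnected ((fun t => toTP (pt q e t)) '' S) :=
    hS.image _ (continuous_toTP.comp (continuous_pt q e)).continuousOn
  refine himg.subset_connectedComponentIn ⟨r₀, hr₀, rfl⟩ ?_ ⟨r, hr, rfl⟩
  rintro _ ⟨s, hs, rfl⟩
  exact toTP_mem_inter_iff.2 ⟨pt_mem_line11 (hdom hs), hcurve s hs⟩

/-- The parameters of the points of an edge that lie in a set. -/
def edgeTrace (q : Fin 3 → ℝ) (e : Edge) (C : Set (EReal × EReal)) : Set ℝ :=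
  dom q e ∩ pt q e ⁻¹' {p | toTP p ∈ C}

theorem isClosed_edgeTrace (e : Edge) {C : Set (EReal × EReal)} (hC : IsClosed C) :
    IsClosed (edgeTrace q e C) :=
  (isClosed_dom q e).inter (hC.preimage (continuous_toTP.comp (continuous_pt q e)))

/-- The increment of the coordinate along an edge. -/
noncomputable def coordSign (q : Fin 3 → ℝ) : Edge → ℝ
  | .left => -1
  | .right => 1
  | .down => -1
  | .up => 1
  | .mid => if 0 ≤ q 2 then 1 else -1

theorem coordSign_eq (q : Fin 3 → ℝ) (e : Edge) : coordSign q e = 1 ∨ coordSign q e = -1 := by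
  cases e <;> simp only [coordSign] <;> try split_ifs
  all_goals simp

theorem coord_pt (q : Fin 3 → ℝ) (e : Edge) (t : ℝ) :
    coord e (pt q e t) = coord e (base q e) + t * coordSign q e := by
  cases e <;> simp only [coord, pt, dir, vec, coordSign] <;> try split_ifs
  all_goals simp

theorem ordConnected_edgeTrace (e : Edge) {C : Set (EReal × EReal)} (hC : IsPreconnected C)
    (hsub : C ⊆ compactify (line11 q)) : (edgeTrace q e C).OrdConnected := by
  refine ⟨fun s hs t ht r hr => ?_⟩
  rcases hr.1.eq_or_lt with rfl | h1
  · exact hs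
  rcases hr.2.eq_or_lt with rfl | h2
  · exact ht
  have hr0 : 0 < r := hs.1.1.trans_lt h1
  have hrl : (r : EReal) < len q e := lt_of_lt_of_le (by exact_mod_cast h2) ht.1.2
  refine ⟨⟨hr0.le, hrl.le⟩, ?_⟩
  have hord := (hC.image (coord e) (continuous_coord e).continuousOn).ordConnected
  have hmem : ∀ x ∈ edgeTrace q e C, ((coord e (pt q e x) : ℝ) : EReal) ∈ coord e '' C :=
    fun x hx => ⟨_, hx.2, coord_toTP e _⟩
  have hr' : ((coord e (pt q e r) : ℝ) : EReal) ∈ coord e '' C := by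
    rcases coordSign_eq q e with h | h
    · refine hord.out (hmem s hs) (hmem t ht) ⟨?_, ?_⟩ <;>
        rw [EReal.coe_le_coe_iff, coord_pt, coord_pt, h] <;> linarith
    · refine hord.out (hmem t ht) (hmem s hs) ⟨?_, ?_⟩ <;>
        rw [EReal.coe_le_coe_iff, coord_pt, coord_pt, h] <;> linarith
  obtain ⟨P, hP, hPr⟩ := hr'
  have := eq_of_coord_eq hr0 hrl (hsub hP) hPr
  change toTP (pt q e r) ∈ C
  rwa [← this]

theorem component_subset_line11 (P : EReal × EReal) :
    connectedComponentIn (inter a q) P ⊆ compactify (line11 q) :=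
  (connectedComponentIn_subset _ _).trans Set.inter_subset_left

theorem mem_curve_of_mem_component {P : EReal × EReal} {p : ℝ × ℝ}
    (h : toTP p ∈ connectedComponentIn (inter a q) P) : p ∈ curve a :=
  (toTP_mem_inter_iff.1 (connectedComponentIn_subset _ _ h)).2

theorem slopeL_modEq_of_isLeast (hgood : IsParityGood a q) {P : EReal × EReal} {e : Edge} {α : ℝ}
    (hα : α ∈ edgeTrace q e (connectedComponentIn (inter a q) P)) (h0 : 0 < α)
    (hmin : ∀ s ∈ edgeTrace q e (connectedComponentIn (inter a q) P), α ≤ s) :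
    slopeL a (base q e) (dir q e) α ≡ par q e [ZMOD 2] := by
  obtain ⟨ε, hε, h⟩ := exists_slope_left a (base q e) (dir q e) α
  have hs1 : max (α - ε / 2) (α / 2) < α := max_lt (by linarith) (by linarith)
  have hs2 : α - ε < max (α - ε / 2) (α / 2) := lt_max_of_lt_left (by linarith)
  have hs0 : 0 < max (α - ε / 2) (α / 2) := lt_max_of_lt_right (by linarith)
  set s := max (α - ε / 2) (α / 2)
  have hdom : ∀ r ∈ Set.Icc s α, r ∈ dom q e := fun r hr =>
    ⟨hs0.le.trans hr.1, le_trans (by exact_mod_cast hr.2) hα.1.2⟩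
  have hact := (h s ⟨hs2, hs1⟩).2.2
  by_cases hc : pt q e s ∈ curve a
  · exfalso
    have hcurve : ∀ r ∈ Set.Icc s α, pt q e r ∈ curve a := by
      intro r hr
      rcases hr.2.eq_or_lt with rfl | hr2
      · exact mem_curve_of_mem_component hα.2
      · have := (h r ⟨hs2.trans_le hr.1, hr2⟩).2.2
        rw [← hact] at this
        change 2 ≤ (active a (base q e + r • vec (dir q e))).card
        rw [this]
        exact hc
    have hsC := mem_component_of_isPreconnected isPreconnected_Icc hdom hcurve
      (Set.right_mem_Icc.2 hs1.le) hα.2 (Set.left_mem_Icc.2 hs1.le)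
    exact absurd (hmin s ⟨hdom s (Set.left_mem_Icc.2 hs1.le), hsC⟩) (not_le.2 hs1)
  · obtain ⟨m, hm⟩ := notMem_curve_iff.1 hc
    have hsl : (s : EReal) < len q e := lt_of_lt_of_le (by exact_mod_cast hs1) hα.1.2
    have hp := hgood e s hs0 hsl m hm
    have hm' : m ∈ active a (base q e + s • vec (dir q e)) := by
      change m ∈ active a (pt q e s)
      rw [hm]; exact Finset.mem_singleton_self m
    rw [hact, Finset.mem_filter] at hm'
    rwa [← hm'.2]

theorem slopeR_modEq_of_isGreatest (hgood : IsParityGood a q) {P : EReal × EReal} {e : Edge} {β : ℝ}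
    (hβ : β ∈ edgeTrace q e (connectedComponentIn (inter a q) P)) (hlt : (β : EReal) < len q e)
    (hmax : ∀ s ∈ edgeTrace q e (connectedComponentIn (inter a q) P), s ≤ β) :
    slopeR a (base q e) (dir q e) β ≡ par q e [ZMOD 2] := by
  obtain ⟨ε, hε, h⟩ := exists_slope_right a (base q e) (dir q e) β
  obtain ⟨c, hc1, hc2⟩ := EReal.lt_iff_exists_real_btwn.1 hlt
  rw [EReal.coe_lt_coe_iff] at hc1
  have hs1 : β < min (β + ε / 2) c := lt_min (by linarith) hc1
  have hs2 : min (β + ε / 2) c < β + ε := min_lt_of_left_lt (by linarith)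
  have hsl : ((min (β + ε / 2) c : ℝ) : EReal) < len q e :=
    lt_of_le_of_lt (by exact_mod_cast min_le_right _ _) hc2
  set s := min (β + ε / 2) c
  have hβ0 : 0 ≤ β := hβ.1.1
  have hdom : ∀ r ∈ Set.Icc β s, r ∈ dom q e := fun r hr =>
    ⟨hβ0.trans hr.1, le_trans (by exact_mod_cast hr.2) hsl.le⟩
  have hact := (h s ⟨hs1, hs2⟩).2.2
  by_cases hc : pt q e s ∈ curve a
  · exfalso
    have hcurve : ∀ r ∈ Set.Icc β s, pt q e r ∈ curve a := by
      intro r hr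
      rcases hr.1.eq_or_lt with rfl | hr1
      · exact mem_curve_of_mem_component hβ.2
      · have := (h r ⟨hr1, hr.2.trans_lt hs2⟩).2.2
        rw [← hact] at this
        change 2 ≤ (active a (base q e + r • vec (dir q e))).card
        rw [this]
        exact hc
    have hsC := mem_component_of_isPreconnected isPreconnected_Icc hdom hcurve
      (Set.left_mem_Icc.2 hs1.le) hβ.2 (Set.right_mem_Icc.2 hs1.le)
    exact absurd (hmax s ⟨hdom s (Set.right_mem_Icc.2 hs1.le), hsC⟩) (not_le.2 hs1)
  · obtain ⟨m, hm⟩ := notMem_curve_iff.1 hc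
    have hp := hgood e s (hβ0.trans_lt hs1) hsl m hm
    have hm' : m ∈ active a (base q e + s • vec (dir q e)) := by
      change m ∈ active a (pt q e s)
      rw [hm]; exact Finset.mem_singleton_self m
    rw [hact, Finset.mem_filter] at hm'
    rwa [← hm'.2]

theorem topSlope_modEq_par {e : Edge} (he : len q e = ⊤) : topSlope e ≡ par q e [ZMOD 2] := by
  have := (len_eq_top_iff q e).1 he
  cases e <;> simp [topSlope, par] at this ⊢
  · decide
  · decide

/-- Under the parity condition, all components carry even multiplicity: the contributions of the
edges cancel in pairs modulo two, since the parities `par` of the edges at a vertex have an even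
sum. -/
theorem even_totalMult (hgood : IsParityGood a q) (P : EReal × EReal) :
    Even (totalMult a q (connectedComponentIn (inter a q) P)) := by
  classical
  set C := connectedComponentIn (inter a q) P with hC
  have hmod : ∀ e, ∑ᶠ t ∈ edgeTrace q e C, multAt a q e t ≡ par q e *
      ((if (0 : ℝ) ∈ edgeTrace q e C then 1 else 0) +
        (if ∃ t ∈ edgeTrace q e C, (t : EReal) = len q e then 1 else 0)) [ZMOD 2] := by
    intro e
    refine finsum_edgeMult_modEq (exists_slope_right' a q e) (exists_slope_left' a q e)
      (finite_setOf_slope_ne _ _ _)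
      (ordConnected_edgeTrace e isPreconnected_connectedComponentIn (component_subset_line11 P))
      (isClosed_edgeTrace e (isClosed_connectedComponentIn (isClosed_inter a q) P))
      (fun t ht => ht.1) ?_ ?_ ?_
    · intro he
      obtain ⟨S, -, t₀, -, h⟩ := exists_leg_atTop a q he
      refine ⟨t₀, fun t ht => ?_⟩
      obtain ⟨-, h1, h2⟩ := h t ht
      rw [h1, h2]
      exact ⟨rfl, topSlope_modEq_par he⟩
    · exact fun α hα h0 hmin => slopeL_modEq_of_isLeast hgood hα h0 hmin
    · exact fun β hβ hlt hmax => slopeR_modEq_of_isGreatest hgood hβ hlt hmax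
  have h0 : ∀ e, ((0 : ℝ) ∈ edgeTrace q e C ↔ toTP (base q e) ∈ C) := by
    intro e
    have : pt q e 0 = base q e := by simp [pt]
    simp only [edgeTrace, Set.mem_inter_iff, zero_mem_dom, true_and, Set.mem_preimage, this,
      Set.mem_ofPred_eq]
  have hmid : (∃ t ∈ edgeTrace q .mid C, (t : EReal) = len q .mid) ↔ toTP (v₁ q) ∈ C := by
    constructor
    · rintro ⟨t, ht, h⟩
      have : t = |q 2| := by simpa [len] using h
      rw [← pt_mid_abs q, ← this]
      exact ht.2
    · intro h
      rw [← pt_mid_abs q] at h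
      exact ⟨|q 2|, ⟨abs_mem_dom q, h⟩, rfl⟩
  have hleg : ∀ e, len q e = ⊤ → ¬ ∃ t ∈ edgeTrace q e C, (t : EReal) = len q e := by
    rintro e he ⟨t, -, h⟩
    rw [he] at h
    exact EReal.coe_ne_top t h
  have htot : totalMult a q C = ∑ e, ∑ᶠ t ∈ edgeTrace q e C, multAt a q e t :=
    finsum_stableMult a q {p | toTP p ∈ C}
  have huniv : (Finset.univ : Finset Edge) = {.left, .right, .down, .up, .mid} := rfl
  rw [huniv] at htot
  simp only [Finset.mem_insert, Finset.mem_singleton, reduceCtorEq, or_self, not_false_eq_true,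
    Finset.sum_insert, Finset.sum_singleton] at htot
  have e1 := hmod .left
  have e2 := hmod .right
  have e3 := hmod .down
  have e4 := hmod .up
  have e5 := hmod .mid
  simp only [h0, hmid, hleg .left rfl, hleg .right rfl, hleg .down rfl, hleg .up rfl, par, base,
    if_false, zero_mul, one_mul, add_zero] at e1 e2 e3 e4 e5
  rw [htot, Int.even_iff]
  simp only [Int.ModEq] at e1 e2 e3 e4 e5
  rcases le_or_gt 0 (q 2) with h | h
  · simp only [h, if_true, zero_mul] at e2 e5
    split_ifs at e2 e4 <;> omega
  · simp only [not_le.2 h, if_false, one_mul] at e2 e5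
    split_ifs at e2 e4 e5 <;> omega

/-- A component with a real point contains a point of positive multiplicity: otherwise the set of
active monomials would be constant along the whole curve, but the monomials active far out on the
upper leg differ from those active far out on the lower leg. -/
theorem exists_stableMult_ne_zero {P : EReal × EReal} {p₀ : ℝ × ℝ}
    (hp₀ : toTP p₀ ∈ connectedComponentIn (inter a q) P) :
    ∃ p, toTP p ∈ connectedComponentIn (inter a q) P ∧ stableMult a q p ≠ 0 := by
  by_contra hcon
  push Not at hcon
  set C := connectedComponentIn (inter a q) P with hC
  obtain ⟨m, hm⟩ := active_nonempty a p₀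
  have hclosed : IsClosed C := isClosed_connectedComponentIn (isClosed_inter a q) P
  have key : ∀ e, ∀ t₀ ∈ dom q e, toTP (pt q e t₀) ∈ C → m ∈ active a (pt q e t₀) →
      ∀ t ∈ dom q e, toTP (pt q e t) ∈ C ∧ m ∈ active a (pt q e t) := by
    intro e t₀ ht₀ h1 h2
    have hconv : Convex ℝ (dom q e) := by
      rw [convex_iff_ordConnected]
      refine ⟨fun x hx y hy z hz => ⟨hx.1.trans hz.1, le_trans ?_ hy.2⟩⟩
      exact_mod_cast hz.2
    have : PreconnectedSpace (dom q e) :=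
      Subtype.preconnectedSpace hconv.isPreconnected
    let Z : Set (dom q e) := {t | toTP (pt q e t) ∈ C ∧ m ∈ active a (pt q e t)}
    have hZc : IsClosed Z := by
      have hc : Continuous fun t : dom q e => pt q e t :=
        (continuous_pt q e).comp continuous_subtype_val
      exact (hclosed.preimage (continuous_toTP.comp hc)).inter
        ((isClosed_setOf_mem_active a m).preimage hc)
    have hZo : IsOpen Z := by
      rw [Metric.isOpen_iff]
      rintro ⟨t, ht⟩ ⟨htC, htm⟩
      have htcurve := mem_curve_of_mem_component htC
      have hmult := hcon _ htC
      obtain ⟨ε, hε, hr⟩ := exists_slope_right a (base q e) (dir q e) t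
      obtain ⟨δ, hδ, hl⟩ := exists_slope_left a (base q e) (dir q e) t
      refine ⟨min ε δ, lt_min hε hδ, ?_⟩
      rintro ⟨s, hs⟩ hst
      have hst' : |s - t| < min ε δ := hst
      have hst1 := abs_lt.1 (hst'.trans_le (min_le_left _ _))
      have hst2 := abs_lt.1 (hst'.trans_le (min_le_right _ _))
      -- The set of active monomials does not change near `t` along the edge.
      have hact : ∀ r ∈ dom q e, t - δ < r → r < t + ε →
          active a (pt q e r) = active a (pt q e t) := by
        intro r hrd hr1 hr2
        rcases lt_trichotomy t r with h | rfl | h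
        · have hfwd : FwdAt q e (pt q e t) :=
            ⟨t, ht.1, lt_of_lt_of_le (by exact_mod_cast h) hrd.2, rfl⟩
          have hout := mem_outgoing_iff.2 ⟨e, Or.inl ⟨rfl, hfwd⟩⟩
          refine ((hr r ⟨h, hr2⟩).2.2).trans (Finset.filter_true_of_mem fun n hn => ?_)
          exact pair_eq_of_stableMult_eq_zero hmult hn hout
        · rfl
        · have hbwd : BwdAt q e (pt q e t) := ⟨t, hrd.1.trans_lt h, ht.2, rfl⟩
          have hout := mem_outgoing_iff.2 ⟨e, Or.inr ⟨rfl, hbwd⟩⟩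
          refine ((hl r ⟨hr1, h⟩).2.2).trans (Finset.filter_true_of_mem fun n hn => ?_)
          have := pair_eq_of_stableMult_eq_zero hmult hn hout
          rw [pair_neg] at this
          change pair n (dir q e) = -tropSlope a (pt q e t) (-dir q e)
          rw [← this, neg_neg]
      have hsub : ∀ r ∈ Set.uIcc s t, r ∈ dom q e ∧ t - δ < r ∧ r < t + ε := by
        intro r hr
        refine ⟨hconv.ordConnected.uIcc_subset hs ht hr, ?_, ?_⟩
        · rcases Set.mem_uIcc.1 hr with h | h <;> linarith [h.1]
        · rcases Set.mem_uIcc.1 hr with h | h <;> linarith [h.2]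
      refine ⟨?_, ?_⟩
      · refine mem_component_of_isPreconnected isPreconnected_uIcc (fun r hr => (hsub r hr).1)
          (fun r hr => ?_) Set.right_mem_uIcc htC Set.left_mem_uIcc
        obtain ⟨h1, h2, h3⟩ := hsub r hr
        change 2 ≤ _
        rw [hact r h1 h2 h3]
        exact htcurve
      · obtain ⟨h1, h2, h3⟩ := hsub s Set.left_mem_uIcc
        change m ∈ active a (pt q e s)
        rw [hact s h1 h2 h3]
        exact htm
    have huniv : Z = Set.univ := IsClopen.eq_univ ⟨hZc, hZo⟩ ⟨⟨t₀, ht₀⟩, h1, h2⟩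
    intro t ht
    have : (⟨t, ht⟩ : dom q e) ∈ Z := huniv ▸ Set.mem_univ _
    exact this
  have hbase : ∀ e, pt q e 0 = base q e := fun e => by simp [pt]
  have hend : pt q .mid |q 2| = base q .up := pt_mid_abs q
  have hzero : pt q .mid 0 = base q .down := pt_mid_zero q
  -- Propagate from the edge of `p₀` to both vertices.
  have hVdu : toTP (base q .down) ∈ C ∧ m ∈ active a (base q .down) ↔
      toTP (base q .up) ∈ C ∧ m ∈ active a (base q .up) := by
    rw [← hend, ← hzero]
    exact ⟨fun h => key .mid 0 (zero_mem_dom q _) h.1 h.2 _ (abs_mem_dom q),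
      fun h => key .mid _ (abs_mem_dom q) h.1 h.2 0 (zero_mem_dom q _)⟩
  have hV : toTP (base q .down) ∈ C ∧ m ∈ active a (base q .down) := by
    obtain ⟨e, t, ht, rfl⟩ := mem_line11_iff.1
      (toTP_mem_inter_iff.1 (connectedComponentIn_subset _ _ hp₀)).1
    have h := key e t ht hp₀ hm 0 (zero_mem_dom q e)
    rw [hbase] at h
    have he : base q e = base q .down ∨ base q e = base q .up := by
      cases e <;> simp only [base] <;> try split_ifs
      all_goals simp
    rcases he with he | he
    · rwa [he] at h
    · rw [he] at h; exact hVdu.2 h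
  have hfar : ∀ e, len q e = ⊤ → toTP (base q e) ∈ C → m ∈ active a (base q e) →
      pair m (dir q e) = topSlope e := by
    intro e he h1 h2
    obtain ⟨S, hS, t₀, ht₀, h⟩ := exists_leg_atTop a q he
    rw [← hbase] at h1 h2
    have := (key e 0 (zero_mem_dom q e) h1 h2 t₀ ⟨ht₀.le, by rw [he]; exact le_top⟩).2
    rw [(h t₀ le_rfl).1] at this
    exact (hS m this).2
  have h1 := hfar .down rfl hV.1 hV.2
  have h2 := hfar .up rfl (hVdu.1 hV).1 (hVdu.1 hV).2
  simp [pair, dir, topSlope] at h1 h2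
  omega

end

end Tritangent

namespace Tritangent

/-! ### Tritangency as a parity condition -/

section

variable {a : Expo → ℝ} {q : Fin 3 → ℝ}

theorem active_eq_singleton_iff {p : ℝ × ℝ} {m : Expo} :
    active a p = {m} ↔ ∀ n, n ≠ m → monomialVal a n p < monomialVal a m p := by
  constructor
  · intro h n hn
    have hm : m ∈ active a p := h ▸ Finset.mem_singleton_self m
    refine lt_of_le_of_ne (mem_active.1 hm n) fun heq => hn ?_
    have := mem_active_of_val_eq hm heq
    rwa [h, Finset.mem_singleton] at this
  · intro h
    ext n
    rw [Finset.mem_singleton]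
    constructor
    · intro hn
      by_contra hne
      exact absurd (mem_active.1 hn m) (not_le.2 (h n hne))
    · rintro rfl
      exact mem_active.2 fun k => (eq_or_ne k n).elim (fun h => h ▸ le_rfl) fun hk => (h k hk).le

theorem isOpen_setOf_active_eq_singleton (a : Expo → ℝ) (m : Expo) :
    IsOpen {p | active a p = {m}} := by
  have : {p | active a p = {m}} =
      ⋂ n, ⋂ _ : n ≠ m, {p | monomialVal a n p < monomialVal a m p} := by
    ext p
    simp only [Set.mem_ofPred_eq, active_eq_singleton_iff, Set.mem_iInter]
  rw [this]
  exact isOpen_iInter_of_finite fun n => isOpen_iInter_of_finite fun _ =>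
    isOpen_lt (continuous_monomialVal a n) (continuous_monomialVal a m)

/-- If the infinite end `P` of a leg lies on the compactified curve of `F`, then the leg is
contained in this curve far out: a monomial which alone is active at a point far out on the leg would be the
only active one near `P`. -/
theorem exists_tail_subset_curve {e : Edge} (he : len q e = ⊤) {P : EReal × EReal}
    (hP : P ∈ compactify (curve a))
    (hnhds : ∀ t₀ : ℝ, ∀ U ∈ 𝓝 (pt q e t₀), ∃ V ∈ 𝓝 P, ∀ p, toTP p ∈ V →
      ∃ s : ℝ, 0 ≤ s ∧ ∃ p' ∈ U, p = p' + s • vec (dir q e)) :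
    ∃ t₀ : ℝ, 0 < t₀ ∧ ∀ t, t₀ ≤ t → pt q e t ∈ curve a := by
  obtain ⟨S, hS, t₀, ht₀, h⟩ := exists_leg_atTop a q he
  refine ⟨t₀, ht₀, fun t ht => ?_⟩
  by_contra hc
  obtain ⟨m, hm⟩ := notMem_curve_iff.1 hc
  have hmax : ∀ n, pair n (dir q e) ≤ pair m (dir q e) := by
    refine (hS m ?_).1
    rw [← (h t ht).1, hm]
    exact Finset.mem_singleton_self m
  have hU : {p : ℝ × ℝ | active a p = {m}} ∈ 𝓝 (pt q e t) :=
    (isOpen_setOf_active_eq_singleton a m).mem_nhds hm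
  obtain ⟨V, hV, hVU⟩ := hnhds t _ hU
  obtain ⟨_, hQV, p, hpc, rfl⟩ := mem_closure_iff_nhds.1 hP V hV
  obtain ⟨s, hs, p', hp', rfl⟩ := hVU p hQV
  refine notMem_curve_iff.2 ⟨m, active_eq_singleton_iff.2 fun n hn => ?_⟩ hpc
  rw [monomialVal_add_smul, monomialVal_add_smul]
  have h1 := active_eq_singleton_iff.1 hp' n hn
  have h2 : (pair n (dir q e) : ℝ) ≤ pair m (dir q e) := by exact_mod_cast hmax n
  nlinarith

theorem exists_toTP_mem_component_of_tendsto {e : Edge} (he : len q e = ⊤) {P : EReal × EReal}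
    (hP : P ∈ inter a q) (hlim : Tendsto (fun t => toTP (pt q e t)) atTop (𝓝 P))
    (hnhds : ∀ t₀ : ℝ, ∀ U ∈ 𝓝 (pt q e t₀), ∃ V ∈ 𝓝 P, ∀ p, toTP p ∈ V →
      ∃ s : ℝ, 0 ≤ s ∧ ∃ p' ∈ U, p = p' + s • vec (dir q e)) :
    ∃ p, toTP p ∈ connectedComponentIn (inter a q) P := by
  obtain ⟨t₀, ht₀, h⟩ := exists_tail_subset_curve he hP.2 hnhds
  have hpre : IsPreconnected ((fun t => toTP (pt q e t)) '' Set.Ici t₀) :=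
    isPreconnected_Ici.image _ (continuous_toTP.comp (continuous_pt q e)).continuousOn
  have hcl : P ∈ closure ((fun t => toTP (pt q e t)) '' Set.Ici t₀) := by
    refine mem_closure_of_tendsto hlim ?_
    filter_upwards [eventually_ge_atTop t₀] with t ht using ⟨t, ht, rfl⟩
  have hpre' := hpre.subset_closure (Set.subset_insert P _)
    (Set.insert_subset hcl subset_closure)
  refine ⟨pt q e t₀, hpre'.subset_connectedComponentIn (Set.mem_insert _ _) ?_
    (Set.mem_insert_of_mem _ ⟨t₀, Set.self_mem_Ici, rfl⟩)⟩
  refine Set.insert_subset hP ?_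
  rintro _ ⟨t, ht, rfl⟩
  refine toTP_mem_inter_iff.2 ⟨pt_mem_line11 ⟨ht₀.le.trans ht, ?_⟩, h t ht⟩
  rw [he]; exact le_top

theorem coe_image_mem_nhds {y : ℝ} {v : Set ℝ} (hv : v ∈ 𝓝 y) :
    ((↑) : ℝ → EReal) '' v ∈ 𝓝 (y : EReal) := by
  rw [EReal.nhds_coe]
  exact image_mem_map hv

theorem coe_mem_image_iff {y : ℝ} {v : Set ℝ} : (y : EReal) ∈ ((↑) : ℝ → EReal) '' v ↔ y ∈ v :=
  ⟨fun ⟨r, hr, h⟩ => by rwa [EReal.coe_eq_coe_iff.1 h] at hr, fun h => ⟨y, h, rfl⟩⟩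

/-- Every component of the intersection has a point in `ℝ²`. -/
theorem exists_toTP_mem_component {P : EReal × EReal} (hP : P ∈ inter a q) :
    ∃ p, toTP p ∈ connectedComponentIn (inter a q) P := by
  have hself := mem_connectedComponentIn hP
  have hreal : ∀ x y : ℝ, P = ((x : EReal), (y : EReal)) →
      ∃ p, toTP p ∈ connectedComponentIn (inter a q) P := by
    intro x y h
    refine ⟨(x, y), ?_⟩
    rw [h] at hself ⊢
    exact hself
  have hfar : Tendsto (fun t : ℝ => (t : EReal)) atTop (𝓝 ⊤) := EReal.tendsto_coe_atTop
  have hfar' : Tendsto (fun t : ℝ => (t : EReal)) atBot (𝓝 ⊥) := EReal.tendsto_coe_atBot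
  obtain ⟨P1, P2⟩ := P
  rcases mem_compactify_line11 hP.1 with ⟨h1, h2⟩ | ⟨h1, h2⟩ | ⟨h1, h2⟩ | ⟨h1, h2⟩ | ⟨t, -, ht⟩
  · simp only at h1 h2
    subst h2
    induction P1 with
    | coe x => exact hreal x _ rfl
    | top => simp at h1
    | bot =>
      have hpt : ∀ t, pt q .left t = ((base q .left).1 - t, (base q .left).2) := by
        intro t; ext <;> simp [pt, dir, vec, sub_eq_add_neg]
      refine exists_toTP_mem_component_of_tendsto (e := .left) rfl hP ?_ ?_
      · simp only [hpt, toTP]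
        exact (hfar'.comp (tendsto_atBot_add_const_left _ _ tendsto_neg_atTop_atBot)).prodMk_nhds
          tendsto_const_nhds
      · intro t₀ U hU
        rw [hpt] at hU
        obtain ⟨u, hu, v, hv, huv⟩ := mem_nhds_prod_iff.1 hU
        refine ⟨Set.Iio (((base q .left).1 - t₀ : ℝ) : EReal) ×ˢ (((↑) : ℝ → EReal) '' v),
          prod_mem_nhds (Iio_mem_nhds (EReal.bot_lt_coe _)) (coe_image_mem_nhds hv), ?_⟩
        rintro ⟨x, y⟩ ⟨hx, hy⟩
        rw [Set.mem_Iio, toTP, EReal.coe_lt_coe_iff] at hx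
        refine ⟨(base q .left).1 - t₀ - x, by simpa using hx.le, ((base q .left).1 - t₀, y),
          huv ⟨mem_of_mem_nhds hu, coe_mem_image_iff.1 hy⟩, ?_⟩
        ext <;> simp [dir, vec]
  · simp only at h1 h2
    subst h2
    induction P1 with
    | coe x => exact hreal x _ rfl
    | bot => simp at h1
    | top =>
      have hpt : ∀ t, pt q .right t = ((base q .right).1 + t, (base q .right).2) := by
        intro t; ext <;> simp [pt, dir, vec]
      refine exists_toTP_mem_component_of_tendsto (e := .right) rfl hP ?_ ?_
      · simp only [hpt, toTP]
        exact (hfar.comp (tendsto_atTop_add_const_left _ _ tendsto_id)).prodMk_nhds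
          tendsto_const_nhds
      · intro t₀ U hU
        rw [hpt] at hU
        obtain ⟨u, hu, v, hv, huv⟩ := mem_nhds_prod_iff.1 hU
        refine ⟨Set.Ioi (((base q .right).1 + t₀ : ℝ) : EReal) ×ˢ (((↑) : ℝ → EReal) '' v),
          prod_mem_nhds (Ioi_mem_nhds (EReal.coe_lt_top _)) (coe_image_mem_nhds hv), ?_⟩
        rintro ⟨x, y⟩ ⟨hx, hy⟩
        rw [Set.mem_Ioi, toTP, EReal.coe_lt_coe_iff] at hx
        refine ⟨x - ((base q .right).1 + t₀), by simpa using hx.le, ((base q .right).1 + t₀, y),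
          huv ⟨mem_of_mem_nhds hu, coe_mem_image_iff.1 hy⟩, ?_⟩
        ext <;> simp [dir, vec]
  · simp only at h1 h2
    subst h1
    induction P2 with
    | coe x => exact hreal _ x rfl
    | top => simp at h2
    | bot =>
      have hpt : ∀ t, pt q .down t = ((base q .down).1, (base q .down).2 - t) := by
        intro t; ext <;> simp [pt, dir, vec, sub_eq_add_neg]
      refine exists_toTP_mem_component_of_tendsto (e := .down) rfl hP ?_ ?_
      · simp only [hpt, toTP]
        exact tendsto_const_nhds.prodMk_nhds
          (hfar'.comp (tendsto_atBot_add_const_left _ _ tendsto_neg_atTop_atBot))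
      · intro t₀ U hU
        rw [hpt] at hU
        obtain ⟨u, hu, v, hv, huv⟩ := mem_nhds_prod_iff.1 hU
        refine ⟨(((↑) : ℝ → EReal) '' u) ×ˢ Set.Iio (((base q .down).2 - t₀ : ℝ) : EReal),
          prod_mem_nhds (coe_image_mem_nhds hu) (Iio_mem_nhds (EReal.bot_lt_coe _)), ?_⟩
        rintro ⟨x, y⟩ ⟨hx, hy⟩
        rw [Set.mem_Iio, toTP, EReal.coe_lt_coe_iff] at hy
        refine ⟨(base q .down).2 - t₀ - y, by simpa using hy.le, (x, (base q .down).2 - t₀),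
          huv ⟨coe_mem_image_iff.1 hx, mem_of_mem_nhds hv⟩, ?_⟩
        ext <;> simp [dir, vec]
  · simp only at h1 h2
    subst h1
    induction P2 with
    | coe x => exact hreal _ x rfl
    | bot => simp at h2
    | top =>
      have hpt : ∀ t, pt q .up t = ((base q .up).1, (base q .up).2 + t) := by
        intro t; ext <;> simp [pt, dir, vec]
      refine exists_toTP_mem_component_of_tendsto (e := .up) rfl hP ?_ ?_
      · simp only [hpt, toTP]
        exact tendsto_const_nhds.prodMk_nhds
          (hfar.comp (tendsto_atTop_add_const_left _ _ tendsto_id))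
      · intro t₀ U hU
        rw [hpt] at hU
        obtain ⟨u, hu, v, hv, huv⟩ := mem_nhds_prod_iff.1 hU
        refine ⟨(((↑) : ℝ → EReal) '' u) ×ˢ Set.Ioi (((base q .up).2 + t₀ : ℝ) : EReal),
          prod_mem_nhds (coe_image_mem_nhds hu) (Ioi_mem_nhds (EReal.coe_lt_top _)), ?_⟩
        rintro ⟨x, y⟩ ⟨hx, hy⟩
        rw [Set.mem_Ioi, toTP, EReal.coe_lt_coe_iff] at hy
        refine ⟨y - ((base q .up).2 + t₀), by simpa using hy.le, (x, (base q .up).2 + t₀),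
          huv ⟨coe_mem_image_iff.1 hx, mem_of_mem_nhds hv⟩, ?_⟩
        ext <;> simp [dir, vec]
  · exact hreal _ _ ht

/-! ### Adding up the components -/

/-- The points of the stable intersection. -/
noncomputable def stablePoints (a : Expo → ℝ) (q : Fin 3 → ℝ) : Finset (ℝ × ℝ) :=
  (finite_support_stableMult a q).toFinset

theorem mem_stablePoints {p : ℝ × ℝ} : p ∈ stablePoints a q ↔ stableMult a q p ≠ 0 := by
  simp [stablePoints]

open Classical in
theorem finsum_stableMult_eq_sum (S : Set (ℝ × ℝ)) :
    ∑ᶠ p ∈ S, stableMult a q p = ∑ p ∈ stablePoints a q with p ∈ S, stableMult a q p := by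
  refine finsum_mem_eq_sum_of_inter_support_eq _ ?_
  ext p
  simp only [Set.mem_inter_iff, Function.mem_support, Finset.coe_filter, Set.mem_ofPred_eq,
    mem_stablePoints]
  tauto

theorem toTP_mem_inter_of_mem_stablePoints {p : ℝ × ℝ} (hp : p ∈ stablePoints a q) :
    toTP p ∈ inter a q := by
  rw [mem_stablePoints] at hp
  refine toTP_mem_inter_iff.2 ⟨?_, ?_⟩
  · by_contra h
    refine hp ?_
    rw [stableMult_eq_sum]
    exact Finset.sum_eq_zero fun e _ =>
      edgeTerm_eq_zero fun he => h (mem_line11_iff.2 ⟨e, he⟩)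
  · by_contra h
    obtain ⟨m, hm⟩ := notMem_curve_iff.1 h
    refine hp ?_
    rw [← sum_outgoing_pair q p m]
    refine Finset.sum_congr rfl fun u _ => tropSlope_eq fun n hn => ?_
    rw [hm, Finset.mem_singleton] at hn
    rw [hn]

/-- The component of the intersection that contains a given point of `ℝ²`. -/
noncomputable def componentAt (a : Expo → ℝ) (q : Fin 3 → ℝ) (p : ℝ × ℝ) : Set (EReal × EReal) :=
  connectedComponentIn (inter a q) (toTP p)

theorem toTP_mem_componentAt_iff {p p' : ℝ × ℝ}
    (hp' : p' ∈ stablePoints a q) :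
    toTP p' ∈ componentAt a q p ↔ componentAt a q p' = componentAt a q p := by
  constructor
  · intro h; exact (connectedComponentIn_eq h).symm
  · intro h; rw [← h]
    exact mem_connectedComponentIn (toTP_mem_inter_of_mem_stablePoints hp')

open Classical in
/-- The stable multiplicity of a set of points which is saturated with respect to the components is
the sum of the multiplicities of the components that it meets. -/
theorem finsum_stableMult_saturated {S : Set (ℝ × ℝ)}
    (hS : ∀ p ∈ stablePoints a q, ∀ p' ∈ stablePoints a q, p ∈ S →
      componentAt a q p' = componentAt a q p → p' ∈ S) :
    ∑ᶠ p ∈ S, stableMult a q p =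
      ∑ C ∈ ((stablePoints a q).filter (· ∈ S)).image (componentAt a q), totalMult a q C := by
  rw [finsum_stableMult_eq_sum, ← Finset.sum_fiberwise_of_maps_to
    (g := componentAt a q) fun p hp => Finset.mem_image_of_mem _ hp]
  refine Finset.sum_congr rfl fun C hC => ?_
  obtain ⟨p, hp, rfl⟩ := Finset.mem_image.1 hC
  rw [Finset.mem_filter] at hp
  refine Eq.trans ?_ (finsum_stableMult_eq_sum {p' | toTP p' ∈ componentAt a q p}).symm
  refine Finset.sum_congr ?_ fun _ _ => rfl
  ext p'
  simp only [Finset.mem_filter, Set.mem_ofPred_eq]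
  constructor
  · rintro ⟨⟨h1, -⟩, h2⟩
    exact ⟨h1, (toTP_mem_componentAt_iff h1).2 h2⟩
  · rintro ⟨h1, h2⟩
    have h3 := (toTP_mem_componentAt_iff h1).1 h2
    exact ⟨⟨h1, hS p hp.1 p' h1 hp.2 h3⟩, h3⟩

open Classical in
theorem components_eq_image :
    components (inter a q) = ((stablePoints a q).image (componentAt a q) : Set _) := by
  ext C
  simp only [components, Set.mem_ofPred_eq, Finset.coe_image, Set.mem_image, Finset.mem_coe]
  constructor
  · rintro ⟨P, hP, rfl⟩
    obtain ⟨p₀, hp₀⟩ := exists_toTP_mem_component hP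
    obtain ⟨p, hp, h⟩ := exists_stableMult_ne_zero hp₀
    exact ⟨p, mem_stablePoints.2 h, (connectedComponentIn_eq hp).symm⟩
  · rintro ⟨p, hp, rfl⟩
    exact ⟨toTP p, toTP_mem_inter_of_mem_stablePoints hp, rfl⟩

open Classical in
theorem totalMult_pos {p : ℝ × ℝ} (hp : p ∈ stablePoints a q) :
    0 < totalMult a q (componentAt a q p) := by
  have h := finsum_stableMult_eq_sum (a := a) (q := q) {p' | toTP p' ∈ componentAt a q p}
  refine lt_of_lt_of_eq ?_ h.symm
  refine Finset.sum_pos' (fun p' _ => stableMult_nonneg a q p') ⟨p, ?_, ?_⟩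
  · rw [Finset.mem_filter]
    exact ⟨hp, mem_connectedComponentIn (toTP_mem_inter_of_mem_stablePoints hp)⟩
  · exact lt_of_le_of_ne (stableMult_nonneg a q p) (mem_stablePoints.1 hp).symm

open Classical in
/-- As the multiplicities of the components add up to six, tritangency means that they are all
even. -/
theorem isTritangent_iff_even :
    IsTritangent a q ↔ ∀ C ∈ components (inter a q), Even (totalMult a q C) := by
  constructor
  · rintro (⟨C₁, C₂, C₃, -, -, -, h, h1, h2, h3⟩ | ⟨C₁, C₂, -, h, h1, h2⟩ | ⟨C₁, h, h1⟩) C hC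
    · rw [h] at hC
      rcases hC with rfl | rfl | rfl
      · rw [h1]; decide
      · rw [h2]; decide
      · rw [h3]; decide
    · rw [h] at hC
      rcases hC with rfl | rfl
      · rw [h1]; decide
      · rw [h2]; decide
    · rw [h] at hC
      rcases hC with rfl
      rw [h1]; decide
  · intro heven
    rw [components_eq_image] at heven
    set K := (stablePoints a q).image (componentAt a q) with hK
    have hsum : ∑ C ∈ K, totalMult a q C = 6 := by
      have := finsum_stableMult_saturated (a := a) (q := q) (S := Set.univ)
        fun _ _ _ _ _ _ => Set.mem_univ _
      simp only [Set.mem_univ, Finset.filter_true, ← hK] at this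
      rw [← this]
      simpa using finsum_stableMult_univ a q
    have hge : ∀ C ∈ K, 2 ≤ totalMult a q C := by
      intro C hC
      obtain ⟨p, hp, rfl⟩ := Finset.mem_image.1 hC
      have h1 := totalMult_pos hp
      obtain ⟨k, hk⟩ := heven _ hC
      omega
    have hcard : K.card ≤ 3 := by
      have := Finset.card_nsmul_le_sum K (totalMult a q) 2 hge
      rw [hsum] at this
      simp only [nsmul_eq_mul] at this
      omega
    have hcomp : components (inter a q) = (K : Set _) := components_eq_image
    unfold IsTritangent
    rw [hcomp]
    have hcard' : K.card = 0 ∨ K.card = 1 ∨ K.card = 2 ∨ K.card = 3 := by omega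
    rcases hcard' with h | h | h | h
    · rw [Finset.card_eq_zero.1 h] at hsum
      simp at hsum
    · obtain ⟨C, hC⟩ := Finset.card_eq_one.1 h
      rw [hC, Finset.sum_singleton] at hsum
      exact Or.inr (Or.inr ⟨C, by rw [hC]; simp, hsum⟩)
    · obtain ⟨C, D, hCD, hC⟩ := Finset.card_eq_two.1 h
      rw [hC, Finset.sum_pair hCD] at hsum
      have g1 := hge C (by simp [hC])
      have g2 := hge D (by simp [hC])
      obtain ⟨k, hk⟩ := heven C (by simp [hC])
      have : totalMult a q C = 2 ∨ totalMult a q C = 4 := by omega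
      rcases this with h1 | h1
      · exact Or.inr (Or.inl ⟨C, D, hCD, by rw [hC]; simp, h1, by omega⟩)
      · exact Or.inr (Or.inl ⟨D, C, hCD.symm, by rw [hC, Finset.pair_comm]; simp, by omega, h1⟩)
    · obtain ⟨C, D, E, h1, h2, h3, hC⟩ := Finset.card_eq_three.1 h
      rw [hC, Finset.sum_insert (by simp [h1, h2]), Finset.sum_pair h3] at hsum
      have g1 := hge C (by simp [hC])
      have g2 := hge D (by simp [hC])
      have g3 := hge E (by simp [hC])
      exact Or.inl ⟨C, D, E, h1, h2, h3, by rw [hC]; simp, by omega, by omega, by omega⟩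

/-- Multiplicities on the far side of a point `t` of an edge at which a single monomial is active:
this set is saturated, as the intersection has no point over the coordinate of `t`. -/
theorem even_finsum_farSide (heven : ∀ C ∈ components (inter a q), Even (totalMult a q C))
    {e : Edge} {t : ℝ} (h0 : 0 < t) (hlt : (t : EReal) < len q e) (ht : pt q e t ∉ curve a) :
    Even (∑ᶠ p ∈ {p : ℝ × ℝ | 0 ≤ coordSign q e * (coord e p - coord e (pt q e t))},
      stableMult a q p) := by
  classical
  rw [finsum_stableMult_saturated]
  · refine Finset.even_sum _ fun C hC => heven C ?_
    rw [components_eq_image]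
    exact Finset.image_subset_image (Finset.filter_subset _ _) hC
  · intro p hp p' hp' hS hc
    by_contra hS'
    simp only [Set.mem_ofPred_eq, not_le] at hS hS'
    have hmem : toTP p ∈ componentAt a q p :=
      mem_connectedComponentIn (toTP_mem_inter_of_mem_stablePoints hp)
    have hmem' : toTP p' ∈ componentAt a q p := (toTP_mem_componentAt_iff hp').2 hc
    have hord := (isPreconnected_connectedComponentIn.image (coord e)
      (continuous_coord e).continuousOn : IsPreconnected (coord e '' componentAt a q p)).ordConnected
    have hx : ((coord e (pt q e t) : ℝ) : EReal) ∈ coord e '' componentAt a q p := by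
      rcases coordSign_eq q e with h | h
      · refine hord.out ⟨_, hmem', coord_toTP e _⟩ ⟨_, hmem, coord_toTP e _⟩ ⟨?_, ?_⟩ <;>
          rw [h] at hS hS' <;> rw [EReal.coe_le_coe_iff] <;> linarith
      · refine hord.out ⟨_, hmem, coord_toTP e _⟩ ⟨_, hmem', coord_toTP e _⟩ ⟨?_, ?_⟩ <;>
          rw [h] at hS hS' <;> rw [EReal.coe_le_coe_iff] <;> linarith
    obtain ⟨P, hP, hPt⟩ := hx
    have hPeq := eq_of_coord_eq h0 hlt (component_subset_line11 _ hP) hPt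
    rw [hPeq] at hP
    exact ht (mem_curve_of_mem_component hP)

theorem finsum_multAt_empty {e : Edge} {S : Set (ℝ × ℝ)} (h : ∀ t ∈ dom q e, pt q e t ∉ S) :
    ∑ᶠ t ∈ dom q e ∩ pt q e ⁻¹' S, multAt a q e t = 0 := by
  have : dom q e ∩ pt q e ⁻¹' S = ∅ := by
    ext t; exact ⟨fun ht => h t ht.1 ht.2, fun h => h.elim⟩
  rw [this, finsum_mem_empty]

theorem finsum_multAt_full {e : Edge} {S : Set (ℝ × ℝ)} (h : ∀ t ∈ dom q e, pt q e t ∈ S) :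
    ∑ᶠ t ∈ dom q e ∩ pt q e ⁻¹' S, multAt a q e t = topSlope e := by
  rw [Set.inter_eq_left.2 (show dom q e ⊆ pt q e ⁻¹' S from h), finsum_multAt_dom]

theorem finsum_multAt_farSide {e : Edge} {t : ℝ} (h0 : 0 < t) (hlt : (t : EReal) < len q e)
    {m : Expo} (hm : active a (pt q e t) = {m}) :
    ∑ᶠ s ∈ dom q e ∩ pt q e ⁻¹' {p | 0 ≤ coordSign q e * (coord e p - coord e (pt q e t))},
      multAt a q e s = topSlope e - pair m (dir q e) := by
  have hslope : slopeL a (base q e) (dir q e) t = pair m (dir q e) := by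
    rw [slopeL, tropSlope_eq (s := -pair m (dir q e)), neg_neg]
    intro n hn
    change n ∈ active a (pt q e t) at hn
    rw [hm, Finset.mem_singleton] at hn
    rw [pair_neg, hn]
  have hset : dom q e ∩ pt q e ⁻¹' {p | 0 ≤ coordSign q e * (coord e p - coord e (pt q e t))} =
      dom q e ∩ Set.Ici t := by
    ext s
    simp only [Set.mem_inter_iff, Set.mem_preimage, Set.mem_ofPred_eq, Set.mem_Ici, coord_pt]
    rcases coordSign_eq q e with h | h <;> rw [h] <;>
      refine and_congr_right fun _ => ⟨fun h => ?_, fun h => ?_⟩ <;> linarith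
  rw [hset]
  by_cases he : e = .mid
  · subst he
    have hlt' : t < |q 2| := by simpa [len] using hlt
    have : dom q .mid ∩ Set.Ici t = Set.Icc t |q 2| := by
      rw [dom_mid]
      ext s
      simp only [Set.mem_inter_iff, Set.mem_Icc, Set.mem_Ici]
      constructor
      · rintro ⟨⟨-, h1⟩, h2⟩; exact ⟨h2, h1⟩
      · rintro ⟨h1, h2⟩; exact ⟨⟨h0.le.trans h1, h2⟩, h1⟩
    rw [this, finsum_multAt_Icc a q _ h0.le hlt'.le le_rfl, hslope]
    simp [h0, len, topSlope]
  · have he' := (len_eq_top_iff q e).2 he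
    have : dom q e ∩ Set.Ici t = Set.Ici t := by
      rw [dom_leg he', Set.inter_eq_right]
      exact Set.Ici_subset_Ici.2 h0.le
    rw [this, finsum_multAt_leg_Ici a q he' h0.le, if_pos h0, hslope]

theorem coord_le_of_ne {e e' : Edge} (he : len q e = ⊤) (hne : e' ≠ e) {s : ℝ} (hs : s ∈ dom q e') :
    coordSign q e * (coord e (pt q e' s) - coord e (base q e)) ≤ 0 := by
  have hs0 := hs.1
  have hmid : e' = .mid → s ≤ |q 2| := by
    rintro rfl; rw [dom_mid] at hs; exact hs.2
  have hleg := (len_eq_top_iff q e).1 he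
  rcases le_or_gt 0 (q 2) with h | h
  · rw [abs_of_nonneg h] at hmid
    cases e <;> cases e' <;>
      simp only [ne_eq, not_true_eq_false, reduceCtorEq, not_false_eq_true, forall_const,
        IsEmpty.forall_iff] at hne hmid hleg <;>
      simp [coord, coordSign, pt, base, dir, vec, v₀, v₁, h, abs_of_nonneg h] <;> linarith
  · rw [abs_of_neg h] at hmid
    cases e <;> cases e' <;>
      simp only [ne_eq, not_true_eq_false, reduceCtorEq, not_false_eq_true, forall_const,
        IsEmpty.forall_iff] at hne hmid hleg <;>
      simp [coord, coordSign, pt, base, dir, vec, v₀, v₁, not_le.2 h, abs_of_neg h] <;> linarith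

/-- A curve is tritangent if and only if it satisfies the parity condition. -/
theorem isTritangent_iff : IsTritangent a q ↔ IsParityGood a q := by
  classical
  rw [isTritangent_iff_even]
  constructor
  · intro heven e t h0 hlt m hm
    have hsum := even_finsum_farSide heven h0 hlt (notMem_curve_iff.2 ⟨m, hm⟩)
    rw [finsum_stableMult] at hsum
    have hfar := finsum_multAt_farSide h0 hlt hm
    set S := {p : ℝ × ℝ | 0 ≤ coordSign q e * (coord e p - coord e (pt q e t))} with hS
    by_cases he : e = .mid
    · subst he
      have hlt' : t < |q 2| := by simpa [len] using hlt
      have huniv : (Finset.univ : Finset Edge) = {.left, .right, .down, .up, .mid} := rfl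
      rw [huniv] at hsum
      simp only [Finset.mem_insert, Finset.mem_singleton, reduceCtorEq, or_self, not_false_eq_true,
        Finset.sum_insert, Finset.sum_singleton] at hsum
      rw [hfar] at hsum
      rcases le_or_gt 0 (q 2) with h | h
      · rw [abs_of_nonneg h] at hlt'
        rw [finsum_multAt_empty (e := .left), finsum_multAt_empty (e := .down),
          finsum_multAt_full (e := .up), finsum_multAt_full (e := .right)] at hsum
        · simp only [topSlope, par, h, if_true, Int.even_iff] at hsum ⊢
          simp only [Int.ModEq]
          omega
        all_goals
          intro s hs
          have hs0 := hs.1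
          simp [hS, coord, coordSign, pt, base, dir, vec, v₀, v₁, h]
          linarith
      · rw [abs_of_neg h] at hlt'
        rw [finsum_multAt_full (e := .left), finsum_multAt_empty (e := .down),
          finsum_multAt_full (e := .up), finsum_multAt_empty (e := .right)] at hsum
        · simp only [topSlope, par, not_le.2 h, if_false, Int.even_iff] at hsum ⊢
          simp only [Int.ModEq]
          omega
        all_goals
          intro s hs
          have hs0 := hs.1
          simp [hS, coord, coordSign, pt, base, dir, vec, v₀, v₁, not_le.2 h]
          linarith
    · have he' := (len_eq_top_iff q e).2 he
      rw [Finset.sum_eq_single e, hfar] at hsum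
      · have := topSlope_modEq_par he'
        simp only [Int.even_iff, Int.ModEq] at hsum this ⊢
        omega
      · intro e' _ hne
        refine finsum_multAt_empty fun s hs hmem => ?_
        have h1 := coord_le_of_ne he' hne hs
        simp only [hS, Set.mem_ofPred_eq] at hmem
        have h2 : coord e (pt q e t) = coord e (base q e) + t * coordSign q e := coord_pt q e t
        rcases coordSign_eq q e with h | h <;> rw [h] at h1 h2 hmem <;> linarith
      · exact fun h => absurd (Finset.mem_univ e) h
  · rintro hgood C ⟨P, -, rfl⟩
    exact even_totalMult hgood P

end

end Tritangent

namespace Tritangent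

/-! ### The set of tritangent curves is closed and semilinear -/

/-- A set is resolvable if it is a union of relatively open cells of some finite arrangement of
rational planes. -/
def IsResolvable (S : Set (Fin 3 → ℝ)) : Prop := ∃ Φ : Finset RatAff, Resolves Φ S

theorem IsResolvable.compl {S : Set (Fin 3 → ℝ)} (h : IsResolvable S) : IsResolvable Sᶜ := by
  obtain ⟨Φ, hΦ⟩ := h
  exact ⟨Φ, fun x y hxy hx hy => hx (hΦ y x hxy.symm hy)⟩

theorem isResolvable_iUnion {ι : Type*} [Finite ι] {S : ι → Set (Fin 3 → ℝ)}
    (h : ∀ i, IsResolvable (S i)) : IsResolvable (⋃ i, S i) := by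
  classical
  have := Fintype.ofFinite ι
  choose Φ hΦ using h
  refine ⟨Finset.univ.biUnion Φ, fun x y hxy hx => ?_⟩
  obtain ⟨i, hi⟩ := Set.mem_iUnion.1 hx
  exact Set.mem_iUnion.2 ⟨i, hΦ i x y
    (fun f hf => hxy f (Finset.mem_biUnion.2 ⟨i, Finset.mem_univ i, hf⟩)) hi⟩

/-- Resolvability may be checked separately on the two half-spaces given by the sign of the third
coordinate. -/
theorem IsResolvable.piecewise {S S₁ S₂ : Set (Fin 3 → ℝ)} (h₁ : IsResolvable S₁)
    (h₂ : IsResolvable S₂) (e₁ : ∀ q, 0 ≤ q 2 → (q ∈ S ↔ q ∈ S₁))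
    (e₂ : ∀ q, q 2 < 0 → (q ∈ S ↔ q ∈ S₂)) : IsResolvable S := by
  classical
  obtain ⟨Φ₁, h₁⟩ := h₁
  obtain ⟨Φ₂, h₂⟩ := h₂
  refine ⟨insert lengthFunctional (Φ₁ ∪ Φ₂), fun x y hxy hx => ?_⟩
  have hs := hxy _ (Finset.mem_insert_self _ _)
  rw [ev_lengthFunctional, ev_lengthFunctional] at hs
  rcases le_or_gt 0 (x 2) with h | h
  · have hy : 0 ≤ y 2 := by rwa [← sign_nonneg_iff, ← hs, sign_nonneg_iff]
    refine (e₁ y hy).2 (h₁ x y (fun f hf => hxy f ?_) ((e₁ x h).1 hx))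
    exact Finset.mem_insert_of_mem (Finset.mem_union_left _ hf)
  · have hy : y 2 < 0 := by rwa [← sign_eq_neg_one_iff, ← hs, sign_eq_neg_one_iff]
    refine (e₂ y hy).2 (h₂ x y (fun f hf => hxy f ?_) ((e₂ x h).1 hx))
    exact Finset.mem_insert_of_mem (Finset.mem_union_right _ hf)

/-- A function is rational affine if it is given by a rational affine functional. -/
def IsRatAff (f : (Fin 3 → ℝ) → ℝ) : Prop := ∃ φ : RatAff, ∀ x, φ.ev x = f x

theorem isRatAff_const (c : ℝ) : IsRatAff fun _ => c :=
  ⟨(0, c), fun x => by simp [RatAff.ev]⟩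

theorem isRatAff_apply (i : Fin 3) : IsRatAff fun x => x i :=
  ⟨(Pi.single i 1, 0), fun x => by fin_cases i <;> simp [RatAff.ev, Fin.sum_univ_three]⟩

theorem IsRatAff.add {f g : (Fin 3 → ℝ) → ℝ} (hf : IsRatAff f) (hg : IsRatAff g) :
    IsRatAff fun x => f x + g x := by
  obtain ⟨φ, hφ⟩ := hf
  obtain ⟨γ, hγ⟩ := hg
  refine ⟨(φ.1 + γ.1, φ.2 + γ.2), fun x => ?_⟩
  simp only [← hφ, ← hγ, RatAff.ev, Fin.sum_univ_three, Pi.add_apply, Rat.cast_add]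
  ring

theorem IsRatAff.const_mul {f : (Fin 3 → ℝ) → ℝ} (hf : IsRatAff f) (c : ℚ) :
    IsRatAff fun x => (c : ℝ) * f x := by
  obtain ⟨φ, hφ⟩ := hf
  refine ⟨(c • φ.1, c * φ.2), fun x => ?_⟩
  simp only [← hφ, RatAff.ev, Fin.sum_univ_three, Pi.smul_apply, smul_eq_mul, Rat.cast_mul]
  ring

theorem IsRatAff.sub {f g : (Fin 3 → ℝ) → ℝ} (hf : IsRatAff f) (hg : IsRatAff g) :
    IsRatAff fun x => f x - g x := by
  have := hf.add (hg.const_mul (-1))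
  simpa [sub_eq_add_neg] using this

/-- Fourier–Motzkin elimination of one variable from a finite system of strict inequalities. -/
theorem exists_forall_pos_iff {ι : Type*} [Finite ι] (f c : ι → ℝ) :
    (∃ t : ℝ, ∀ i, 0 < f i + c i * t) ↔
      (∀ i, c i = 0 → 0 < f i) ∧ ∀ i j, 0 < c i → c j < 0 → 0 < c i * f j - c j * f i := by
  classical
  have := Fintype.ofFinite ι
  constructor
  · rintro ⟨t, ht⟩
    refine ⟨fun i hi => by simpa [hi] using ht i, fun i j hi hj => ?_⟩
    nlinarith [mul_pos hi (ht j), mul_pos (neg_pos.2 hj) (ht i)]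
  · rintro ⟨h0, h⟩
    obtain ⟨t, h1, h2⟩ := Order.exists_between_finsets
      ((Finset.univ.filter fun i => 0 < c i).image fun i => -f i / c i)
      ((Finset.univ.filter fun i => c i < 0).image fun i => -f i / c i) (by
        simp only [Finset.mem_image, Finset.mem_filter, Finset.mem_univ, true_and]
        rintro _ ⟨i, hi, rfl⟩ _ ⟨j, hj, rfl⟩
        rw [div_lt_iff₀ hi, div_mul_eq_mul_div, lt_div_iff_of_neg hj]
        linarith [h i j hi hj])
    refine ⟨t, fun i => ?_⟩
    rcases lt_trichotomy (c i) 0 with hi | hi | hi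
    · have := h2 _ (Finset.mem_image_of_mem _ (Finset.mem_filter.2 ⟨Finset.mem_univ i, hi⟩))
      rw [lt_div_iff_of_neg hi] at this
      linarith
    · simpa [hi] using h0 i hi
    · have := h1 _ (Finset.mem_image_of_mem _ (Finset.mem_filter.2 ⟨Finset.mem_univ i, hi⟩))
      rw [div_lt_iff₀ hi] at this
      linarith

theorem isResolvable_exists_forall_pos {ι : Type*} [Finite ι] {f : ι → (Fin 3 → ℝ) → ℝ}
    (hf : ∀ i, IsRatAff (f i)) (c : ι → ℚ) :
    IsResolvable {q | ∃ t : ℝ, ∀ i, 0 < f i q + c i * t} := by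
  classical
  have := Fintype.ofFinite ι
  choose φ hφ using hf
  have hg : ∀ ij : ι × ι, IsRatAff fun x => c ij.1 * f ij.2 x - c ij.2 * f ij.1 x := fun ij =>
    (IsRatAff.const_mul ⟨_, hφ ij.2⟩ _).sub (IsRatAff.const_mul ⟨_, hφ ij.1⟩ _)
  choose γ hγ using hg
  refine ⟨Finset.univ.image φ ∪ Finset.univ.image γ, fun x y hxy hx => ?_⟩
  simp only [Set.mem_ofPred_eq, exists_forall_pos_iff (fun i => f i _)] at hx ⊢
  refine ⟨fun i hi => ?_, fun i j hi hj => ?_⟩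
  · have h1 := hx.1 i hi
    have h2 := hxy (φ i) (Finset.mem_union_left _ (Finset.mem_image_of_mem _ (Finset.mem_univ i)))
    rw [hφ, hφ, sign_pos h1] at h2
    exact sign_eq_one_iff.1 h2.symm
  · have h1 := hx.2 i j hi hj
    have h2 := hxy (γ (i, j))
      (Finset.mem_union_right _ (Finset.mem_image_of_mem _ (Finset.mem_univ (i, j))))
    rw [hγ, hγ, sign_pos h1] at h2
    exact sign_eq_one_iff.1 h2.symm

section

variable {a : Expo → ℝ}

/-- The condition that the monomial `m` is the only active one at some point of a moving segment or
ray, with base `(b₁, b₂)`, direction `d`, and parameters `t > 0` with `c t < ℓ`. -/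
def singleOn (a : Expo → ℝ) (m : Expo) (d : ℤ × ℤ) (c : ℚ) (b₁ b₂ ℓ : (Fin 3 → ℝ) → ℝ) :
    Set (Fin 3 → ℝ) :=
  {q | ∃ t : ℝ, 0 < t ∧ c * t < ℓ q ∧ active a ((b₁ q, b₂ q) + t • vec d) = {m}}

theorem isOpen_singleOn (m : Expo) (d : ℤ × ℤ) (c : ℚ) {b₁ b₂ ℓ : (Fin 3 → ℝ) → ℝ}
    (h₁ : Continuous b₁) (h₂ : Continuous b₂) (hl : Continuous ℓ) :
    IsOpen (singleOn a m d c b₁ b₂ ℓ) := by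
  have : singleOn a m d c b₁ b₂ ℓ = ⋃ t : ℝ, ⋃ _ : 0 < t, ({q | c * t < ℓ q} ∩
      (fun q => (b₁ q, b₂ q) + t • vec d) ⁻¹' {p | active a p = {m}}) := by
    ext q
    simp only [singleOn, Set.mem_ofPred_eq, Set.mem_iUnion, Set.mem_inter_iff, Set.mem_preimage,
      exists_prop]
  rw [this]
  refine isOpen_iUnion fun t => isOpen_iUnion fun _ => ?_
  refine (isOpen_lt continuous_const hl).inter
    ((isOpen_setOf_active_eq_singleton a m).preimage ?_)
  fun_prop

theorem isResolvable_singleOn (m : Expo) (d : ℤ × ℤ) (c : ℚ) {b₁ b₂ ℓ : (Fin 3 → ℝ) → ℝ}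
    (h₁ : IsRatAff b₁) (h₂ : IsRatAff b₂) (hl : IsRatAff ℓ) :
    IsResolvable (singleOn a m d c b₁ b₂ ℓ) := by
  have hval : ∀ n, IsRatAff fun q => monomialVal a n (b₁ q, b₂ q) := by
    intro n
    have := ((isRatAff_const (a n)).add (h₁.const_mul (n.1 : ℕ))).add (h₂.const_mul (n.2 : ℕ))
    simpa [monomialVal] using this
  have key := isResolvable_exists_forall_pos (ι := Option (Option {n : Expo // n ≠ m}))
    (f := fun i q => match i with
      | none => 0
      | some none => ℓ q
      | some (some n) => monomialVal a m (b₁ q, b₂ q) - monomialVal a n (b₁ q, b₂ q))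
    (by
      rintro (_ | _ | n)
      · exact isRatAff_const 0
      · exact hl
      · exact (hval m).sub (hval n))
    (fun i => match i with
      | none => 1
      | some none => -c
      | some (some n) => pair m d - pair n d)
  convert key using 1
  ext q
  simp only [singleOn, Set.mem_ofPred_eq, active_eq_singleton_iff, monomialVal_add_smul,
    Option.forall, Subtype.forall]
  refine exists_congr fun t => and_congr (by simp) (and_congr ?_ (forall₂_congr fun n _ => ?_))
  · push_cast; constructor <;> intro h <;> linarith
  · push_cast; constructor <;> intro h <;> linarith

/-- The monomial `m` violates the parity condition along `e`. -/
def badAt (a : Expo → ℝ) (e : Edge) (m : Expo) : Set (Fin 3 → ℝ) :=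
  {q | (∃ t : ℝ, 0 < t ∧ (t : EReal) < len q e ∧ active a (pt q e t) = {m}) ∧
    ¬ pair m (dir q e) ≡ par q e [ZMOD 2]}

theorem setOf_isParityGood_eq :
    {q | IsParityGood a q} = (⋃ em : Edge × Expo, badAt a em.1 em.2)ᶜ := by
  ext q
  simp only [IsParityGood, badAt, Set.mem_ofPred_eq, Set.mem_compl_iff, Set.mem_iUnion, not_exists,
    not_and, not_not, Prod.forall]
  constructor
  · rintro h e i j ⟨t, h1, h2, h3⟩
    exact h e t h1 h2 i j h3
  · intro h e t h1 h2 i j h3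
    exact h e i j ⟨t, h1, h2, h3⟩

theorem badAt_leg_iff {e : Edge} (he : e ≠ .mid) {m : Expo} {q : Fin 3 → ℝ}
    {b₁ b₂ : (Fin 3 → ℝ) → ℝ} (hb : base q e = (b₁ q, b₂ q)) :
    q ∈ badAt a e m ↔ q ∈ singleOn a m (dir 0 e) 0 b₁ b₂ (fun _ => 1) ∧
      ¬ pair m (dir 0 e) ≡ par 0 e [ZMOD 2] := by
  have h1 : dir q e = dir 0 e := by cases e <;> first | rfl | exact absurd rfl he
  have h2 : par q e = par 0 e := by cases e <;> first | rfl | exact absurd rfl he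
  have h3 := (len_eq_top_iff q e).2 he
  simp only [badAt, singleOn, Set.mem_ofPred_eq, pt, hb, h1, h2, h3, EReal.coe_lt_top, true_and,
    Rat.cast_zero, zero_mul, zero_lt_one]

theorem badAt_mid_iff {q : Fin 3 → ℝ} {m : Expo} {d : ℤ × ℤ} {r : ℤ} {ℓ : (Fin 3 → ℝ) → ℝ}
    (hd : dir q .mid = d) (hr : par q .mid = r) (hl : |q 2| = ℓ q) :
    q ∈ badAt a .mid m ↔ q ∈ singleOn a m d 1 (· 0) (· 1) ℓ ∧ ¬ pair m d ≡ r [ZMOD 2] := by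
  simp only [badAt, singleOn, Set.mem_ofPred_eq, pt, hd, hr, len, hl, EReal.coe_lt_coe_iff,
    Rat.cast_one, one_mul, base, v₀]

theorem IsResolvable.and_const {S : Set (Fin 3 → ℝ)} (h : IsResolvable S) (p : Prop) :
    IsResolvable {q | q ∈ S ∧ p} := by
  obtain ⟨Φ, hΦ⟩ := h
  exact ⟨Φ, fun x y hxy hx => ⟨hΦ x y hxy hx.1, hx.2⟩⟩

theorem isOpen_and_const {S : Set (Fin 3 → ℝ)} (h : IsOpen S) (p : Prop) :
    IsOpen {q | q ∈ S ∧ p} :=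
  h.inter isOpen_const

theorem isResolvable_badAt (a : Expo → ℝ) (e : Edge) (m : Expo) : IsResolvable (badAt a e m) := by
  have h0 := isRatAff_apply 0
  have h1 := isRatAff_apply 1
  have h2 := isRatAff_apply 2
  have hc := isRatAff_const 1
  by_cases he : e = .mid
  · subst he
    refine IsResolvable.piecewise
      ((isResolvable_singleOn (a := a) m (1, 1) 1 h0 h1 h2).and_const
        (¬ pair m (1, 1) ≡ 0 [ZMOD 2]))
      ((isResolvable_singleOn (a := a) m (-1, 1) 1 h0 h1 ((isRatAff_const 0).sub h2)).and_const
        (¬ pair m (-1, 1) ≡ 1 [ZMOD 2])) (fun q hq => ?_) fun q hq => ?_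
    · exact badAt_mid_iff (by simp [dir, hq]) (by simp [par, hq]) (abs_of_nonneg hq)
    · exact badAt_mid_iff (by simp [dir, not_le.2 hq]) (by simp [par, not_le.2 hq])
        (by rw [abs_of_neg hq]; ring)
  · -- The vertices depend affinely on `q` for each sign of the length.
    have hbase : ∃ b₁ b₂ b₁' b₂' : (Fin 3 → ℝ) → ℝ, IsRatAff b₁ ∧ IsRatAff b₂ ∧ IsRatAff b₁' ∧
        IsRatAff b₂' ∧ (∀ q, 0 ≤ q 2 → base q e = (b₁ q, b₂ q)) ∧
        ∀ q, q 2 < 0 → base q e = (b₁' q, b₂' q) := by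
      cases e
      · refine ⟨_, _, _, _, h0, h1, h0.add h2, h1.sub h2, fun q hq => ?_, fun q hq => ?_⟩
        · simp [base, hq, v₀]
        · simp [base, not_le.2 hq, v₁, abs_of_neg hq, sub_eq_add_neg]
      · refine ⟨_, _, _, _, h0.add h2, h1.add h2, h0, h1, fun q hq => ?_, fun q hq => ?_⟩
        · simp [base, hq, v₁, abs_of_nonneg hq]
        · simp [base, not_le.2 hq, v₀]
      · exact ⟨_, _, _, _, h0, h1, h0, h1, fun q _ => rfl, fun q _ => rfl⟩
      · refine ⟨_, _, _, _, h0.add h2, h1.add h2, h0.add h2, h1.sub h2, fun q hq => ?_,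
          fun q hq => ?_⟩
        · simp [base, v₁, abs_of_nonneg hq]
        · simp [base, v₁, abs_of_neg hq, sub_eq_add_neg]
      · exact absurd rfl he
    obtain ⟨b₁, b₂, b₁', b₂', g1, g2, g3, g4, hb, hb'⟩ := hbase
    exact IsResolvable.piecewise ((isResolvable_singleOn m _ 0 g1 g2 hc).and_const _)
      ((isResolvable_singleOn m _ 0 g3 g4 hc).and_const _)
      (fun q hq => badAt_leg_iff he (hb q hq)) fun q hq => badAt_leg_iff he (hb' q hq)

theorem continuous_base (e : Edge) : Continuous fun q => base q e := by
  have h0 : Continuous v₀ := by unfold v₀; fun_prop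
  have h1 : Continuous v₁ := by unfold v₁; fun_prop
  have h01 : ∀ q : Fin 3 → ℝ, 0 = q 2 → v₀ q = v₁ q := by
    intro q hq
    simp [v₀, v₁, ← hq]
  cases e
  · exact Continuous.if_le h0 h1 continuous_const (continuous_apply 2) h01
  · exact Continuous.if_le h1 h0 continuous_const (continuous_apply 2) fun q hq => (h01 q hq).symm
  · exact h0
  · exact h1
  · exact h0

theorem isOpen_badAt (a : Expo → ℝ) (e : Edge) (m : Expo) : IsOpen (badAt a e m) := by
  by_cases he : e = .mid
  · subst he
    have hne : ∀ q ∈ badAt a .mid m, q 2 ≠ 0 := by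
      rintro q ⟨⟨t, ht, ht', -⟩, -⟩ h
      simp only [len, h, abs_zero, EReal.coe_lt_coe_iff] at ht'
      exact absurd ht (not_lt.2 ht'.le)
    have : badAt a .mid m =
        ({q | 0 < q 2} ∩ {q | q ∈ singleOn a m (1, 1) 1 (· 0) (· 1) (· 2) ∧
          ¬ pair m (1, 1) ≡ 0 [ZMOD 2]}) ∪
        ({q | q 2 < 0} ∩ {q | q ∈ singleOn a m (-1, 1) 1 (· 0) (· 1) (fun q => -q 2) ∧
          ¬ pair m (-1, 1) ≡ 1 [ZMOD 2]}) := by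
      ext q
      rcases lt_trichotomy (q 2) 0 with h | h | h
      · have := badAt_mid_iff (a := a) (q := q) (m := m) (d := (-1, 1)) (r := 1)
          (ℓ := fun q => -q 2) (by simp [dir, not_le.2 h]) (by simp [par, not_le.2 h])
          (abs_of_neg h)
        simp [this, h, h.not_gt]
      · simp only [Set.mem_union, Set.mem_inter_iff, Set.mem_ofPred_eq, h, lt_irrefl, false_and,
          or_false, iff_false]
        exact fun hq => hne q hq h
      · have := badAt_mid_iff (a := a) (q := q) (m := m) (d := (1, 1)) (r := 0)
          (ℓ := (· 2)) (by simp [dir, h.le]) (by simp [par, h.le]) (abs_of_pos h)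
        simp [this, h, h.not_gt]
    rw [this]
    refine IsOpen.union (IsOpen.inter (isOpen_lt (by fun_prop) (by fun_prop)) ?_)
      (IsOpen.inter (isOpen_lt (by fun_prop) (by fun_prop)) ?_)
    · exact isOpen_and_const (isOpen_singleOn m _ _ (by fun_prop) (by fun_prop) (by fun_prop)) _
    · exact isOpen_and_const (isOpen_singleOn m _ _ (by fun_prop) (by fun_prop) (by fun_prop)) _
  · have : badAt a e m = {q | q ∈ singleOn a m (dir 0 e) 0 (fun q => (base q e).1)
        (fun q => (base q e).2) (fun _ => 1) ∧ ¬ pair m (dir 0 e) ≡ par 0 e [ZMOD 2]} :=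
      Set.ext fun q => badAt_leg_iff he rfl
    rw [this]
    exact isOpen_and_const (isOpen_singleOn m _ _ (continuous_base e).fst (continuous_base e).snd
      continuous_const) _

theorem setOf_isTritangent_eq :
    {q | IsTritangent a q} = (⋃ em : Edge × Expo, badAt a em.1 em.2)ᶜ := by
  rw [← setOf_isParityGood_eq]
  exact Set.ext fun q => isTritangent_iff

theorem isClosed_setOf_isTritangent (a : Expo → ℝ) : IsClosed {q | IsTritangent a q} := by
  rw [setOf_isTritangent_eq]
  exact (isOpen_iUnion fun em : Edge × Expo => isOpen_badAt a em.1 em.2).isClosed_compl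

theorem isResolvable_setOf_isTritangent (a : Expo → ℝ) : IsResolvable {q | IsTritangent a q} := by
  rw [setOf_isTritangent_eq]
  exact (isResolvable_iUnion fun em : Edge × Expo => isResolvable_badAt a em.1 em.2).compl

end

end Tritangent

namespace Tritangent

/-! ### Sets without a coarsest polyhedral structure -/

/-- The functional with the linear part of `f`, vanishing at the origin. -/
noncomputable def RatAff.lin (f : RatAff) (x : Fin 3 → ℝ) : ℝ := ∑ j, (f.1 j : ℝ) * x j

theorem RatAff.ev_add_smul (f : RatAff) (x y : Fin 3 → ℝ) (t : ℝ) :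
    f.ev (x + t • y) = f.ev x + t * f.lin y := by
  simp only [RatAff.ev, RatAff.lin, Fin.sum_univ_three, Pi.add_apply, Pi.smul_apply, smul_eq_mul]
  ring

/-- A vector with rational coordinates, as a vector of `ℝ³`. -/
def ratVec (v : Fin 3 → ℚ) : Fin 3 → ℝ := fun i => v i

/-- The piecewise affine tent over the `ℓ¹`-ball of radius `r` about `p`. -/
noncomputable def tent (p : Fin 3 → ℝ) (r : ℝ) (x : Fin 3 → ℝ) : ℝ := max 0 (r - ∑ i, |x i - p i|)

/-- The piecewise affine map that shifts each point in direction `d` by its value under the tent. -/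
noncomputable def tentShift (p : Fin 3 → ℝ) (r : ℝ) (d : Fin 3 → ℚ) (x : Fin 3 → ℝ) : Fin 3 → ℝ :=
  x + tent p r x • ratVec d

section tent

variable {p : Fin 3 → ℝ} {r : ℝ} {d : Fin 3 → ℚ}

theorem continuous_tent : Continuous (tent p r) := by
  unfold tent; fun_prop

theorem abs_tent_sub_le (x y : Fin 3 → ℝ) : |tent p r x - tent p r y| ≤ ∑ i, |x i - y i| := by
  refine (abs_max_sub_max_le_max _ _ _ _).trans ?_
  rw [sub_self, abs_zero, max_le_iff]
  refine ⟨Finset.sum_nonneg fun i _ => abs_nonneg _, ?_⟩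
  rw [sub_sub_sub_cancel_left, ← Finset.sum_sub_distrib]
  refine (Finset.abs_sum_le_sum_abs _ _).trans (Finset.sum_le_sum fun i _ => ?_)
  refine (abs_abs_sub_abs_le_abs_sub _ _).trans (le_of_eq ?_)
  rw [abs_sub_comm]
  congr 1
  ring

theorem tentShift_injective (hd : ∑ i, |d i| < 1) : Function.Injective (tentShift p r d) := by
  intro x y h
  have hd' : ∑ i, |(d i : ℝ)| < 1 := by exact_mod_cast hd
  have hxy : ∀ i, x i - y i = (tent p r y - tent p r x) * d i := by
    intro i
    have := congrFun h i
    simp only [tentShift, ratVec, Pi.add_apply, Pi.smul_apply, smul_eq_mul] at this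
    linarith
  have h1 : ∑ i, |x i - y i| = |tent p r y - tent p r x| * ∑ i, |(d i : ℝ)| := by
    rw [Finset.mul_sum]
    exact Finset.sum_congr rfl fun i _ => by rw [hxy, abs_mul]
  have h2 := abs_tent_sub_le (p := p) (r := r) x y
  rw [abs_sub_comm] at h2
  have h3 : |tent p r y - tent p r x| = 0 := by
    nlinarith [abs_nonneg (tent p r y - tent p r x)]
  have h4 : tent p r y - tent p r x = 0 := abs_eq_zero.1 h3
  ext i
  have := hxy i
  rw [h4, zero_mul] at this
  linarith

/-- Each point is the image of a point from which it is reached by a shift of at most `r`. -/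
theorem exists_tentShift_eq (hr : 0 < r) (y : Fin 3 → ℝ) :
    ∃ τ ∈ Set.Icc 0 r, tent p r (y - τ • ratVec d) = τ ∧
      tentShift p r d (y - τ • ratVec d) = y := by
  have hcont : ContinuousOn (fun τ : ℝ => τ - tent p r (y - τ • ratVec d)) (Set.Icc 0 r) := by
    have : Continuous fun τ : ℝ => τ - tent p r (y - τ • ratVec d) :=
      continuous_id.sub (continuous_tent.comp (by fun_prop))
    exact this.continuousOn
  have h0 : (0 : ℝ) ∈ Set.Icc (0 - tent p r (y - (0 : ℝ) • ratVec d))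
      (r - tent p r (y - r • ratVec d)) := by
    constructor
    · have : 0 ≤ tent p r (y - (0 : ℝ) • ratVec d) := le_max_left _ _
      linarith
    · have : tent p r (y - r • ratVec d) ≤ r :=
        max_le hr.le (sub_le_self _ (Finset.sum_nonneg fun i _ => abs_nonneg _))
      linarith
  obtain ⟨τ, hτ, h⟩ := intermediate_value_Icc hr.le hcont h0
  have h' : tent p r (y - τ • ratVec d) = τ := by
    simp only at h
    linarith
  exact ⟨τ, hτ, h', by rw [tentShift, h', sub_add_cancel]⟩

theorem isRatAut_shear (c d : Fin 3 → ℚ) (κ : ℝ) (h : 1 + ∑ i, c i * d i ≠ 0) :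
    IsRatAut fun y => y + (κ + ∑ j, (c j : ℝ) * y j) • ratVec d := by
  refine ⟨Matrix.of fun i j => (if i = j then 1 else 0) + d i * c j, fun i => κ * d i, ?_, ?_⟩
  · rw [Matrix.det_fin_three]
    rw [Fin.sum_univ_three] at h
    simp only [Matrix.of_apply]
    norm_num [Fin.ext_iff]
    intro h'
    exact h (by linarith)
  · intro x i
    simp only [Matrix.of_apply, Fin.sum_univ_three, Pi.add_apply, Pi.smul_apply, smul_eq_mul,
      ratVec]
    fin_cases i <;> simp <;> ring

/-- The functionals `x i - p i`. -/
noncomputable def coordFunctional (p : Fin 3 → ℝ) (i : Fin 3) : RatAff := (Pi.single i 1, -p i)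

theorem ev_coordFunctional (i : Fin 3) (x : Fin 3 → ℝ) :
    (coordFunctional p i).ev x = x i - p i := by
  fin_cases i <;> simp [coordFunctional, RatAff.ev, Fin.sum_univ_three, sub_eq_add_neg]

/-- The sign `1` or `-1` encoded by a Boolean. -/
def boolSign (b : Bool) : ℚ := if b then 1 else -1

/-- The affine functions which bound the tent on the orthants about `p`. -/
noncomputable def slabFunctional (p : Fin 3 → ℝ) (r : ℝ) (σ : Fin 3 → Bool) : RatAff :=
  (fun i => -boolSign (σ i), r + ∑ i, (boolSign (σ i) : ℝ) * p i)

theorem ev_slabFunctional (σ : Fin 3 → Bool) (x : Fin 3 → ℝ) :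
    (slabFunctional p r σ).ev x = r - ∑ i, (boolSign (σ i) : ℝ) * (x i - p i) := by
  simp only [slabFunctional, RatAff.ev, Fin.sum_univ_three]
  push_cast
  ring

open Classical in
/-- The functionals at whose zeros the tent may fail to be affine. -/
noncomputable def tentBreaks (p : Fin 3 → ℝ) (r : ℝ) : Finset RatAff :=
  Finset.univ.image (coordFunctional p) ∪ Finset.univ.image (slabFunctional p r)

/-- On each cell of an arrangement containing the break planes of the tent, the shift is an affine
automorphism which moves all points in direction `d`. -/
theorem exists_shear_eqOn (hd : ∑ i, |d i| < 1) {Φ : Finset RatAff} (hΦ : tentBreaks p r ⊆ Φ)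
    (x : Fin 3 → ℝ) : ∃ (c : Fin 3 → ℚ) (κ : ℝ),
      IsRatAut (fun y => y + (κ + ∑ j, (c j : ℝ) * y j) • ratVec d) ∧
      Set.EqOn (tentShift p r d) (fun y => y + (κ + ∑ j, (c j : ℝ) * y j) • ratVec d)
        (closedCell Φ x) := by
  classical
  let σ : Fin 3 → Bool := fun i => decide (0 ≤ x i - p i)
  have hcoord : ∀ y ∈ closedCell Φ x, ∀ i, |y i - p i| = boolSign (σ i) * (y i - p i) := by
    intro y hy i
    have hmem : coordFunctional p i ∈ Φ :=
      hΦ (Finset.mem_union_left _ (Finset.mem_image_of_mem _ (Finset.mem_univ i)))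
    obtain ⟨h1, h2⟩ := hy _ hmem
    rw [ev_coordFunctional, ev_coordFunctional] at h1 h2
    by_cases h : 0 ≤ x i - p i
    · have hσ : boolSign (σ i) = 1 := by simp only [σ, h, boolSign, decide_true, if_true]
      rw [hσ, abs_of_nonneg (h2 h), Rat.cast_one, one_mul]
    · have hσ : boolSign (σ i) = -1 := by
        simp only [σ, h, boolSign, decide_false, Bool.false_eq_true, if_false]
      rw [hσ, abs_of_nonpos (h1 (not_le.1 h).le), Rat.cast_neg, Rat.cast_one, neg_one_mul]
  have hslab : ∀ y ∈ closedCell Φ x, ∑ i, |y i - p i| = r - (slabFunctional p r σ).ev y := by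
    intro y hy
    rw [ev_slabFunctional, sub_sub_cancel]
    exact Finset.sum_congr rfl fun i _ => hcoord y hy i
  have hmem : slabFunctional p r σ ∈ Φ :=
    hΦ (Finset.mem_union_right _ (Finset.mem_image_of_mem _ (Finset.mem_univ σ)))
  rcases le_total 0 ((slabFunctional p r σ).ev x) with h | h
  · refine ⟨(slabFunctional p r σ).1, (slabFunctional p r σ).2, isRatAut_shear _ _ _ ?_, ?_⟩
    · have hle : -∑ i, |d i| ≤ ∑ i, (slabFunctional p r σ).1 i * d i := by
        rw [← Finset.sum_neg_distrib]
        refine Finset.sum_le_sum fun i _ => ?_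
        have : |(slabFunctional p r σ).1 i * d i| = |d i| := by
          simp only [slabFunctional, boolSign]
          split_ifs <;> simp
        rw [← this]
        exact neg_abs_le _
      linarith
    · intro y hy
      have h0 := (hy _ hmem).2 h
      simp only [tentShift, tent, hslab y hy, sub_sub_cancel, max_eq_right h0]
      rw [add_comm ((slabFunctional p r σ).2)]
      rfl
  · refine ⟨0, 0, isRatAut_shear _ _ _ (by simp), ?_⟩
    intro y hy
    have h0 := (hy _ hmem).1 h
    simp only [tentShift, tent, hslab y hy, sub_sub_cancel, max_eq_left h0]
    simp

end tent

section plane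

variable {Ω H N : Set (Fin 3 → ℝ)} {v w : Fin 3 → ℚ}

/-- Points of the cells of the arrangement that lie on none of the planes of the arrangement,
except for those containing `H`, are interior relative to `H`. -/
theorem exists_open_inter_subset_closedCell
    (hH : ∀ x ∈ H, ∀ y, y ∈ H ↔ ∃ α β : ℝ, y = x + α • ratVec v + β • ratVec w)
    {Φ : Finset RatAff} {x : Fin 3 → ℝ} (hx : x ∈ H)
    (hgen : ∀ f ∈ Φ, f.ev x = 0 → f.lin (ratVec v) = 0 ∧ f.lin (ratVec w) = 0) :
    ∃ W, IsOpen W ∧ x ∈ W ∧ W ∩ H ⊆ closedCell Φ x := by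
  have hev : ∀ f ∈ Φ, ∀ᶠ y in 𝓝 x, y ∈ H →
      (f.ev x ≤ 0 → f.ev y ≤ 0) ∧ (0 ≤ f.ev x → 0 ≤ f.ev y) := by
    intro f hf
    rcases lt_trichotomy (f.ev x) 0 with h | h | h
    · filter_upwards [(f.continuous_ev.tendsto x).eventually_lt_const h] with y hy _
      exact ⟨fun _ => hy.le, fun h' => absurd h (not_lt.2 h')⟩
    · refine Eventually.of_forall fun y hy => ?_
      obtain ⟨α, β, rfl⟩ := (hH x hx y).1 hy
      obtain ⟨h1, h2⟩ := hgen f hf h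
      rw [f.ev_add_smul, f.ev_add_smul, h1, h2, h]
      simp
    · filter_upwards [(f.continuous_ev.tendsto x).eventually_const_lt h] with y hy _
      exact ⟨fun h' => absurd h (not_lt.2 h'), fun _ => hy.le⟩
  obtain ⟨W, hW, hWo, hxW⟩ := eventually_nhds_iff.1 ((eventually_all_finset Φ).2 hev)
  exact ⟨W, hWo, hxW, fun y hy f hf => hW y hy.1 f hf hy.2⟩

/-- If `Ω` agrees near `p` with a rational plane `H`, then it has a rational polyhedral structure in
which `p` is a relative interior point of a cell of `H`: apply to any structure a small piecewise
affine automorphism of `Ω` that moves a generic point to `p`. -/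
theorem exists_structure_with_interior_point (hΩ : IsClosed Ω) (hres : IsResolvable Ω)
    (hH : ∀ x ∈ H, ∀ y, y ∈ H ↔ ∃ α β : ℝ, y = x + α • ratVec v + β • ratVec w)
    (hN : IsOpen N) (hΩN : Ω ∩ N = H ∩ N) {p : Fin 3 → ℝ} (hp : p ∈ H ∩ N) :
    ∃ K ∈ rationalPolyhedralStructures Ω, ∃ P ∈ K, ∃ W, IsOpen W ∧ p ∈ W ∧ W ∩ H ⊆ P := by
  classical
  obtain ⟨Φ₀, hΦ₀⟩ := hres
  -- An `ℓ¹`-ball in `N`.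
  obtain ⟨r, hr, hball⟩ : ∃ r : ℝ, 0 < r ∧ ∀ x, ∑ i, |x i - p i| < r → x ∈ N := by
    obtain ⟨r, hr, h⟩ := Metric.isOpen_iff.1 hN p hp.2
    refine ⟨r, hr, fun x hx => h ?_⟩
    rw [Metric.mem_ball, dist_pi_lt_iff hr]
    intro i
    rw [Real.dist_eq]
    exact (Finset.single_le_sum (f := fun i => |x i - p i|) (fun i _ => abs_nonneg _)
      (Finset.mem_univ i)).trans_lt hx
  set Φ := Φ₀ ∪ tentBreaks p r with hΦ
  have hresΦ : Resolves Φ Ω := hΦ₀.mono Finset.subset_union_left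
  -- A rational direction in `H` transversal to all planes through `p` not containing `H`.
  obtain ⟨k, hk⟩ : ∃ k : ℕ, ∀ f ∈ Φ, f.lin (ratVec v) + k * f.lin (ratVec w) = 0 →
      f.lin (ratVec v) = 0 ∧ f.lin (ratVec w) = 0 := by
    have hev : ∀ f ∈ Φ, ∀ᶠ k : ℕ in atTop, f.lin (ratVec v) + k * f.lin (ratVec w) = 0 →
        f.lin (ratVec v) = 0 ∧ f.lin (ratVec w) = 0 := by
      intro f _
      by_cases hw : f.lin (ratVec w) = 0
      · exact Eventually.of_forall fun k h => ⟨by simpa [hw] using h, hw⟩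
      · obtain ⟨n, hn⟩ := exists_nat_gt (-f.lin (ratVec v) / f.lin (ratVec w))
        filter_upwards [eventually_ge_atTop n] with k hk h
        exfalso
        have h1 : (k : ℝ) = -f.lin (ratVec v) / f.lin (ratVec w) := by
          rw [eq_div_iff hw]; linarith
        have h2 : (n : ℝ) ≤ k := by exact_mod_cast hk
        linarith
    exact ((eventually_all_finset Φ).2 hev).exists
  set z : Fin 3 → ℚ := fun i => v i + k * w i with hz
  have hzvec : ratVec z = ratVec v + (k : ℝ) • ratVec w := by
    ext i; simp [ratVec, hz]
  have hlinz : ∀ f : RatAff, f.lin (ratVec z) = f.lin (ratVec v) + k * f.lin (ratVec w) := by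
    intro f
    simp only [hzvec, RatAff.lin, Fin.sum_univ_three, Pi.add_apply, Pi.smul_apply, smul_eq_mul]
    ring
  have hHz : ∀ x ∈ H, ∀ t : ℝ, x + t • ratVec z ∈ H := by
    intro x hx t
    refine (hH x hx _).2 ⟨t, t * k, ?_⟩
    rw [hzvec]; module
  -- The size of the shift.
  obtain ⟨ε, hε, hε1, hεΦ⟩ : ∃ ε : ℚ, 0 < ε ∧ ∑ i, |ε * z i| < 1 ∧
      ∀ f ∈ Φ, f.ev p ≠ 0 → ε * (r * |f.lin (ratVec z)|) < |f.ev p| := by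
    have hlim : Tendsto (fun n : ℕ => (((1 : ℚ) / (n + 1) : ℚ) : ℝ)) atTop (𝓝 0) := by
      push_cast
      exact tendsto_one_div_add_atTop_nhds_zero_nat
    have e1 : ∀ᶠ n : ℕ in atTop,
        (((1 : ℚ) / (n + 1) : ℚ) : ℝ) * ∑ i, |(z i : ℝ)| < 1 := by
      have := hlim.mul_const (∑ i, |(z i : ℝ)|)
      rw [zero_mul] at this
      exact this.eventually_lt_const one_pos
    have e2 : ∀ f ∈ Φ, ∀ᶠ n : ℕ in atTop, f.ev p ≠ 0 →
        (((1 : ℚ) / (n + 1) : ℚ) : ℝ) * (r * |f.lin (ratVec z)|) < |f.ev p| := by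
      intro f _
      by_cases h : f.ev p = 0
      · exact Eventually.of_forall fun n h' => absurd h h'
      · have := hlim.mul_const (r * |f.lin (ratVec z)|)
        rw [zero_mul] at this
        filter_upwards [this.eventually_lt_const (abs_pos.2 h)] with n hn _ using hn
    obtain ⟨n, hn1, hn2⟩ := (e1.and ((eventually_all_finset Φ).2 e2)).exists
    have hpos : (0 : ℚ) < 1 / (n + 1) := by positivity
    refine ⟨1 / (n + 1), hpos, ?_, hn2⟩
    simp only [abs_mul, abs_of_pos hpos, ← Finset.mul_sum]
    exact_mod_cast hn1
  set d : Fin 3 → ℚ := fun i => ε * z i with hd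
  have hdvec : ratVec d = (ε : ℝ) • ratVec z := by
    ext i; simp [ratVec, hd]
  have hHd : ∀ x ∈ H, ∀ t : ℝ, x + t • ratVec d ∈ H := by
    intro x hx t
    rw [hdvec, smul_smul]
    exact hHz x hx _
  -- The shift preserves `Ω`.
  have htent : ∀ x, 0 < tent p r x → x ∈ N := by
    intro x hx
    refine hball x ?_
    rcases lt_max_iff.1 hx with h | h
    · exact absurd h (lt_irrefl _)
    · linarith
  have hshiftN : ∀ x, 0 < tent p r x → tentShift p r d x ∈ N := by
    intro x hx
    have hpos : 0 < r - ∑ i, |x i - p i| := by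
      rcases lt_max_iff.1 hx with h | h
      · exact absurd h (lt_irrefl _)
      · exact h
    have heq : tent p r x = r - ∑ i, |x i - p i| := max_eq_right hpos.le
    refine hball _ ?_
    have hd1 : ∑ i, |(d i : ℝ)| < 1 := by exact_mod_cast hε1
    have hle : ∑ i, |tentShift p r d x i - p i| ≤
        ∑ i, |x i - p i| + tent p r x * ∑ i, |(d i : ℝ)| := by
      rw [Finset.mul_sum, ← Finset.sum_add_distrib]
      refine Finset.sum_le_sum fun i _ => ?_
      have : tentShift p r d x i - p i = (x i - p i) + tent p r x * d i := by
        simp only [tentShift, ratVec, Pi.add_apply, Pi.smul_apply, smul_eq_mul]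
        ring
      rw [this]
      refine (abs_add_le _ _).trans (le_of_eq ?_)
      rw [abs_mul, abs_of_pos hx]
    nlinarith
  have hmem : ∀ x ∈ N, (x ∈ Ω ↔ x ∈ H) := by
    intro x hx
    have := Set.ext_iff.1 hΩN x
    simpa [hx] using this
  have himage : tentShift p r d '' Ω = Ω := by
    refine Set.Subset.antisymm ?_ fun y hy => ?_
    · rintro _ ⟨x, hx, rfl⟩
      have h0 : 0 ≤ tent p r x := le_max_left _ _
      rcases h0.eq_or_lt with h | h
      · rw [tentShift, ← h, zero_smul, add_zero]
        exact hx
      · refine (hmem _ (hshiftN x h)).2 (hHd x ((hmem x (htent x h)).1 hx) _)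
    · obtain ⟨τ, hτ, h1, h2⟩ := exists_tentShift_eq (p := p) (d := d) hr y
      refine ⟨_, ?_, h2⟩
      rcases hτ.1.eq_or_lt with h | h
      · rwa [← h, zero_smul, sub_zero]
      · have hN1 := htent (y - τ • ratVec d) (h1.symm ▸ h)
        have hN2 := hshiftN (y - τ • ratVec d) (h1.symm ▸ h)
        rw [h2] at hN2
        rw [hmem _ hN1, sub_eq_add_neg, ← neg_smul]
        exact hHd y ((hmem y hN2).1 hy) _
  -- The point moved to `p` is generic.
  obtain ⟨τ, hτ, h1, h2⟩ := exists_tentShift_eq (p := p) (d := d) hr p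
  set x := p - τ • ratVec d with hx
  have hτ0 : 0 < τ := by
    refine lt_of_le_of_ne hτ.1 fun h => ?_
    rw [hx, ← h, zero_smul, sub_zero, tent] at h1
    simp only [sub_self, abs_zero, Finset.sum_const_zero, sub_zero] at h1
    exact hr.not_ge ((le_max_right 0 r).trans h1.le)
  have hxp : x = p + (-(τ * ε)) • ratVec z := by
    rw [hx, hdvec]; module
  have hxH : x ∈ H := by rw [hxp]; exact hHz p hp.1 _
  have hxN : x ∈ N := htent x (h1.symm ▸ hτ0)
  have hε' : (0 : ℝ) < ε := by exact_mod_cast hε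
  have hgen : ∀ f ∈ Φ, f.ev x = 0 → f.lin (ratVec v) = 0 ∧ f.lin (ratVec w) = 0 := by
    intro f hf h
    rw [hxp, f.ev_add_smul] at h
    by_cases hfp : f.ev p = 0
    · refine hk f hf ?_
      rw [hfp, zero_add, hlinz] at h
      exact (mul_eq_zero.1 h).resolve_left (neg_ne_zero.2 (mul_pos hτ0 hε').ne')
    · exfalso
      have h3 := hεΦ f hf hfp
      have h4 : |f.ev p| = τ * ε * |f.lin (ratVec z)| := by
        have : f.ev p = (τ * ε) * f.lin (ratVec z) := by linarith
        rw [this, abs_mul, abs_of_pos (mul_pos hτ0 hε')]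
      rw [h4] at h3
      have h5 : τ * (ε * |f.lin (ratVec z)|) ≤ r * (ε * |f.lin (ratVec z)|) :=
        mul_le_mul_of_nonneg_right hτ.2 (by positivity)
      nlinarith
  obtain ⟨W, hW, hxW, hWH⟩ := exists_open_inter_subset_closedCell hH hxH hgen
  obtain ⟨c, κ, hg, hEq⟩ := exists_shear_eqOn (p := p) (r := r) hε1
    (Finset.subset_union_right : tentBreaks p r ⊆ Φ) x
  have hK := image_mem_rationalPolyhedralStructures
    (closedCell_image_mem_rationalPolyhedralStructures hΩ hresΦ)
    (tentShift_injective (p := p) (r := r) hε1) (by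
      rintro _ ⟨y, -, rfl⟩
      obtain ⟨c, κ, h⟩ := exists_shear_eqOn (p := p) (r := r) hε1
        (Finset.subset_union_right : tentBreaks p r ⊆ Φ) y
      exact ⟨_, h⟩)
  rw [himage] at hK
  refine ⟨_, hK, _, ⟨_, ⟨x, (hmem x hxN).2 hxH, rfl⟩, rfl⟩, ?_⟩
  -- Near `p`, the shift is inverted by an affine map that preserves `H`.
  obtain ⟨L, b, -, hL, -⟩ := hg.exists_inverse
  have hLinv : ∀ y, L (L.symm (y - b)) + b = y := fun y => by simp
  refine ⟨(fun y => L.symm (y - b)) ⁻¹' W, hW.preimage (by fun_prop), ?_, ?_⟩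
  · have : L.symm (p - b) = x := by
      rw [ContinuousLinearEquiv.symm_apply_eq, sub_eq_iff_eq_add, ← hL]
      exact h2.symm.trans (hEq (self_mem_closedCell Φ x))
    rw [Set.mem_preimage, this]
    exact hxW
  · rintro y ⟨hyW, hyH⟩
    have hgy := hL (L.symm (y - b))
    rw [hLinv] at hgy
    have hmemH : L.symm (y - b) ∈ H := by
      have h6 : L.symm (y - b) = y + (-(κ + ∑ j, (c j : ℝ) * L.symm (y - b) j)) • ratVec d := by
        rw [neg_smul, ← sub_eq_add_neg, eq_sub_iff_add_eq]
        exact hgy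
      rw [h6]
      exact hHd y hyH _
    have hcell := hWH ⟨hyW, hmemH⟩
    exact ⟨L.symm (y - b), hcell, (hEq hcell).trans hgy⟩

theorem IsPolyhedron.convex {P : Set (Fin 3 → ℝ)} (hP : IsPolyhedron P) : Convex ℝ P := by
  obtain ⟨k, A, b, rfl⟩ := hP
  intro x hx y hy s t hs ht hst i
  simp only [Fin.sum_univ_three, Pi.add_apply, Pi.smul_apply, smul_eq_mul]
  have h1 := hx i
  have h2 := hy i
  simp only [Fin.sum_univ_three] at h1 h2
  have : b i = s * b i + t * b i := by rw [← add_mul, hst, one_mul]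
  nlinarith [mul_le_mul_of_nonneg_left h1 hs, mul_le_mul_of_nonneg_left h2 ht]

/-- If `Ω` agrees on an open set `N` with a rational plane `H`, then any polyhedral structure on `Ω`
which is refined by all rational ones has a cell containing the part of `Ω` in `N`, provided that
this part is connected. -/
theorem exists_cell_superset (hΩ : IsClosed Ω) (hres : IsResolvable Ω)
    (hH : ∀ x ∈ H, ∀ y, y ∈ H ↔ ∃ α β : ℝ, y = x + α • ratVec v + β • ratVec w)
    (hN : IsOpen N) (hΩN : Ω ∩ N = H ∩ N) (hconn : IsConnected (H ∩ N))
    {K₀ : Set (Set (Fin 3 → ℝ))} (hK₀ : K₀ ∈ polyhedralStructures Ω)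
    (hcoarse : ∀ K ∈ rationalPolyhedralStructures Ω, ∀ P ∈ K, ∃ Q ∈ K₀, P ⊆ Q) :
    ∃ Q ∈ K₀, H ∩ N ⊆ Q := by
  obtain ⟨hC, hU⟩ := hK₀
  have hsub : ∀ Q ∈ K₀, Q ⊆ Ω := fun Q hQ => hU ▸ Set.subset_sUnion_of_mem hQ
  have hHline : ∀ x ∈ H, ∀ y ∈ H, ∀ t : ℝ, x + t • (y - x) ∈ H := by
    intro x hx y hy t
    obtain ⟨α, β, rfl⟩ := (hH x hx y).1 hy
    exact (hH x hx _).2 ⟨t * α, t * β, by module⟩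
  -- Cells meeting `N` lie in `H`.
  have hcellH : ∀ Q ∈ K₀, ∀ p ∈ Q, p ∈ N → Q ⊆ H := by
    intro Q hQ p hpQ hpN y hy
    have hpH : p ∈ H := (hΩN ▸ (⟨hsub Q hQ hpQ, hpN⟩ : p ∈ Ω ∩ N) : p ∈ H ∩ N).1
    have hlim : Tendsto (fun t : ℝ => p + t • (y - p)) (𝓝[>] 0) (𝓝 p) := by
      have : Continuous fun t : ℝ => p + t • (y - p) := by fun_prop
      simpa using (this.tendsto 0).mono_left (nhdsWithin_le_nhds (s := Set.Ioi 0))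
    obtain ⟨t, ht, ht01⟩ := ((hlim.eventually (hN.mem_nhds hpN)).and
      (Ioo_mem_nhdsGT (zero_lt_one' ℝ))).exists
    have htQ : p + t • (y - p) ∈ Q :=
      (hC.polyhedron Q hQ).convex.add_smul_sub_mem hpQ hy ⟨ht01.1.le, ht01.2.le⟩
    have htH : p + t • (y - p) ∈ H :=
      (hΩN ▸ (⟨hsub Q hQ htQ, ht⟩ : _ ∈ Ω ∩ N) : _ ∈ H ∩ N).1
    have := hHline p hpH _ htH t⁻¹
    rwa [add_sub_cancel_left, smul_smul, inv_mul_cancel₀ ht01.1.ne', one_smul,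
      add_sub_cancel] at this
  -- Cells with a common relative interior point coincide.
  have hle : ∀ Q ∈ K₀, ∀ Q' ∈ K₀, ∀ p ∈ H ∩ N, ∀ W, IsOpen W → p ∈ W → W ∩ H ⊆ Q ∩ Q' →
      Q ⊆ Q' := by
    intro Q hQ Q' hQ' p hp W hW hpW hWH y hy
    have hpQ := hWH ⟨hpW, hp.1⟩
    have hyH := hcellH Q hQ p hpQ.1 hp.2 hy
    have hlim : Tendsto (fun t : ℝ => p + (-t) • (y - p)) (𝓝[>] 0) (𝓝 p) := by
      have : Continuous fun t : ℝ => p + (-t) • (y - p) := by fun_prop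
      simpa using (this.tendsto 0).mono_left (nhdsWithin_le_nhds (s := Set.Ioi 0))
    obtain ⟨t, ht, ht0⟩ := ((hlim.eventually (hW.mem_nhds hpW)).and self_mem_nhdsWithin).exists
    have ht0 : 0 < t := ht0
    have hmem := hWH ⟨ht, hHline p hp.1 y hyH (-t)⟩
    have hex := (hC.inter_face Q hQ Q' hQ' ⟨p, hpQ⟩).1
    refine (hex.isExtreme.left_mem_of_mem_openSegment hy hmem.1 hpQ
      ⟨t / (1 + t), 1 / (1 + t), by positivity, by positivity, by field_simp; ring, ?_⟩).2
    ext i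
    simp only [Pi.add_apply, Pi.smul_apply, Pi.sub_apply, smul_eq_mul]
    field_simp
    ring
  have hnhds : ∀ p ∈ H ∩ N, ∃ Q ∈ K₀, ∃ W, IsOpen W ∧ p ∈ W ∧ W ∩ H ⊆ Q := by
    intro p hp
    obtain ⟨K, hK, P, hP, W, hW, hpW, hWP⟩ :=
      exists_structure_with_interior_point hΩ hres hH hN hΩN hp
    obtain ⟨Q, hQ, hPQ⟩ := hcoarse K hK P hP
    exact ⟨Q, hQ, W, hW, hpW, hWP.trans hPQ⟩
  obtain ⟨u, hu⟩ := hconn.nonempty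
  obtain ⟨Q₀, hQ₀, W₀, hW₀, huW₀, hW₀Q⟩ := hnhds u hu
  refine ⟨Q₀, hQ₀, ?_⟩
  by_contra hcon
  obtain ⟨y, hy, hyQ⟩ := Set.not_subset.1 hcon
  let A : Set (Fin 3 → ℝ) := ⋃₀ {W | IsOpen W ∧ W ∩ H ⊆ Q₀}
  let B : Set (Fin 3 → ℝ) := ⋃₀ {W | IsOpen W ∧ ∃ Q ∈ K₀, Q ≠ Q₀ ∧ W ∩ H ⊆ Q}
  have hA : IsOpen A := isOpen_sUnion fun W hW => hW.1
  have hB : IsOpen B := isOpen_sUnion fun W hW => hW.1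
  have hcover : H ∩ N ⊆ A ∪ B := by
    intro p hp
    obtain ⟨Q, hQ, W, hW, hpW, hWQ⟩ := hnhds p hp
    by_cases h : Q = Q₀
    · exact Or.inl ⟨W, ⟨hW, h ▸ hWQ⟩, hpW⟩
    · exact Or.inr ⟨W, ⟨hW, Q, hQ, h, hWQ⟩, hpW⟩
  have hyB : y ∈ B := by
    rcases hcover hy with ⟨W, ⟨hW, hWQ⟩, hyW⟩ | h
    · exact absurd (hWQ ⟨hyW, hy.1⟩) hyQ
    · exact h
  obtain ⟨p, hp, ⟨W, ⟨hW, hWQ⟩, hpW⟩, W', ⟨hW', Q, hQ, hne, hWQ'⟩, hpW'⟩ :=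
    hconn.isPreconnected A B hA hB hcover ⟨u, hu, W₀, ⟨hW₀, hW₀Q⟩, huW₀⟩ ⟨y, hy, hyB⟩
  refine hne (Set.Subset.antisymm ?_ ?_)
  · exact hle Q hQ Q₀ hQ₀ p hp (W ∩ W') (hW.inter hW') ⟨hpW, hpW'⟩
      fun x hx => ⟨hWQ' ⟨hx.1.2, hx.2⟩, hWQ ⟨hx.1.1, hx.2⟩⟩
  · exact hle Q₀ hQ₀ Q hQ p hp (W ∩ W') (hW.inter hW') ⟨hpW, hpW'⟩
      fun x hx => ⟨hWQ ⟨hx.1.1, hx.2⟩, hWQ' ⟨hx.1.2, hx.2⟩⟩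

/-- A set has no coarsest polyhedral structure if some open set meets it in a connected, but not
convex, part of a rational plane. -/
theorem not_hasCoarsest (hΩ : IsClosed Ω) (hres : IsResolvable Ω)
    (hH : ∀ x ∈ H, ∀ y, y ∈ H ↔ ∃ α β : ℝ, y = x + α • ratVec v + β • ratVec w)
    (hN : IsOpen N) (hΩN : Ω ∩ N = H ∩ N) (hconn : IsConnected (H ∩ N))
    {x y z : Fin 3 → ℝ} (hx : x ∈ H ∩ N) (hy : y ∈ H ∩ N) (hz : z ∈ segment ℝ x y) (hzΩ : z ∉ Ω) :
    ¬ HasCoarsest (polyhedralStructures Ω) ∧ ¬ HasCoarsest (rationalPolyhedralStructures Ω) := by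
  have key : ∀ K₀ ∈ polyhedralStructures Ω,
      ¬ ∀ K ∈ rationalPolyhedralStructures Ω, ∀ P ∈ K, ∃ Q ∈ K₀, P ⊆ Q := by
    intro K₀ hK₀ hcoarse
    obtain ⟨Q, hQ, hsub⟩ := exists_cell_superset hΩ hres hH hN hΩN hconn hK₀ hcoarse
    exact hzΩ (hK₀.2 ▸ Set.subset_sUnion_of_mem hQ
      ((hK₀.1.polyhedron Q hQ).convex.segment_subset (hsub hx) (hsub hy) hz))
  refine ⟨?_, ?_⟩
  · rintro ⟨K₀, hK₀, h⟩
    exact key K₀ hK₀ fun K hK => h K hK.1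
  · rintro ⟨K₀, hK₀, h⟩
    exact key K₀ hK₀.1 h

end plane

end Tritangent

namespace Tritangent

/-! ### A smooth curve with a class without coarsest structure -/

/-- For integral coefficients `A`: the height of the lifted point over `r` above the plane through
the lifted points over `m, n, k`, scaled by twice the signed area of this triangle. -/
def liftDet (A : Expo → ℤ) (m n k r : Expo) : ℤ :=
  triDet m n k * (A r - A m) - triDet m r k * (A n - A m) - triDet m n r * (A k - A m)

theorem triDet_mul_sub (A : Expo → ℤ) {m n k : Expo} (r : Expo) {p : ℝ × ℝ}
    (hn : monomialVal (fun m => A m) n p = monomialVal (fun m => A m) m p)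
    (hk : monomialVal (fun m => A m) k p = monomialVal (fun m => A m) m p) :
    (triDet m n k : ℝ) * (monomialVal (fun m => A m) r p - monomialVal (fun m => A m) m p) =
      liftDet A m n k r := by
  have h : (triDet m n k : ℝ) *
      (monomialVal (fun m => A m) r p - monomialVal (fun m => A m) m p) = liftDet A m n k r +
      triDet m r k * (monomialVal (fun m => A m) n p - monomialVal (fun m => A m) m p) +
      triDet m n r * (monomialVal (fun m => A m) k p - monomialVal (fun m => A m) m p) := by
    simp only [monomialVal, liftDet, triDet]
    push_cast
    ring
  rw [h, hn, hk]
  ring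

/-- A criterion for smoothness with integral coefficients: for each lattice triangle, either the
plane through the lifted vertices passes below some lifted lattice point, so that the triangle is
not part of the subdivision, or the triangle is unimodular and all other lifted points lie strictly
below this plane. It suffices to consider positively oriented triangles that start at a leftmost
vertex. -/
theorem isSmooth_of_forall_triangle (A : Expo → ℤ)
    (h : ∀ m n k : Expo, m.1 ≤ n.1 → m.1 ≤ k.1 → 0 < triDet m n k →
      (∃ r, 0 < liftDet A m n k r) ∨
        triDet m n k = 1 ∧ ∀ r, r = m ∨ r = n ∨ r = k ∨ liftDet A m n k r < 0) :
    IsSmooth fun m => A m := by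
  intro p
  have hpos : ∀ m ∈ active (fun m => (A m : ℝ)) p, ∀ n ∈ active (fun m => (A m : ℝ)) p,
      ∀ k ∈ active (fun m => (A m : ℝ)) p, m.1 ≤ n.1 → m.1 ≤ k.1 → 0 < triDet m n k →
      |triDet m n k| = 1 ∧ active (fun m => (A m : ℝ)) p = {m, n, k} := by
    intro m hm n hn k hk hmn hmk hD
    have hD' : (0 : ℝ) < triDet m n k := by exact_mod_cast hD
    have hval := fun r => triDet_mul_sub A r (val_eq_of_mem_active hn hm)
      (val_eq_of_mem_active hk hm)
    rcases h m n k hmn hmk hD with ⟨r, hr⟩ | ⟨h1, hr⟩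
    · have hr' : (0 : ℝ) < liftDet A m n k r := by exact_mod_cast hr
      rw [← hval] at hr'
      have := mem_active.1 hm r
      nlinarith
    · refine ⟨by rw [h1, abs_one], ?_⟩
      ext r
      simp only [Finset.mem_insert, Finset.mem_singleton]
      constructor
      · intro hract
        rcases hr r with hr | hr | hr | hr
        · exact Or.inl hr
        · exact Or.inr (Or.inl hr)
        · exact Or.inr (Or.inr hr)
        · have hr' : (liftDet A m n k r : ℝ) < 0 := by exact_mod_cast hr
          rw [← hval, val_eq_of_mem_active hract hm, sub_self, mul_zero] at hr'
          exact absurd hr' (lt_irrefl _)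
      · rintro (rfl | rfl | rfl) <;> assumption
  have hleft : ∀ m ∈ active (fun m => (A m : ℝ)) p, ∀ n ∈ active (fun m => (A m : ℝ)) p,
      ∀ k ∈ active (fun m => (A m : ℝ)) p, m.1 ≤ n.1 → m.1 ≤ k.1 → triDet m n k ≠ 0 →
      |triDet m n k| = 1 ∧ active (fun m => (A m : ℝ)) p = {m, n, k} := by
    intro m hm n hn k hk hmn hmk hD
    rcases lt_or_gt_of_ne hD with h0 | h0
    · have hswap : triDet m k n = -triDet m n k := by simp only [triDet]; ring
      have := hpos m hm k hk n hn hmk hmn (by rw [hswap]; exact neg_pos.2 h0)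
      rwa [hswap, abs_neg, Finset.pair_comm k n] at this
    · exact hpos m hm n hn k hk hmn hmk h0
  intro m hm n hn k hk hD
  have hrot : ∀ m n k : Expo, triDet n k m = triDet m n k := by
    intro m n k; simp only [triDet]; ring
  have hset : ∀ m n k : Expo, ({n, k, m} : Finset Expo) = {m, n, k} := by
    intro m n k; ext; simp only [Finset.mem_insert, Finset.mem_singleton]; tauto
  have hcases : (m.1 ≤ n.1 ∧ m.1 ≤ k.1) ∨ (n.1 ≤ k.1 ∧ n.1 ≤ m.1) ∨ (k.1 ≤ m.1 ∧ k.1 ≤ n.1) := by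
    omega
  rcases hcases with ⟨h1, h2⟩ | ⟨h1, h2⟩ | ⟨h1, h2⟩
  · exact hleft m hm n hn k hk h1 h2 hD
  · have := hleft n hn k hk m hm h1 h2 (by rwa [hrot])
    rwa [hrot m n k, hset m n k] at this
  · have := hleft k hk m hm n hn h1 h2 (by rwa [hrot n k m, hrot m n k])
    rwa [hrot n k m, hrot m n k, hset n k m, hset m n k] at this

/-- The coefficients of the example. -/
def exampleCoeff (m : Expo) : ℤ :=
  ![![-1, -7, -22, -45], ![1, -8, -20, -44], ![-7, -12, -23, -49], ![-16, -19, -32, -60]] m.1 m.2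

/-- The tropical polynomial of the example. -/
noncomputable def exampleCurve (m : Expo) : ℝ := exampleCoeff m

theorem isSmooth_exampleCurve : IsSmooth exampleCurve := by
  refine isSmooth_of_forall_triangle exampleCoeff ?_
  decide +kernel

end Tritangent

namespace Tritangent

section

variable {m : Expo} {p : ℝ × ℝ}

theorem eq_of_active_eq_singleton {a : Expo → ℝ} {m₀ : Expo} (hm : active a p = {m})
    (h : ∀ n, monomialVal a n p ≤ monomialVal a m₀ p) : m = m₀ := by
  have := mem_active.2 h
  rw [hm, Finset.mem_singleton] at this
  exact this.symm

theorem example_val_le_zero_zero (h1 : p.1 ≤ -2) (h2 : p.2 ≤ 6) (n : Expo) :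
    monomialVal exampleCurve n p ≤ monomialVal exampleCurve (0, 0) p := by
  obtain ⟨i, j⟩ := n
  fin_cases i <;> fin_cases j <;> simp [monomialVal, exampleCurve, exampleCoeff] <;> linarith

theorem example_val_le_one_zero (h1 : -2 ≤ p.1) (h2 : p.2 ≤ 6) (h3 : p.1 ≤ 8)
    (h4 : 2 * p.1 + p.2 ≤ 20) (n : Expo) :
    monomialVal exampleCurve n p ≤ monomialVal exampleCurve (1, 0) p := by
  obtain ⟨i, j⟩ := n
  fin_cases i <;> fin_cases j <;> simp [monomialVal, exampleCurve, exampleCoeff] <;> linarith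

theorem example_val_le_three_one (h1 : 4 ≤ p.2) (h2 : p.2 ≤ 6) (h3 : 20 ≤ 2 * p.1 + p.2)
    (n : Expo) : monomialVal exampleCurve n p ≤ monomialVal exampleCurve (3, 1) p := by
  obtain ⟨i, j⟩ := n
  fin_cases i <;> fin_cases j <;> simp [monomialVal, exampleCurve, exampleCoeff] <;> linarith

theorem example_val_le_zero_one (h1 : p.1 = -2) (h2 : 6 ≤ p.2) (h3 : p.2 ≤ 15) (n : Expo) :
    monomialVal exampleCurve n p ≤ monomialVal exampleCurve (0, 1) p := by
  obtain ⟨i, j⟩ := n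
  fin_cases i <;> fin_cases j <;> simp [monomialVal, exampleCurve, exampleCoeff] <;> linarith

theorem example_val_le_zero_two (h1 : p.1 ≤ -2) (h2 : 15 ≤ p.2) (h3 : p.2 ≤ 23) (n : Expo) :
    monomialVal exampleCurve n p ≤ monomialVal exampleCurve (0, 2) p := by
  obtain ⟨i, j⟩ := n
  fin_cases i <;> fin_cases j <;> simp [monomialVal, exampleCurve, exampleCoeff] <;> linarith

theorem example_val_le_one_two (h1 : p.1 = -2) (h2 : 15 ≤ p.2) (h3 : p.2 ≤ 23) (n : Expo) :
    monomialVal exampleCurve n p ≤ monomialVal exampleCurve (1, 2) p := by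
  obtain ⟨i, j⟩ := n
  fin_cases i <;> fin_cases j <;> simp [monomialVal, exampleCurve, exampleCoeff] <;> linarith

theorem example_val_le_zero_three (h1 : p.1 = -2) (h2 : 23 ≤ p.2) (n : Expo) :
    monomialVal exampleCurve n p ≤ monomialVal exampleCurve (0, 3) p := by
  obtain ⟨i, j⟩ := n
  fin_cases i <;> fin_cases j <;> simp [monomialVal, exampleCurve, exampleCoeff] <;> linarith

/-- The plane containing the exhibited part of the class: the upper leg runs along the vertical line
through an edge of the curve. -/
def examplePlane : Set (Fin 3 → ℝ) := {q | q 0 + q 2 = -2}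

/-- An open set meeting `examplePlane` in a nonconvex region, with a reflex corner at
`(-2, 4, 0)`. -/
def exampleNhd : Set (Fin 3 → ℝ) :=
  {q | |q 0 + q 2 + 2| < 1 / 2} ∩ {q | |q 2| < 1 / 2} ∩ {q | q 1 < 5} ∩
    ({q | 4 < q 1} ∪ {q | 4 < q 1 + q 2})

theorem isOpen_exampleNhd : IsOpen exampleNhd := by
  refine IsOpen.inter (IsOpen.inter (IsOpen.inter ?_ ?_) ?_) (IsOpen.union ?_ ?_) <;>
    exact isOpen_lt (by fun_prop) (by fun_prop)

theorem mem_examplePlane_iff {x : Fin 3 → ℝ} (hx : x ∈ examplePlane) (y : Fin 3 → ℝ) :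
    y ∈ examplePlane ↔ ∃ α β : ℝ, y = x + α • ratVec ![0, 1, 0] + β • ratVec ![1, 0, -1] := by
  simp only [examplePlane, Set.mem_ofPred_eq] at hx ⊢
  constructor
  · intro hy
    refine ⟨y 1 - x 1, y 0 - x 0, ?_⟩
    ext i
    fin_cases i <;> simp [ratVec]
    linarith
  · rintro ⟨α, β, rfl⟩
    simp [ratVec]
    linarith

theorem isConnected_examplePlane_inter_nhd : IsConnected (examplePlane ∩ exampleNhd) := by
  have hmem : ∀ q : Fin 3 → ℝ, q ∈ examplePlane ∩ exampleNhd ↔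
      q ∈ ({q | q 0 + q 2 = -2} ∩ {q | |q 2| < 1 / 2} ∩ {q | q 1 < 5} ∩ {q | 4 < q 1}) ∪
        ({q | q 0 + q 2 = -2} ∩ {q | |q 2| < 1 / 2} ∩ {q | q 1 < 5} ∩ {q | 4 < q 1 + q 2} :
          Set (Fin 3 → ℝ)) := by
    intro q
    simp only [examplePlane, exampleNhd, Set.mem_inter_iff, Set.mem_union, Set.mem_ofPred_eq]
    constructor
    · rintro ⟨h0, ⟨⟨-, h1⟩, h2⟩, h3 | h3⟩
      · exact Or.inl ⟨⟨⟨h0, h1⟩, h2⟩, h3⟩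
      · exact Or.inr ⟨⟨⟨h0, h1⟩, h2⟩, h3⟩
    · rintro (⟨⟨⟨h0, h1⟩, h2⟩, h3⟩ | ⟨⟨⟨h0, h1⟩, h2⟩, h3⟩)
      · exact ⟨h0, ⟨⟨by rw [h0]; norm_num, h1⟩, h2⟩, Or.inl h3⟩
      · exact ⟨h0, ⟨⟨by rw [h0]; norm_num, h1⟩, h2⟩, Or.inr h3⟩
  have hconv : ∀ c : ℝ, Convex ℝ
      ({q | q 0 + q 2 = -2} ∩ {q | |q 2| < 1 / 2} ∩ {q | q 1 < 5} ∩ {q | 4 < q 1 + c * q 2} :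
        Set (Fin 3 → ℝ)) := by
    rintro c x ⟨⟨⟨x0, x1⟩, x2⟩, x3⟩ y ⟨⟨⟨y0, y1⟩, y2⟩, y3⟩ s t hs ht hst
    simp only [Set.mem_ofPred_eq, abs_lt] at x0 x1 x2 x3 y0 y1 y2 y3
    have key : ∀ a b k : ℝ, a < k → b < k → s * a + t * b < k := by
      intro a b k ha hb
      rcases hs.eq_or_lt with h | h
      · have : t = 1 := by linarith
        rw [← h, this]; linarith
      · have : s * k + t * k = k := by rw [← add_mul, hst, one_mul]
        nlinarith [mul_lt_mul_of_pos_left ha h, mul_le_mul_of_nonneg_left hb.le ht]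
    refine ⟨⟨⟨?_, ?_⟩, ?_⟩, ?_⟩ <;>
      simp only [Set.mem_ofPred_eq, Pi.add_apply, Pi.smul_apply, smul_eq_mul]
    · linear_combination s * x0 + t * y0 - 2 * hst
    · rw [abs_lt]
      exact ⟨by linarith [key _ _ (1 / 2) (neg_lt.1 x1.1) (neg_lt.1 y1.1)], key _ _ _ x1.2 y1.2⟩
    · exact key _ _ _ x2 y2
    · linarith [key _ _ _ (neg_lt_neg (show (4 : ℝ) < _ from x3))
        (neg_lt_neg (show (4 : ℝ) < _ from y3))]
  rw [Set.ext hmem]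
  have h0 := hconv 0
  have h1 := hconv 1
  simp only [zero_mul, add_zero, one_mul] at h0 h1
  have hq : ∀ s : Set (Fin 3 → ℝ), s = {q | q 0 + q 2 = -2} ∩ {q | |q 2| < 1 / 2} ∩ {q | q 1 < 5} →
      (![-2, 9 / 2, 0] : Fin 3 → ℝ) ∈ s := by
    rintro _ rfl
    refine ⟨⟨by simp, by simp⟩, ?_⟩
    simp
    norm_num
  have hq1 : (![-2, 9 / 2, 0] : Fin 3 → ℝ) ∈ {q : Fin 3 → ℝ | 4 < q 1} := by
    simp; norm_num
  have hq2 : (![-2, 9 / 2, 0] : Fin 3 → ℝ) ∈ {q : Fin 3 → ℝ | 4 < q 1 + q 2} := by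
    simp; norm_num
  exact IsConnected.union ⟨_, ⟨hq _ rfl, hq1⟩, hq _ rfl, hq2⟩
    ⟨⟨_, hq _ rfl, hq1⟩, h0.isPreconnected⟩ ⟨⟨_, hq _ rfl, hq2⟩, h1.isPreconnected⟩

theorem isParityGood_of_mem_examplePlane {q : Fin 3 → ℝ} (hq : q ∈ examplePlane ∩ exampleNhd) :
    IsParityGood exampleCurve q := by
  obtain ⟨h0, ⟨⟨-, h1⟩, h2⟩, h3⟩ := hq
  simp only [examplePlane, Set.mem_ofPred_eq, Set.mem_union] at h0 h1 h2 h3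
  have hx : q 0 = -2 - q 2 := by linarith
  rw [abs_lt] at h1
  intro e t ht hlt m hm
  -- The coordinates of the points of the edge, and the position of the vertices.
  have hright : 4 < (base q .right).2 ∧ (base q .right).2 < 6 ∧ -2 ≤ (base q .right).1 := by
    rcases le_or_gt 0 (q 2) with h | h
    · simp only [base, h, if_true, v₁, abs_of_nonneg h]
      refine ⟨?_, by linarith, by linarith⟩
      rcases h3 with h3 | h3 <;> linarith
    · simp only [base, not_le.2 h, if_false, v₀]
      refine ⟨?_, by linarith, by linarith⟩
      rcases h3 with h3 | h3 <;> linarith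
  have hleft : (base q .left).2 < 6 ∧ (base q .left).1 ≤ -2 := by
    rcases le_or_gt 0 (q 2) with h | h
    · simp only [base, h, if_true, v₀]
      constructor <;> linarith
    · simp only [base, not_le.2 h, if_false, v₁, abs_of_neg h]
      constructor <;> linarith
  have hmid : e = .mid → t < |q 2| := by
    rintro rfl; simpa [len] using hlt
  cases e
  case left =>
    have hX : (pt q .left t).1 = (base q .left).1 - t := by
      simp [pt, dir, vec, sub_eq_add_neg]
    have hY : (pt q .left t).2 = (base q .left).2 := by simp [pt, dir, vec]
    have := eq_of_active_eq_singleton hm (example_val_le_zero_zero (by linarith) (by linarith))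
    subst this
    simp only [dir, par]
    decide
  case right =>
    have hX : (pt q .right t).1 = (base q .right).1 + t := by simp [pt, dir, vec]
    have hY : (pt q .right t).2 = (base q .right).2 := by simp [pt, dir, vec]
    rcases le_total (2 * (pt q .right t).1 + (pt q .right t).2) 20 with h | h
    · have := eq_of_active_eq_singleton hm
        (example_val_le_one_zero (by linarith) (by linarith) (by linarith) h)
      subst this
      simp only [dir, par]
      decide
    · have := eq_of_active_eq_singleton hm (example_val_le_three_one (by linarith) (by linarith) h)
      subst this
      simp only [dir, par]
      decide
  case down =>
    have hX : (pt q .down t).1 = q 0 := by simp [pt, dir, vec, base, v₀]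
    have hY : (pt q .down t).2 = q 1 - t := by
      simp [pt, dir, vec, base, v₀, sub_eq_add_neg]
    rcases le_total (q 0) (-2) with h | h
    · have := eq_of_active_eq_singleton hm (example_val_le_zero_zero (by linarith) (by linarith))
      subst this
      simp only [dir, par]
      decide
    · have := eq_of_active_eq_singleton hm
        (example_val_le_one_zero (by linarith) (by linarith) (by linarith) (by linarith))
      subst this
      simp only [dir, par]
      decide
  case up =>
    have hX : (pt q .up t).1 = -2 := by simp [pt, dir, vec, base, v₁, h0]
    have hY : 4 < (pt q .up t).2 := by
      simp only [pt, dir, vec, base, v₁, Prod.snd_add, Prod.smul_snd, smul_eq_mul, Int.cast_one,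
        mul_one]
      rcases h3 with h3 | h3
      · linarith [abs_nonneg (q 2)]
      · linarith [le_abs_self (q 2)]
    rcases le_total (pt q .up t).2 6 with h | h
    · have e1 := eq_of_active_eq_singleton hm (example_val_le_zero_zero hX.le h)
      have e2 := eq_of_active_eq_singleton hm
        (example_val_le_one_zero hX.ge h (by linarith) (by linarith))
      rw [e1] at e2
      exact absurd e2 (by decide)
    rcases le_total (pt q .up t).2 15 with h' | h'
    · have := eq_of_active_eq_singleton hm (example_val_le_zero_one hX h h')
      subst this
      simp only [dir, par]
      decide
    rcases le_total (pt q .up t).2 23 with h'' | h''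
    · have e1 := eq_of_active_eq_singleton hm (example_val_le_zero_two hX.le h' h'')
      have e2 := eq_of_active_eq_singleton hm (example_val_le_one_two hX h' h'')
      rw [e1] at e2
      exact absurd e2 (by decide)
    · have := eq_of_active_eq_singleton hm (example_val_le_zero_three hX h'')
      subst this
      simp only [dir, par]
      decide
  case mid =>
    have hmid := hmid rfl
    rcases le_or_gt 0 (q 2) with h | h
    · rw [abs_of_nonneg h] at hmid
      have hX : (pt q .mid t).1 = q 0 + t := by simp [pt, dir, vec, base, v₀, h]
      have hY : (pt q .mid t).2 = q 1 + t := by simp [pt, dir, vec, base, v₀, h]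
      have := eq_of_active_eq_singleton hm (example_val_le_zero_zero (by linarith) (by linarith))
      subst this
      simp only [dir, par, h, if_true]
      decide
    · rw [abs_of_neg h] at hmid
      have hX : (pt q .mid t).1 = q 0 - t := by
        simp [pt, dir, vec, base, v₀, not_le.2 h, sub_eq_add_neg]
      have hY : (pt q .mid t).2 = q 1 + t := by simp [pt, dir, vec, base, v₀, not_le.2 h]
      have := eq_of_active_eq_singleton hm
        (example_val_le_one_zero (by linarith) (by linarith) (by linarith) (by linarith))
      subst this
      simp only [dir, par, not_le.2 h, if_false]
      decide

/-- Off the plane, the upper leg passes, at height `19`, through a region of slope two. -/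
theorem mem_examplePlane_of_isParityGood {q : Fin 3 → ℝ} (hq : q ∈ exampleNhd)
    (hgood : IsParityGood exampleCurve q) : q ∈ examplePlane := by
  obtain ⟨⟨⟨h0, h1⟩, h2⟩, -⟩ := hq
  simp only [Set.mem_ofPred_eq, abs_lt] at h0 h1 h2
  have habs : |q 2| < 1 / 2 := abs_lt.2 h1
  have ht : 0 < 19 - (q 1 + |q 2|) := by linarith
  have hpt : pt q .up (19 - (q 1 + |q 2|)) = (q 0 + q 2, 19) := by
    ext <;> simp [pt, dir, vec, base, v₁]
  have key := hgood .up _ ht (EReal.coe_lt_top _)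
  rw [hpt] at key
  by_contra hne
  rcases lt_or_gt_of_ne hne with h | h
  · have hact : active exampleCurve (q 0 + q 2, 19) = {(0, 2)} := by
      rw [active_eq_singleton_iff]
      rintro ⟨i, j⟩ hn
      fin_cases i <;> fin_cases j <;>
        simp [monomialVal, exampleCurve, exampleCoeff] at hn ⊢ <;> linarith
    have := key _ hact
    simp only [dir, par] at this
    exact absurd this (by decide)
  · have hact : active exampleCurve (q 0 + q 2, 19) = {(1, 2)} := by
      rw [active_eq_singleton_iff]
      rintro ⟨i, j⟩ hn
      fin_cases i <;> fin_cases j <;>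
        simp [monomialVal, exampleCurve, exampleCoeff] at hn ⊢ <;> linarith
    have := key _ hact
    simp only [dir, par] at this
    exact absurd this (by decide)

/-- A point of the plane beyond the reflex corner: its right leg passes through a region of slope
two. -/
theorem not_isParityGood_example : ¬ IsParityGood exampleCurve ![-2, 63 / 16, 0] := by
  intro hgood
  have key := hgood .right (10 + 1 / 32) (by norm_num) (EReal.coe_lt_top _)
  have hpt : pt ![-2, 63 / 16, 0] .right (10 + 1 / 32) = (8 + 1 / 32, 63 / 16) := by
    ext <;> simp [pt, dir, vec, base, v₁]
    norm_num
  rw [hpt] at key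
  have hact : active exampleCurve (8 + 1 / 32, 63 / 16) = {(2, 0)} := by
    rw [active_eq_singleton_iff]
    rintro ⟨i, j⟩ hn
    fin_cases i <;> fin_cases j <;>
      simp [monomialVal, exampleCurve, exampleCoeff] at hn ⊢ <;> norm_num
  have := key _ hact
  simp only [dir, par] at this
  exact absurd this (by decide)

end

/-- The class of the example: near `(-2, 4, 0)` it is a nonconvex region of a plane. -/
theorem exists_class_not_hasCoarsest :
    ∃ Ω ∈ tritangentClasses exampleCurve, ¬ HasCoarsest (polyhedralStructures Ω) ∧
      ¬ HasCoarsest (rationalPolyhedralStructures Ω) := by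
  have hconn := isConnected_examplePlane_inter_nhd
  obtain ⟨q, hq⟩ := hconn.nonempty
  have hsub : examplePlane ∩ exampleNhd ⊆ {q | IsTritangent exampleCurve q} :=
    fun x hx => isTritangent_iff.2 (isParityGood_of_mem_examplePlane hx)
  obtain ⟨Φ, hΦ⟩ := isResolvable_setOf_isTritangent exampleCurve
  obtain ⟨hcl, hres⟩ :=
    component_isClosed_resolves (isClosed_setOf_isTritangent exampleCurve) hΦ (x := q)
  refine ⟨_, ⟨q, hsub hq, rfl⟩, ?_⟩
  refine not_hasCoarsest hcl ⟨Φ, hres⟩ (fun x hx => mem_examplePlane_iff hx) isOpen_exampleNhd ?_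
    hconn (x := ![-9 / 4, 61 / 16, 1 / 4]) (y := ![-7 / 4, 65 / 16, -1 / 4])
    (z := ![-2, 63 / 16, 0]) ?_ ?_ ?_ ?_
  · ext x
    constructor
    · rintro ⟨hx, hxN⟩
      exact ⟨mem_examplePlane_of_isParityGood hxN
        (isTritangent_iff.1
          (connectedComponentIn_subset {q | IsTritangent exampleCurve q} _ hx)), hxN⟩
    · intro hx
      exact ⟨hconn.isPreconnected.subset_connectedComponentIn hq hsub hx, hx.2⟩
  · refine ⟨?_, ⟨⟨?_, ?_⟩, ?_⟩, Or.inr ?_⟩ <;>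
      simp [examplePlane, abs_lt] <;> norm_num
  · refine ⟨?_, ⟨⟨?_, ?_⟩, ?_⟩, Or.inl ?_⟩ <;>
      simp [examplePlane, abs_lt] <;> norm_num
  · refine ⟨1 / 2, 1 / 2, by norm_num, by norm_num, by norm_num, ?_⟩
    ext i
    fin_cases i <;> simp <;> norm_num
  · exact fun hz => not_isParityGood_example
      (isTritangent_iff.1 (connectedComponentIn_subset {q | IsTritangent exampleCurve q} _ hz))

end Tritangent

theorem theorem1p2 :
    (∀ a : Tritangent.Expo → ℝ, Tritangent.IsSmooth a →
      ∀ Ω ∈ Tritangent.tritangentClasses a,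
        (IsConnected Ω ∧ (Tritangent.rationalPolyhedralStructures Ω).Nonempty) ∧
        (IsConnected (Tritangent.segre ⁻¹' Ω) ∧
          (Tritangent.rationalPolyhedralStructures (Tritangent.segre ⁻¹' Ω)).Nonempty)) ∧
    (∃ a : Tritangent.Expo → ℝ, Tritangent.IsSmooth a ∧
      ∃ Ω ∈ Tritangent.tritangentClasses a,
        ¬ Tritangent.HasCoarsest (Tritangent.polyhedralStructures Ω) ∧
        ¬ Tritangent.HasCoarsest (Tritangent.rationalPolyhedralStructures Ω)) := by
  refine ⟨fun a _ Ω hΩ => ?_, ?_⟩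
  · obtain ⟨Φ, hΦ⟩ := Tritangent.isResolvable_setOf_isTritangent a
    exact Tritangent.connected_and_polyhedral_of_resolves
      (Tritangent.isClosed_setOf_isTritangent a) hΦ hΩ
  · exact ⟨Tritangent.exampleCurve, Tritangent.isSmooth_exampleCurve,
      Tritangent.exists_class_not_hasCoarsest⟩
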